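/- For each positive integer $n$ let $K_n, P_n$ be positive integers and $r_n > 0$ a real number. Let $G(P_n,K_n,r_n)$ be the random graph on the nodes $1,\dots,n$ defined as follows: the locations $x_1,\dots,x_n$ are independent and uniformly distributed in $[0,1]^2$; independently of these, $S_1,\dots,S_n$ are independent and uniformly distributed among the subsets of size $K_n$ of a fixed pool of $P_n$ keys; distinct nodes $i,j$ are adjacent if and only if $\|x_i-x_j\|\le r_n$ (Euclidean norm) and $S_i\cap S_j\neq\emptyset$. Let $\sigma>0$ be a constant. Assume that $r_n\to 0$, $K_n\to\infty$, $P_n\to\infty$ and $K_n^2/P_n\to 0$ as $n\to\infty$, and that $K_n\ge 2$, $P_n\ge 2K_n$ and $P_n\ge\sigma n r_n^2$ for all sufficiently large $n$. (i) If, for a constant $0<c_1<\infty$, $\pi r_n^2\,\dfrac{K_n^2}{P_n}=\dfrac{\log n+c_1}{n}$ for all sufficiently large $n$, then $$\liminf_{n\to\infty}\Pr\bigl(G(P_n,K_n,r_n)\text{ is disconnected}\bigr)\ \ge\ \frac{e^{-c_1}}{4}.$$ (ii) If, for some $0<\delta<1$, $\pi r_n^2\,\dfrac{K_n^2}{P_n}>\dfrac{2\pi}{1-\delta}\,\dfrac{\log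 n}{n}$ for all sufficiently large $n$, then there are constants $0<c_2<\infty$ and $c_3>0$ such that $$\Pr\bigl(G(P_n,K_n,r_n)\text{ is connected}\bigr)\ \ge\ 1-\frac{c_2}{n^{c_3}}\qquad\text{for all sufficiently large } n,$$ and consequently $\Pr\bigl(G(P_n,K_n,r_n)\text{ is connected}\bigr)\to 1$ as $n\to\infty$. -/

import Mathlib

open MeasureTheory ProbabilityTheory Filter Topology

noncomputable section

/-- The unit square `[0,1]²` in the Euclidean plane. -/
def unitSquare : Set (EuclideanSpace ℝ (Fin 2)) :=
  {x | ∀ i, x i ∈ Set.Icc (0 : ℝ) 1}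

/-- Key rings: subsets of size `K` of a pool of `P` keys. -/
def KeyRing (P K : ℕ) : Type := {S : Finset (Fin P) // S.card = K}

instance KeyRing.instMeasurableSpace (P K : ℕ) : MeasurableSpace (KeyRing P K) := ⊤

/-- A node is given by its location and its key ring. -/
abbrev Node (P K : ℕ) : Type := EuclideanSpace ℝ (Fin 2) × KeyRing P K

/-- The law of one node: the location is uniform in the unit square, the key ring is uniform
among all `K`-subsets of the pool, and the two are independent. -/
def nodeLaw (P K : ℕ) : Measure (Node P K) :=
  ((volume : Measure (EuclideanSpace ℝ (Fin 2))).restrict unitSquare).prod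
    (uniformOn (Set.univ : Set (KeyRing P K)))

/-- The law of `n` independent nodes. -/
def networkLaw (n P K : ℕ) : Measure (Fin n → Node P K) :=
  Measure.pi fun _ => nodeLaw P K

/-- The intersection of the random geometric graph with cutoff `r` and the random key graph:
two distinct nodes are adjacent iff their distance is at most `r` and they share a key. -/
def keyGeometricGraph {n P K : ℕ} (r : ℝ) (ω : Fin n → Node P K) : SimpleGraph (Fin n) where
  Adj i j := i ≠ j ∧ dist (ω i).1 (ω j).1 ≤ r ∧ ((ω i).2.val ∩ (ω j).2.val).Nonempty
  symm := ⟨fun _ _ h => ⟨h.1.symm, by rw [dist_comm]; exact h.2.1,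
    by rw [Finset.inter_comm]; exact h.2.2⟩⟩
  loopless := ⟨fun _ h => h.1 rfl⟩

/-- The probability that the random graph with `n` nodes is connected. -/
def probConnected (n P K : ℕ) (r : ℝ) : ℝ :=
  (networkLaw n P K).real {ω | (keyGeometricGraph r ω).Connected}

/-- The probability that the random graph with `n` nodes is disconnected. -/
def probDisconnected (n P K : ℕ) (r : ℝ) : ℝ :=
  (networkLaw n P K).real {ω | ¬ (keyGeometricGraph r ω).Connected}

end

/-! Part (i) is a second moment argument for isolated nodes. Only nodes at distance about `r` or
more from the boundary are counted, so that a node is linked to another one with probability exactly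
`a = π r² p`, where `p = linkProb` lies between `x / (1 + x)` and `x = K² / P`. The mean number `t`
of such isolated nodes is then at least about `e^{-c}`. For a pair of isolated nodes there are three
cases. At distance beyond `2r` the two neighbourhoods are disjoint, and the contribution is close to
the product. If the nodes are near but their rings are disjoint, meeting the two rings is negatively
correlated (log-concavity of falling factorials), so the exponent is still `2 - p`, and nearness
costs a factor of order `r²`. If they are near and share a key, not being adjacent puts them at
distance more than `r`; their discs then cover an extra quarter of a disc, and the exponent `5/4`
beats `n² a`. Hence the second moment is at most `t + (3/2) t²` plus a small error, and `t² / s`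
bounds the probability of an isolated node (`networkLaw_real_isolatedInner_inter_le`,
`measureReal_iUnion_ge`, `second_moment_bound`).

Part (ii) reduces to random key graphs without geometry. Divide the square into boxes of side `1 /
L` with `L` about `√8 / r`. A block of two by two boxes has diameter at most `r`, so inside it
adjacency only means sharing a key. Neighbouring boxes lie in a common block; if no box is empty and
every block induces a connected key graph, the whole graph is connected (`connected_of_cells`). By
Chernoff bounds a block holds at least nearly `n r² / 2` nodes, so its key graph has mean degree at
least about `log n / (1 - δ)`.

A key graph on `m` nodes is disconnected only if some set of at most half of the nodes shares no key
with the rest. A set of `k` nodes holding nearly `k K` keys is isolated with probability at most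
about `e^{-kh}`, `h = m K² / P`, and these bounds sum to order `m e^{-h}`. Small sets holding few
keys are rare enough to survive the union bound; this uses that `P` is at least a constant times
`m`, and that `log K` is negligible against `K`. For larger sets, the keys of a subset of a fixed
size `k₀` already suffice to beat the `2^m` choices (`keysLaw_real_keySplit_le`). Summing over the
blocks costs a factor `L²`, and `L² m` is of order `n`, which leaves `n^{-δ/2}`. -/

set_option linter.unusedSectionVars false

noncomputable section

/-! ### Independent coordinates: conditioning and Chernoff bounds -/

section ProductMeasure

variable {ι α : Type*} [Fintype ι] [DecidableEq ι] [MeasurableSpace α]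

/-- If `B` and `R` do not depend on the coordinates in `t`, the coordinates in `t` are, given the
others, independent of each other. -/
theorem lmarginal_indicator_forall_mem (ν : Measure α) [IsProbabilityMeasure ν] (t : Finset ι)
    (B : Set (ι → α)) (R : (ι → α) → Set α)
    (hB : ∀ ω y, Function.updateFinset ω t y ∈ B ↔ ω ∈ B)
    (hR : ∀ ω y, R (Function.updateFinset ω t y) = R ω)
    (hmeas : MeasurableSet {ω | ω ∈ B ∧ ∀ k ∈ t, ω k ∈ R ω}) (ω : ι → α) :
    lmarginal (fun _ => ν) t ({ω | ω ∈ B ∧ ∀ k ∈ t, ω k ∈ R ω}.indicator 1) ω =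
      B.indicator (fun ω => ν (R ω) ^ t.card) ω := by
  unfold lmarginal
  have h1 : (fun y : (i : t) → α => ({ω | ω ∈ B ∧ ∀ k ∈ t, ω k ∈ R ω}.indicator
      (1 : (ι → α) → ENNReal)) (Function.updateFinset ω t y)) =
      ((fun y : (i : t) → α => Function.updateFinset ω t y) ⁻¹'
        {ω | ω ∈ B ∧ ∀ k ∈ t, ω k ∈ R ω}).indicator 1 := by
    ext y; rfl
  rw [h1, lintegral_indicator_one (measurable_updateFinset hmeas)]
  by_cases hω : ω ∈ B
  · have h2 : ((fun y : (i : t) → α => Function.updateFinset ω t y) ⁻¹'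
        {ω | ω ∈ B ∧ ∀ k ∈ t, ω k ∈ R ω}) = Set.pi Set.univ (fun _ => R ω) := by
      ext y
      simp only [Set.mem_preimage, Set.mem_ofPred_eq, hB, hω, true_and, hR, Set.mem_pi,
        Set.mem_univ, forall_const, Subtype.forall]
      refine forall₂_congr fun k hk => ?_
      simp [Function.updateFinset, hk]
    rw [h2, Measure.pi_pi]
    simp [hω]
  · have h2 : ((fun y : (i : t) → α => Function.updateFinset ω t y) ⁻¹'
        {ω | ω ∈ B ∧ ∀ k ∈ t, ω k ∈ R ω}) = ∅ := by
      ext y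
      simp [hB, hω]
    rw [h2]
    simp [hω]

theorem lmarginal_const_mul_indicator (ν : Measure α) [IsProbabilityMeasure ν] (t : Finset ι)
    (B : Set (ι → α)) (hB : ∀ ω y, Function.updateFinset ω t y ∈ B ↔ ω ∈ B) (c : ENNReal)
    (ω : ι → α) :
    lmarginal (fun _ => ν) t (B.indicator fun _ => c) ω = B.indicator (fun _ => c) ω := by
  unfold lmarginal
  have h1 : ∀ y : (i : t) → α, B.indicator (fun _ => c) (Function.updateFinset ω t y) =
      B.indicator (fun _ => c) ω := by
    intro y
    by_cases hω : ω ∈ B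
    · rw [Set.indicator_of_mem hω, Set.indicator_of_mem ((hB ω y).2 hω)]
    · rw [Set.indicator_of_notMem hω, Set.indicator_of_notMem (fun h => hω ((hB ω y).1 h))]
  simp [h1]

/-- Integrate out the coordinates in `t` first: with the others fixed, they fall into `R ω`
independently of each other. This is how the file conditions on some nodes, here and in the version
with equality below. -/
theorem pi_real_forall_mem_le (ν : Measure α) [IsProbabilityMeasure ν] (t : Finset ι)
    (B : Set (ι → α)) (R : (ι → α) → Set α)
    (hB : ∀ ω y, Function.updateFinset ω t y ∈ B ↔ ω ∈ B)
    (hR : ∀ ω y, R (Function.updateFinset ω t y) = R ω)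
    (hmeas : MeasurableSet {ω | ω ∈ B ∧ ∀ k ∈ t, ω k ∈ R ω}) (hBm : MeasurableSet B)
    {c : ℝ} (hc : ∀ ω ∈ B, ν.real (R ω) ≤ c) :
    (Measure.pi fun _ : ι => ν).real {ω | ω ∈ B ∧ ∀ k ∈ t, ω k ∈ R ω} ≤
      c ^ t.card * (Measure.pi fun _ : ι => ν).real B := by
  rcases B.eq_empty_or_nonempty with rfl | ⟨ω₀, hω₀⟩
  · simp
  have hc0 : 0 ≤ c := measureReal_nonneg.trans (hc ω₀ hω₀)
  have key := lintegral_le_of_lmarginal_le (μ := fun _ : ι => ν) t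
    (f := {ω | ω ∈ B ∧ ∀ k ∈ t, ω k ∈ R ω}.indicator 1)
    (g := B.indicator fun _ => ENNReal.ofReal c ^ t.card)
    (measurable_one.indicator hmeas) (measurable_const.indicator hBm) (by
      intro ω
      rw [lmarginal_indicator_forall_mem ν t B R hB hR hmeas,
        lmarginal_const_mul_indicator ν t B hB]
      by_cases hω : ω ∈ B
      · rw [Set.indicator_of_mem hω, Set.indicator_of_mem hω]
        gcongr
        rw [← ENNReal.ofReal_toReal (measure_ne_top ν (R ω))]
        exact ENNReal.ofReal_le_ofReal (hc ω hω)
      · simp [hω])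
  rw [lintegral_indicator_one hmeas, lintegral_indicator_const hBm] at key
  have := ENNReal.toReal_mono (by finiteness) key
  simpa [Measure.real, ENNReal.toReal_mul, ENNReal.toReal_pow, ENNReal.toReal_ofReal hc0] using this

theorem pi_real_forall_mem_eq (ν : Measure α) [IsProbabilityMeasure ν] (t : Finset ι)
    (B : Set (ι → α)) (R : (ι → α) → Set α)
    (hB : ∀ ω y, Function.updateFinset ω t y ∈ B ↔ ω ∈ B)
    (hR : ∀ ω y, R (Function.updateFinset ω t y) = R ω)
    (hmeas : MeasurableSet {ω | ω ∈ B ∧ ∀ k ∈ t, ω k ∈ R ω}) (hBm : MeasurableSet B)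
    {c : ℝ} (hc : ∀ ω ∈ B, ν.real (R ω) = c) :
    (Measure.pi fun _ : ι => ν).real {ω | ω ∈ B ∧ ∀ k ∈ t, ω k ∈ R ω} =
      c ^ t.card * (Measure.pi fun _ : ι => ν).real B := by
  rcases B.eq_empty_or_nonempty with rfl | ⟨ω₀, hω₀⟩
  · simp
  have hc0 : 0 ≤ c := measureReal_nonneg.trans (hc ω₀ hω₀).le
  have key := lintegral_eq_of_lmarginal_eq (μ := fun _ : ι => ν) t
    (f := {ω | ω ∈ B ∧ ∀ k ∈ t, ω k ∈ R ω}.indicator 1)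
    (g := B.indicator fun _ => ENNReal.ofReal c ^ t.card)
    (measurable_one.indicator hmeas) (measurable_const.indicator hBm) (by
      ext ω
      rw [lmarginal_indicator_forall_mem ν t B R hB hR hmeas,
        lmarginal_const_mul_indicator ν t B hB]
      by_cases hω : ω ∈ B
      · rw [Set.indicator_of_mem hω, Set.indicator_of_mem hω,
          ← ENNReal.ofReal_toReal (measure_ne_top ν (R ω))]
        exact congrArg (fun z => ENNReal.ofReal z ^ t.card) (hc ω hω)
      · simp [hω])
  rw [lintegral_indicator_one hmeas, lintegral_indicator_const hBm] at key
  have := congrArg ENNReal.toReal key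
  simpa [Measure.real, ENNReal.toReal_mul, ENNReal.toReal_pow, ENNReal.toReal_ofReal hc0] using this

/-- If the second components avoid `E` with probability at least `1 - b` whenever the first
components lie outside `bad`, then `E` has probability at most `P(bad) + b`. -/
theorem pi_prod_real_le {β : Type*} [MeasurableSpace β] (μ : Measure α)
    (ν : Measure β) [IsProbabilityMeasure μ] [IsProbabilityMeasure ν] {E : Set (ι → α × β)}
    (hE : MeasurableSet E) {bad : Set (ι → α)} (hbad : MeasurableSet bad) {b : ℝ} (hb : 0 ≤ b)
    (h : ∀ x, x ∉ bad → (Measure.pi fun _ : ι => ν).real {S | (fun i => (x i, S i)) ∈ E} ≤ b) :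
    (Measure.pi fun _ : ι => μ.prod ν).real E ≤ (Measure.pi fun _ : ι => μ).real bad + b := by
  -- A family of independent pairs has the law of a pair of independent families, so Fubini lets all
  -- first components be fixed at once.
  have hmp := (measurePreserving_arrowProdEquivProdArrow α β ι (fun _ => μ) (fun _ => ν)).symm
  rw [measureReal_def, ← hmp.measure_preimage hE.nullMeasurableSet,
    Measure.prod_apply (hmp.measurable hE), measureReal_def]
  have hle : ∀ x : ι → α, (Measure.pi fun _ : ι => ν) (Prod.mk x ⁻¹'
      ((MeasurableEquiv.arrowProdEquivProdArrow α β ι).symm ⁻¹' E)) ≤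
      bad.indicator 1 x + ENNReal.ofReal b := by
    intro x
    by_cases hx : x ∈ bad
    · rw [Set.indicator_of_mem hx]
      exact prob_le_one.trans le_self_add
    · rw [Set.indicator_of_notMem hx, zero_add,
        ← ENNReal.ofReal_toReal (measure_ne_top (Measure.pi fun _ : ι => ν) _)]
      exact ENNReal.ofReal_le_ofReal (h x hx)
  have := lintegral_mono (μ := Measure.pi fun _ : ι => μ) hle
  rw [lintegral_add_right _ measurable_const, lintegral_indicator_one hbad, lintegral_const,
    measure_univ, mul_one] at this
  refine (ENNReal.toReal_mono (by finiteness) this).trans ?_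
  rw [ENNReal.toReal_add (by finiteness) (by finiteness)]
  simp [ENNReal.toReal_ofReal hb]

/-- The moment generating function of a binomial variable: the exponential of the count is a product
over independent coordinates. -/
theorem pi_real_exp_count (ν : Measure α) [IsProbabilityMeasure ν] {E : Set α}
    (hE : MeasurableSet E) (θ : ℝ) :
    ∫ x, Real.exp (θ * ∑ i, E.indicator 1 (x i)) ∂(Measure.pi fun _ : ι => ν) =
      (1 + ν.real E * (Real.exp θ - 1)) ^ Fintype.card ι := by
  have h1 : ∀ x : ι → α, Real.exp (θ * ∑ i, E.indicator 1 (x i)) =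
      ∏ i, Real.exp (θ * E.indicator 1 (x i)) := by
    intro x
    rw [Finset.mul_sum, Real.exp_sum]
  simp_rw [h1]
  rw [integral_fintype_prod_eq_prod (𝕜 := ℝ) (fun _ : ι => fun y => Real.exp (θ * E.indicator 1 y))]
  rw [Finset.prod_const, Finset.card_univ]
  congr 1
  have h2 : ∀ y : α, Real.exp (θ * E.indicator 1 y) =
      1 + E.indicator (fun _ => Real.exp θ - 1) y := by
    intro y
    by_cases hy : y ∈ E <;> simp [hy]
  simp_rw [h2]
  rw [integral_add (integrable_const _) ((integrable_const _).indicator hE),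
    integral_indicator_const _ hE]
  simp

/-- Exponential Markov inequality for the number of independent points falling into `E`. -/
theorem pi_real_count_le (ν : Measure α) [IsProbabilityMeasure ν] {E : Set α}
    (hE : MeasurableSet E) (θ u : ℝ) :
    (Measure.pi fun _ : ι => ν).real {x | u ≤ θ * ∑ i, E.indicator (1 : α → ℝ) (x i)} ≤
      Real.exp (Fintype.card ι * ν.real E * (Real.exp θ - 1) - u) := by
  set μ := Measure.pi fun _ : ι => ν
  have hmeas : Measurable fun x : ι → α => Real.exp (θ * ∑ i, E.indicator (1 : α → ℝ) (x i)) := by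
    refine Real.measurable_exp.comp (Measurable.const_mul ?_ θ)
    exact Finset.measurable_sum _ fun i _ =>
      (measurable_one.indicator hE).comp (measurable_pi_apply i)
  have hint : Integrable (fun x : ι → α => Real.exp (θ * ∑ i, E.indicator (1 : α → ℝ) (x i))) μ := by
    refine Integrable.of_bound hmeas.aestronglyMeasurable (Real.exp (|θ| * Fintype.card ι)) ?_
    refine Eventually.of_forall fun x => ?_
    rw [Real.norm_eq_abs, Real.abs_exp]
    refine Real.exp_le_exp.2 ?_
    have h0 : 0 ≤ ∑ i, E.indicator (1 : α → ℝ) (x i) :=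
      Finset.sum_nonneg fun i _ => Set.indicator_nonneg (fun _ _ => zero_le_one) _
    have h1 : ∑ i, E.indicator (1 : α → ℝ) (x i) ≤ Fintype.card ι := by
      calc ∑ i, E.indicator (1 : α → ℝ) (x i) ≤ ∑ _i : ι, (1 : ℝ) := by
            refine Finset.sum_le_sum fun i _ => ?_
            exact Set.indicator_le_self' (fun _ _ => zero_le_one) _
        _ = Fintype.card ι := by simp
    calc θ * _ ≤ |θ| * _ := mul_le_mul_of_nonneg_right (le_abs_self θ) h0
      _ ≤ _ := mul_le_mul_of_nonneg_left h1 (abs_nonneg θ)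
  have hM := mul_meas_ge_le_integral_of_nonneg (μ := μ)
    (Eventually.of_forall fun x => (Real.exp_pos _).le) hint (Real.exp u)
  have hset : {x : ι → α | Real.exp u ≤ Real.exp (θ * ∑ i, E.indicator (1 : α → ℝ) (x i))} =
      {x | u ≤ θ * ∑ i, E.indicator (1 : α → ℝ) (x i)} := by
    ext x; simp
  rw [hset, pi_real_exp_count ν hE θ] at hM
  have h1 : (1 + ν.real E * (Real.exp θ - 1)) ^ Fintype.card ι ≤
      Real.exp (Fintype.card ι * ν.real E * (Real.exp θ - 1)) := by
    rw [mul_assoc, Real.exp_nat_mul]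
    refine pow_le_pow_left₀ ?_ (by linarith [Real.add_one_le_exp (ν.real E * (Real.exp θ - 1))]) _
    have h3 : ν.real E ≤ 1 := measureReal_le_one
    have h4 : 0 ≤ ν.real E := measureReal_nonneg
    nlinarith [Real.exp_pos θ, mul_nonneg h4 (Real.exp_pos θ).le]
  rw [Real.exp_sub, le_div_iff₀ (Real.exp_pos u), mul_comm]
  exact hM.trans h1

theorem pi_real_count_lower_tail (ν : Measure α) [IsProbabilityMeasure ν] {E : Set α}
    (hE : MeasurableSet E) {ε : ℝ} (hε : 0 < ε) :
    (Measure.pi fun _ : ι => ν).real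
      {x | ∑ i, E.indicator (1 : α → ℝ) (x i) ≤ (1 - ε) * (Fintype.card ι * ν.real E)} ≤
      Real.exp (-(ε ^ 2 / 2 * (Fintype.card ι * ν.real E))) := by
  have h := pi_real_count_le (ι := ι) ν hE (-ε) (-ε * ((1 - ε) * (Fintype.card ι * ν.real E)))
  have hset : {x : ι → α | -ε * ((1 - ε) * (Fintype.card ι * ν.real E)) ≤
      -ε * ∑ i, E.indicator (1 : α → ℝ) (x i)} =
      {x | ∑ i, E.indicator (1 : α → ℝ) (x i) ≤ (1 - ε) * (Fintype.card ι * ν.real E)} := by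
    ext x
    simp only [Set.mem_ofPred_eq]
    constructor <;> intro h <;> nlinarith
  rw [hset] at h
  refine h.trans (Real.exp_le_exp.2 ?_)
  have hq : 0 ≤ Fintype.card ι * ν.real E := by positivity
  -- Since `(1 + ε + ε²/2)(1 - ε + ε²/2) = 1 + ε⁴/4 ≥ 1`, the quadratic lower bound for `exp ε`
  -- inverts to this upper bound.
  have he : Real.exp (-ε) ≤ 1 - ε + ε ^ 2 / 2 := by
    have hb : 1 + ε + ε ^ 2 / 2 ≤ Real.exp ε := by
      linarith [Real.quadratic_le_exp_of_nonneg hε.le]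
    rw [Real.exp_neg]
    refine (inv_anti₀ (by positivity) hb).trans ?_
    rw [inv_le_iff_one_le_mul₀ (by positivity)]
    nlinarith [pow_pos hε 4]
  nlinarith

theorem pi_real_count_upper_tail (ν : Measure α) [IsProbabilityMeasure ν] {E : Set α}
    (hE : MeasurableSet E) :
    (Measure.pi fun _ : ι => ν).real
      {x | 2 * (Fintype.card ι * ν.real E) ≤ ∑ i, E.indicator (1 : α → ℝ) (x i)} ≤
      Real.exp (-(1 / 4 * (Fintype.card ι * ν.real E))) := by
  have h := pi_real_count_le (ι := ι) ν hE 1 (2 * (Fintype.card ι * ν.real E))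
  simp only [one_mul] at h
  refine h.trans (Real.exp_le_exp.2 ?_)
  have hq : 0 ≤ Fintype.card ι * ν.real E := by positivity
  -- With `θ = 1` the exponent is `(e - 3)` times the mean, and `e - 3 < -1/4`.
  nlinarith [Real.exp_one_lt_d9]

end ProductMeasure

/-- A second moment bound for the probability of a union of events. -/
theorem measureReal_iUnion_ge {Ω ι : Type*} [Fintype ι] [MeasurableSpace Ω] (μ : Measure Ω)
    [IsProbabilityMeasure μ] (I : ι → Set Ω) (hI : ∀ i, MeasurableSet (I i)) (l : ℝ) :
    2 * l * ∑ i, μ.real (I i) - l ^ 2 * ∑ i, ∑ j, μ.real (I i ∩ I j) ≤ μ.real (⋃ i, I i) := by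
  have hint : ∀ s : Set Ω, MeasurableSet s → Integrable (s.indicator (1 : Ω → ℝ)) μ :=
    fun s hs => (integrable_const (1 : ℝ)).indicator hs
  have h1 : ∫ ω, (2 * l * ∑ i, (I i).indicator (1 : Ω → ℝ) ω -
      l ^ 2 * ∑ i, ∑ j, (I i ∩ I j).indicator (1 : Ω → ℝ) ω) ∂μ =
      2 * l * ∑ i, μ.real (I i) - l ^ 2 * ∑ i, ∑ j, μ.real (I i ∩ I j) := by
    rw [integral_sub, integral_const_mul, integral_const_mul, integral_finsetSum,
      integral_finsetSum]
    · simp_rw [integral_indicator_one (hI _)]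
      congr 2
      refine Finset.sum_congr rfl fun i _ => ?_
      rw [integral_finsetSum _ fun j _ => hint _ ((hI i).inter (hI j))]
      simp_rw [integral_indicator_one ((hI i).inter (hI _))]
    · exact fun i _ => integrable_finsetSum _ fun j _ => hint _ ((hI i).inter (hI j))
    · exact fun i _ => hint _ (hI i)
    · exact (integrable_finsetSum _ fun i _ => hint _ (hI i)).const_mul _
    · exact (integrable_finsetSum _ fun i _ => integrable_finsetSum _ fun j _ =>
        hint _ ((hI i).inter (hI j))).const_mul _
  rw [← h1, ← integral_indicator_one (MeasurableSet.iUnion hI)]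
  refine integral_mono ?_ (hint _ (MeasurableSet.iUnion hI)) fun ω => ?_
  · exact ((integrable_finsetSum _ fun i _ => hint _ (hI i)).const_mul _).sub
      ((integrable_finsetSum _ fun i _ => integrable_finsetSum _ fun j _ =>
        hint _ ((hI i).inter (hI j))).const_mul _)
  · have h2 : ∑ i, ∑ j, (I i ∩ I j).indicator (1 : Ω → ℝ) ω =
        (∑ i, (I i).indicator (1 : Ω → ℝ) ω) ^ 2 := by
      rw [sq, Finset.sum_mul_sum]
      refine Finset.sum_congr rfl fun i _ => Finset.sum_congr rfl fun j _ => ?_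
      rw [Set.inter_indicator_one, Pi.mul_apply]
    simp only [h2]
    by_cases hω : ω ∈ ⋃ i, I i
    · rw [Set.indicator_of_mem hω]
      simp only [Pi.one_apply]
      -- For the number `X` of events that occur, `2 l X - l² X² = 1 - (l X - 1)² ≤ 1`; when no
      -- event occurs the left side vanishes.
      nlinarith [sq_nonneg (l * (∑ i, (I i).indicator (1 : Ω → ℝ) ω) - 1)]
    · rw [Set.indicator_of_notMem hω]
      have : ∀ i, (I i).indicator (1 : Ω → ℝ) ω = 0 := fun i =>
        Set.indicator_of_notMem (fun h => hω (Set.mem_iUnion.2 ⟨i, h⟩)) _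
      simp [this]

/-! ### A single random key ring -/

section KeyRings

instance KeyRing.instFintype (P K : ℕ) : Fintype (KeyRing P K) :=
  inferInstanceAs (Fintype {S : Finset (Fin P) // S.card = K})

instance KeyRing.instDiscreteMeasurableSpace (P K : ℕ) : DiscreteMeasurableSpace (KeyRing P K) :=
  ⟨fun _ => trivial⟩

theorem KeyRing.card_eq (P K : ℕ) : Fintype.card (KeyRing P K) = P.choose K := by
  have := Fintype.card_finset_len (α := Fin P) K
  rw [Fintype.card_fin] at this
  exact this

theorem KeyRing.nonempty {P K : ℕ} (h : K ≤ P) : Nonempty (KeyRing P K) := by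
  rw [← Fintype.card_pos_iff, KeyRing.card_eq]
  exact Nat.choose_pos h

/-- The uniform law on key rings. -/
abbrev keyLaw (P K : ℕ) : Measure (KeyRing P K) := uniformOn Set.univ

theorem keyLaw_isProbabilityMeasure {P K : ℕ} (h : K ≤ P) :
    IsProbabilityMeasure (keyLaw P K) :=
  have := KeyRing.nonempty h
  inferInstance

/-- The probability that a random key ring is contained in a given set of `w` keys. -/
def ringRatio (P K w : ℕ) : ℝ := (w.choose K : ℝ) / (P.choose K : ℝ)

theorem keyLaw_real_subset {P K : ℕ} (W : Finset (Fin P)) :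
    (keyLaw P K).real {T | T.val ⊆ W} = ringRatio P K W.card := by
  classical
  have hcard : Fintype.card {T : KeyRing P K // T.val ⊆ W} = W.card.choose K := by
    rw [← Finset.card_powersetCard, ← Fintype.card_coe]
    refine Fintype.card_congr
      { toFun := fun T => ⟨T.1.1, Finset.mem_powersetCard.2 ⟨T.2, T.1.2⟩⟩
        invFun := fun S => ⟨⟨S.1, (Finset.mem_powersetCard.1 S.2).2⟩,
          (Finset.mem_powersetCard.1 S.2).1⟩
        left_inv := fun T => rfl
        right_inv := fun S => rfl }
  rw [measureReal_def, uniformOn_univ, KeyRing.card_eq,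
    Measure.count_apply (MeasurableSet.of_discrete), ENNReal.toReal_div, ringRatio]
  congr 1
  rw [← hcard, Set.encard_eq_coe_toFinset_card, Set.toFinset_card]
  simp only [ENat.toENNReal_coe, ENNReal.toReal_natCast, Nat.cast_inj]
  exact Fintype.card_congr (Equiv.refl _)

theorem keyLaw_real_disjoint {P K : ℕ} (S : Finset (Fin P)) :
    (keyLaw P K).real {T | ¬ (S ∩ T.val).Nonempty} = ringRatio P K (P - S.card) := by
  have : {T : KeyRing P K | ¬ (S ∩ T.val).Nonempty} = {T | T.val ⊆ Sᶜ} := by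
    ext T
    simp only [Set.mem_ofPred_eq, Finset.not_nonempty_iff_eq_empty,
      ← Finset.disjoint_iff_inter_eq_empty, Finset.subset_compl_iff_disjoint_right, disjoint_comm]
  rw [this, keyLaw_real_subset, Finset.card_compl, Fintype.card_fin]

theorem keyLaw_real_inter {P K : ℕ} (h : K ≤ P) (S : Finset (Fin P)) :
    (keyLaw P K).real {T | (S ∩ T.val).Nonempty} = 1 - ringRatio P K (P - S.card) := by
  have := keyLaw_isProbabilityMeasure h
  rw [← keyLaw_real_disjoint S, ← probReal_compl_eq_one_sub MeasurableSet.of_discrete]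
  congr 1
  ext T
  simp [Finset.nonempty_iff_ne_empty]

/-- Factor by factor, `(w - k) / (P - k) ≤ w / P`: drawing without replacement stays inside a set no
more often than drawing with replacement. -/
theorem descFactorial_mul_pow_le {w P : ℕ} (h : w ≤ P) (K : ℕ) :
    w.descFactorial K * P ^ K ≤ P.descFactorial K * w ^ K := by
  induction K with
  | zero => simp
  | succ k ih =>
    rw [Nat.descFactorial_succ, Nat.descFactorial_succ, pow_succ, pow_succ]
    have h1 : (w - k) * P ≤ (P - k) * w := by
      rw [Nat.sub_mul, Nat.sub_mul, mul_comm P w]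
      exact Nat.sub_le_sub_left (Nat.mul_le_mul_left k h) _
    calc (w - k) * w.descFactorial k * (P ^ k * P)
        = (w.descFactorial k * P ^ k) * ((w - k) * P) := by ring
      _ ≤ (P.descFactorial k * w ^ k) * ((P - k) * w) := Nat.mul_le_mul ih h1
      _ = _ := by ring

/-- Log-concavity, factor by factor: `(y - d)(y + d) ≤ y²` with `y = a + d - k`. It yields the
negative correlation of meeting two disjoint rings. -/
theorem descFactorial_mul_descFactorial_le (a d j : ℕ) :
    a.descFactorial j * (a + 2 * d).descFactorial j ≤ (a + d).descFactorial j ^ 2 := by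
  induction j with
  | zero => simp
  | succ k ih =>
    simp only [Nat.descFactorial_succ]
    have h1 : (a - k) * (a + 2 * d - k) ≤ (a + d - k) ^ 2 := by
      rcases le_total a k with h | h
      -- Subtraction is truncated, so for `k ≥ a` the left side is zero.
      · simp [Nat.sub_eq_zero_of_le h]
      · obtain ⟨b, rfl⟩ := Nat.exists_eq_add_of_le h
        have e1 : k + b - k = b := by omega
        have e2 : k + b + 2 * d - k = b + 2 * d := by omega
        have e3 : k + b + d - k = b + d := by omega
        rw [e1, e2, e3]
        nlinarith [Nat.zero_le (d ^ 2)]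
    calc (a - k) * a.descFactorial k * ((a + 2 * d - k) * (a + 2 * d).descFactorial k)
        = ((a - k) * (a + 2 * d - k)) * (a.descFactorial k * (a + 2 * d).descFactorial k) := by
          ring
      _ ≤ (a + d - k) ^ 2 * (a + d).descFactorial k ^ 2 := Nat.mul_le_mul h1 ih
      _ = _ := by ring

theorem ringRatio_eq_descFactorial (P K w : ℕ) :
    ringRatio P K w = (w.descFactorial K : ℝ) / (P.descFactorial K : ℝ) := by
  rw [ringRatio, Nat.descFactorial_eq_factorial_mul_choose,
    Nat.descFactorial_eq_factorial_mul_choose]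
  push_cast
  rw [mul_div_mul_left _ _ (by positivity)]

theorem ringRatio_nonneg (P K w : ℕ) : 0 ≤ ringRatio P K w := by
  unfold ringRatio; positivity

theorem ringRatio_le_pow {P K w : ℕ} (hKP : K ≤ P) (hP : 0 < P) (h : w ≤ P) :
    ringRatio P K w ≤ ((w : ℝ) / P) ^ K := by
  have hd : 0 < P.descFactorial K := by
    rw [Nat.pos_iff_ne_zero, ne_eq, Nat.descFactorial_eq_zero_iff_lt]
    omega
  rw [ringRatio_eq_descFactorial, div_pow, div_le_div_iff₀ (by positivity) (by positivity)]
  have := descFactorial_mul_pow_le h K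
  rw [mul_comm ((w : ℝ) ^ K)]
  exact_mod_cast this

theorem ringRatio_sub_le_exp {P K u : ℕ} (hKP : K ≤ P) (hP : 0 < P) (h : u ≤ P) :
    ringRatio P K (P - u) ≤ Real.exp (-(K * u / P)) := by
  have hP' : (0 : ℝ) < P := by exact_mod_cast hP
  refine (ringRatio_le_pow hKP hP (Nat.sub_le P u)).trans ?_
  have h1 : ((P - u : ℕ) : ℝ) / P = 1 - u / P := by
    rw [Nat.cast_sub h, sub_div, div_self hP'.ne']
  have h2 : Real.exp (-(K * u / P)) = Real.exp (-(u / P)) ^ K := by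
    rw [← Real.exp_nat_mul]; congr 1; ring
  rw [h2]
  refine pow_le_pow_left₀ (by positivity) ?_ K
  rw [h1]
  linarith [Real.add_one_le_exp (-((u : ℝ) / P))]

/-- A union bound over the forbidden keys, each of which lies in the ring with probability `K / P`.
The induction forbids one key at a time by Pascal's rule, and the lost binomial is at most `(P -
1).choose (K - 1) = (K / P) * P.choose K`. -/
theorem ringRatio_sub_ge {P K u : ℕ} (hKP : K ≤ P) (hP : 0 < P) (h : u ≤ P) :
    1 - (K : ℝ) * u / P ≤ ringRatio P K (P - u) := by
  rcases K with _ | k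
  · simp [ringRatio]
  have hP' : (0 : ℝ) < P := by exact_mod_cast hP
  have hC : (0 : ℝ) < P.choose (k + 1) := by exact_mod_cast Nat.choose_pos hKP
  obtain ⟨Q, rfl⟩ : ∃ Q, P = Q + 1 := ⟨P - 1, by omega⟩
  have hQ : ((Q.choose k : ℕ) : ℝ) = ((k + 1 : ℕ) : ℝ) / ((Q + 1 : ℕ) : ℝ) * (Q + 1).choose (k + 1) := by
    have := Nat.add_one_mul_choose_eq Q k
    rw [div_mul_eq_mul_div, eq_div_iff hP'.ne']
    have h' : (((Q + 1) * Q.choose k : ℕ) : ℝ) = (((Q + 1).choose (k + 1) * (k + 1) : ℕ) : ℝ) := by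
      exact_mod_cast this
    push_cast at h' ⊢
    linarith
  induction u with
  | zero => simp [ringRatio, div_self hC.ne']
  | succ v ih =>
    have ih := ih (by omega)
    have hstep : ((Q + 1 - v).choose (k + 1) : ℝ) ≤
        ((Q + 1 - (v + 1)).choose (k + 1) : ℝ) + (Q.choose k : ℝ) := by
      have e : Q + 1 - v = (Q - v) + 1 := by omega
      have e' : Q + 1 - (v + 1) = Q - v := by omega
      rw [e, e', Nat.choose_succ_succ]
      push_cast
      have : ((Q - v).choose k : ℝ) ≤ Q.choose k := by
        exact_mod_cast Nat.choose_le_choose k (Nat.sub_le Q v)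
      linarith
    have h3 : ringRatio (Q + 1) (k + 1) (Q + 1 - v) ≤
        ringRatio (Q + 1) (k + 1) (Q + 1 - (v + 1)) + ((k + 1 : ℕ) : ℝ) / ((Q + 1 : ℕ) : ℝ) := by
      unfold ringRatio
      rw [hQ] at hstep
      rw [div_le_iff₀ hC, add_mul, div_mul_cancel₀ _ hC.ne']
      exact hstep
    have h4 : ((k + 1 : ℕ) : ℝ) * ((v + 1 : ℕ) : ℝ) / ((Q + 1 : ℕ) : ℝ) =
        ((k + 1 : ℕ) : ℝ) * (v : ℝ) / ((Q + 1 : ℕ) : ℝ) + ((k + 1 : ℕ) : ℝ) / ((Q + 1 : ℕ) : ℝ) := by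
      push_cast; ring
    rw [h4]
    linarith

/-- The probability that two independent key rings meet. -/
def linkProb (P K : ℕ) : ℝ := 1 - ringRatio P K (P - K)

theorem linkProb_le {P K : ℕ} (hKP : K ≤ P) (hP : 0 < P) :
    linkProb P K ≤ (K : ℝ) ^ 2 / P := by
  have := ringRatio_sub_ge hKP hP hKP
  unfold linkProb
  rw [sq]
  linarith

/-- With `x = K² / P`, `1 - e^{-x} ≥ 1 - 1 / (1 + x)`. Together with `linkProb_le` this makes
`linkProb` asymptotic to `x` as `x → 0`, with an explicit relative error. -/
theorem linkProb_ge {P K : ℕ} (hKP : K ≤ P) (hP : 0 < P) :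
    (K : ℝ) ^ 2 / P / (1 + (K : ℝ) ^ 2 / P) ≤ linkProb P K := by
  have h := ringRatio_sub_le_exp hKP hP hKP
  rw [← sq, Real.exp_neg] at h
  have hx : 0 ≤ (K : ℝ) ^ 2 / P := by positivity
  have h2 : (Real.exp ((K : ℝ) ^ 2 / P))⁻¹ ≤ (1 + (K : ℝ) ^ 2 / P)⁻¹ :=
    inv_anti₀ (by positivity) (by linarith [Real.add_one_le_exp ((K : ℝ) ^ 2 / P)])
  have h3 : (K : ℝ) ^ 2 / P / (1 + (K : ℝ) ^ 2 / P) = 1 - (1 + (K : ℝ) ^ 2 / P)⁻¹ := by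
    field_simp
    ring
  unfold linkProb
  linarith

theorem linkProb_nonneg {P K : ℕ} (hKP : K ≤ P) (hP : 0 < P) : 0 ≤ linkProb P K :=
  le_trans (by positivity) (linkProb_ge hKP hP)

theorem linkProb_le_one (P K : ℕ) : linkProb P K ≤ 1 := by
  have := ringRatio_nonneg P K (P - K)
  unfold linkProb
  linarith

theorem keyLaw_real_link {P K : ℕ} (h : K ≤ P) (S : KeyRing P K) :
    (keyLaw P K).real {T | (S.val ∩ T.val).Nonempty} = linkProb P K := by
  rw [keyLaw_real_inter h, S.2, linkProb]

theorem ringRatio_sub_two_mul_le {P K : ℕ} (h : 2 * K ≤ P) :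
    ringRatio P K (P - 2 * K) ≤ ringRatio P K (P - K) ^ 2 := by
  have hd : 0 < P.descFactorial K := by
    rw [Nat.pos_iff_ne_zero, ne_eq, Nat.descFactorial_eq_zero_iff_lt]
    omega
  obtain ⟨a, rfl⟩ := Nat.exists_eq_add_of_le' h
  have e1 : a + 2 * K - 2 * K = a := by omega
  have e2 : a + 2 * K - K = a + K := by omega
  rw [ringRatio_eq_descFactorial, ringRatio_eq_descFactorial, e1, e2, div_pow,
    div_le_div_iff₀ (by positivity) (by positivity), sq ((a + 2 * K).descFactorial K : ℝ),
    ← mul_assoc]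
  refine mul_le_mul_of_nonneg_right ?_ (by positivity)
  exact_mod_cast descFactorial_mul_descFactorial_le a K K

/-- Meeting two disjoint key rings are negatively correlated events. -/
theorem keyLaw_real_link_link_le {P K : ℕ} (h : 2 * K ≤ P) (S₁ S₂ : KeyRing P K)
    (hd : ¬ (S₁.val ∩ S₂.val).Nonempty) :
    (keyLaw P K).real {T | (S₁.val ∩ T.val).Nonempty ∧ (S₂.val ∩ T.val).Nonempty} ≤
      linkProb P K ^ 2 := by
  have hKP : K ≤ P := by omega
  have := keyLaw_isProbabilityMeasure hKP
  have hcard : (S₁.val ∪ S₂.val).card = 2 * K := by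
    rw [Finset.card_union_of_disjoint (Finset.disjoint_iff_inter_eq_empty.2
      (Finset.not_nonempty_iff_eq_empty.1 hd)), S₁.2, S₂.2]
    ring
  have hU := keyLaw_real_inter hKP (S₁.val ∪ S₂.val)
  have hset : {T : KeyRing P K | ((S₁.val ∪ S₂.val) ∩ T.val).Nonempty} =
      {T | (S₁.val ∩ T.val).Nonempty} ∪ {T | (S₂.val ∩ T.val).Nonempty} := by
    ext T
    simp [Finset.union_inter_distrib_right, Finset.union_nonempty]
  have hie := measureReal_union_add_inter (μ := keyLaw P K)
    (s := {T : KeyRing P K | (S₁.val ∩ T.val).Nonempty})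
    (t := {T | (S₂.val ∩ T.val).Nonempty}) MeasurableSet.of_discrete
  rw [← hset, hU, hcard, keyLaw_real_link hKP, keyLaw_real_link hKP] at hie
  have hr := ringRatio_sub_two_mul_le h
  have : {T : KeyRing P K | (S₁.val ∩ T.val).Nonempty ∧ (S₂.val ∩ T.val).Nonempty} =
    {T | (S₁.val ∩ T.val).Nonempty} ∩ {T | (S₂.val ∩ T.val).Nonempty} := rfl
  rw [this]
  unfold linkProb at hie ⊢
  -- With `ρ = ringRatio P K (P - K)`, inclusion-exclusion gives `2 (1 - ρ) - (1 - ringRatio P K (P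
  -- - 2K))`, which is at most `1 - 2ρ + ρ² = (1 - ρ)²` by `hr`.
  nlinarith

end KeyRings

/-! ### Isolated sets in the random key graph -/

section RandomKeyGraph

variable {ι : Type*} [Fintype ι] [DecidableEq ι] {P K : ℕ}

/-- The keys held by the nodes of `A`. -/
def keysOf (S : ι → KeyRing P K) (A : Finset ι) : Finset (Fin P) := A.biUnion fun i => (S i).val

/-- No node of `A` shares a key with a node of `M \ A`. -/
def KeyIsolated (S : ι → KeyRing P K) (M A : Finset ι) : Prop :=
  ∀ i ∈ A, ∀ j ∈ M \ A, ¬ ((S i).val ∩ (S j).val).Nonempty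

theorem keysOf_mono (S : ι → KeyRing P K) {A B : Finset ι} (h : A ⊆ B) :
    keysOf S A ⊆ keysOf S B :=
  Finset.biUnion_subset_biUnion_of_subset_left _ h

theorem keyIsolated_iff (S : ι → KeyRing P K) (M A : Finset ι) :
    KeyIsolated S M A ↔ ∀ j ∈ M \ A, ¬ (keysOf S A ∩ (S j).val).Nonempty := by
  simp only [KeyIsolated, keysOf, Finset.biUnion_inter, Finset.biUnion_nonempty]
  constructor
  · rintro h j hj ⟨i, hi, hne⟩
    exact h i hi j hj hne
  · intro h i hi j hj hne
    exact h j hj ⟨i, hi, hne⟩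

theorem le_card_keysOf (S : ι → KeyRing P K) {A : Finset ι} (hA : A.Nonempty) :
    K ≤ (keysOf S A).card := by
  obtain ⟨i, hi⟩ := hA
  refine (S i).2.symm.le.trans ?_
  exact Finset.card_le_card (Finset.subset_biUnion_of_mem (fun i => (S i).val) hi)

/-- The law of independent uniform key rings. -/
abbrev keysLaw (ι : Type*) [Fintype ι] (P K : ℕ) : Measure (ι → KeyRing P K) :=
  Measure.pi fun _ => keyLaw P K

theorem keysOf_updateFinset (S : ι → KeyRing P K) (A t : Finset ι) (h : Disjoint A t)
    (y : (i : t) → KeyRing P K) : keysOf (Function.updateFinset S t y) A = keysOf S A := by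
  refine Finset.biUnion_congr rfl fun i hi => ?_
  have : i ∉ t := Finset.disjoint_left.1 h hi
  simp [Function.updateFinset, this]

/-- Given the rings of `A`, each of the other `|M| - |A|` rings must avoid at least `u` keys,
independently. The condition `Q` keeps its own probability as a factor, which is needed for sets
that hold unusually few keys. -/
theorem keysLaw_real_isolated_le (hKP : K ≤ P) (hP : 0 < P) (M A : Finset ι) (hAM : A ⊆ M)
    (Q : Finset (Fin P) → Prop) {u : ℝ} (hQ : ∀ V, Q V → u ≤ V.card) :
    (keysLaw ι P K).real {S | Q (keysOf S A) ∧ KeyIsolated S M A} ≤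
      Real.exp (-(K * u / P * (M.card - A.card))) * (keysLaw ι P K).real {S | Q (keysOf S A)} := by
  have := keyLaw_isProbabilityMeasure hKP
  have hdis : Disjoint A (M \ A) := Finset.disjoint_sdiff
  have h := pi_real_forall_mem_le (keyLaw P K) (M \ A) {S | Q (keysOf S A)}
    (fun S => {T | ¬ (keysOf S A ∩ T.val).Nonempty})
    (fun S y => by simp only [Set.mem_ofPred_eq, keysOf_updateFinset S A _ hdis])
    (fun S y => by simp only [keysOf_updateFinset S A _ hdis])
    MeasurableSet.of_discrete MeasurableSet.of_discrete (c := Real.exp (-(K * u / P)))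
    (fun S hS => by
      rw [keyLaw_real_disjoint]
      have hle : (keysOf S A).card ≤ P := by
        simpa using Finset.card_le_univ (keysOf S A)
      refine (ringRatio_sub_le_exp hKP hP hle).trans (Real.exp_le_exp.2 (neg_le_neg ?_))
      have := hQ _ hS
      gcongr)
  have hset : {S : ι → KeyRing P K | Q (keysOf S A) ∧ KeyIsolated S M A} =
      {S | S ∈ {S : ι → KeyRing P K | Q (keysOf S A)} ∧
        ∀ k ∈ M \ A, S k ∈ {T : KeyRing P K | ¬ (keysOf S A ∩ T.val).Nonempty}} := by
    ext S
    simp only [Set.mem_ofPred_eq, keyIsolated_iff]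
  rw [hset]
  refine h.trans (le_of_eq ?_)
  congr 1
  rw [← Real.exp_nat_mul, Finset.card_sdiff_of_subset hAM,
    Nat.cast_sub (Finset.card_le_card hAM)]
  congr 1
  ring

theorem pow_self_div_factorial_le_exp (k : ℕ) : (k : ℝ) ^ k / k.factorial ≤ Real.exp k :=
  Real.pow_div_factorial_le_exp k (Nat.cast_nonneg k) k

theorem choose_le_exp_mul_div_pow (m : ℕ) {k : ℕ} (hk : 0 < k) :
    (m.choose k : ℝ) ≤ (Real.exp 1 * m / k) ^ k := by
  have hk' : (0 : ℝ) < k := by exact_mod_cast hk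
  calc (m.choose k : ℝ) ≤ (m : ℝ) ^ k / k.factorial := Nat.choose_le_pow_div k m
    _ = ((m : ℝ) / k) ^ k * ((k : ℝ) ^ k / k.factorial) := by
      rw [div_pow]; field_simp
    _ ≤ ((m : ℝ) / k) ^ k * Real.exp k := by
      gcongr
      exact pow_self_div_factorial_le_exp k
    _ = (Real.exp 1 * m / k) ^ k := by
      rw [← Real.exp_one_pow k, ← mul_pow]
      congr 1
      ring

/-- A union bound over the sets `W` of `w` keys that could contain all rings of `A`. -/
theorem keysLaw_real_card_keysOf_le (hKP : K ≤ P) (hP : 0 < P) (A : Finset ι) {w : ℕ}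
    (hw : w ≤ P) (hwk : w ≤ A.card * K) :
    (keysLaw ι P K).real {S | (keysOf S A).card ≤ w} ≤
      Real.exp w * ((w : ℝ) / P) ^ (A.card * K - w) := by
  have hprob := keyLaw_isProbabilityMeasure hKP
  have hP' : (0 : ℝ) < P := by exact_mod_cast hP
  have hsub : {S : ι → KeyRing P K | (keysOf S A).card ≤ w} ⊆
      ⋃ W ∈ Finset.powersetCard w (Finset.univ : Finset (Fin P)),
        {S : ι → KeyRing P K | ∀ i ∈ A, (S i).val ⊆ W} := by
    intro S hS
    obtain ⟨W, hW1, hW2⟩ := Finset.exists_superset_card_eq (s := keysOf S A) (n := w) hS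
      (by simpa using hw)
    simp only [Set.mem_iUnion]
    refine ⟨W, Finset.mem_powersetCard.2 ⟨Finset.subset_univ _, hW2⟩, fun i hi => ?_⟩
    exact (Finset.subset_biUnion_of_mem (fun i => (S i).val) hi).trans hW1
  have hone : ∀ W ∈ Finset.powersetCard w (Finset.univ : Finset (Fin P)),
      (keysLaw ι P K).real {S : ι → KeyRing P K | ∀ i ∈ A, (S i).val ⊆ W} ≤
        (((w : ℝ) / P) ^ K) ^ A.card := by
    intro W hW
    have h := pi_real_forall_mem_le (ι := ι) (keyLaw P K) A Set.univ
      (fun _ => {T | T.val ⊆ W}) (fun _ _ => by simp) (fun _ _ => rfl)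
      MeasurableSet.of_discrete MeasurableSet.univ (c := ((w : ℝ) / P) ^ K) (fun S _ => by
        rw [keyLaw_real_subset, (Finset.mem_powersetCard.1 hW).2]
        exact ringRatio_le_pow hKP hP hw)
    simpa using h
  calc (keysLaw ι P K).real {S | (keysOf S A).card ≤ w}
      ≤ ∑ W ∈ Finset.powersetCard w (Finset.univ : Finset (Fin P)),
        (keysLaw ι P K).real {S : ι → KeyRing P K | ∀ i ∈ A, (S i).val ⊆ W} :=
        (measureReal_mono hsub (measure_ne_top _ _)).trans (measureReal_biUnion_finset_le _ _)
    _ ≤ ∑ W ∈ Finset.powersetCard w (Finset.univ : Finset (Fin P)),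
        (((w : ℝ) / P) ^ K) ^ A.card := Finset.sum_le_sum hone
    -- The exponent is split because `w` of the factors `w / P` compensate the number of choices of
    -- `W`, up to `e^w`.
    _ = P.choose w * ((w : ℝ) / P) ^ (w + (A.card * K - w)) := by
        rw [Finset.sum_const, Finset.card_powersetCard, Finset.card_univ, Fintype.card_fin,
          nsmul_eq_mul, ← pow_mul, Nat.add_sub_cancel' hwk, mul_comm K]
    _ ≤ (P : ℝ) ^ w / w.factorial * ((w : ℝ) / P) ^ (w + (A.card * K - w)) := by
        gcongr
        exact Nat.choose_le_pow_div w P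
    _ = (w : ℝ) ^ w / w.factorial * ((w : ℝ) / P) ^ (A.card * K - w) := by
        rw [pow_add, div_pow (w : ℝ) (P : ℝ) w]
        field_simp
    _ ≤ _ := by
        gcongr
        exact pow_self_div_factorial_le_exp w

theorem keysLaw_real_card_keysOf_le_exp (hKP : K ≤ P) (hP : 0 < P) (hK : 0 < K) (A : Finset ι)
    (hA : A.Nonempty) (hAP : A.card * K ≤ P) {ε : ℝ} (hε : 0 < ε) (hε1 : ε < 1) :
    (keysLaw ι P K).real {S | ((keysOf S A).card : ℝ) < (1 - ε) * (A.card * K)} ≤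
      Real.exp (A.card * K * (1 + ε * Real.log (A.card * K / P))) := by
  have hP' : (0 : ℝ) < P := by exact_mod_cast hP
  have hAc : 0 < A.card := hA.card_pos
  have hz : 0 < A.card * K := Nat.mul_pos hAc hK
  have hz' : (0 : ℝ) < (A.card : ℝ) * K := by exact_mod_cast hz
  set w : ℕ := ⌊(1 - ε) * (A.card * K)⌋₊ with hwdef
  have hw1 : (w : ℝ) ≤ (1 - ε) * (A.card * K) := Nat.floor_le (by nlinarith)
  have hw2 : (w : ℝ) ≤ A.card * K := by nlinarith
  have hw3 : w ≤ A.card * K := by exact_mod_cast hw2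
  have h1 := keysLaw_real_card_keysOf_le hKP hP A (hw3.trans hAP) hw3
  have hAP' : (A.card : ℝ) * K ≤ P := by exact_mod_cast hAP
  have hlog : Real.log (A.card * K / P) ≤ 0 :=
    Real.log_nonpos (by positivity) ((div_le_one hP').2 hAP')
  calc (keysLaw ι P K).real {S | ((keysOf S A).card : ℝ) < (1 - ε) * (A.card * K)}
      ≤ (keysLaw ι P K).real {S | (keysOf S A).card ≤ w} := by
        refine measureReal_mono fun S hS => ?_
        exact Nat.le_floor (le_of_lt hS)
    _ ≤ Real.exp w * ((w : ℝ) / P) ^ (A.card * K - w) := h1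
    _ ≤ Real.exp (A.card * K) * ((A.card * K : ℝ) / P) ^ (A.card * K - w) := by
        gcongr
    _ = Real.exp (A.card * K + (A.card * K - w) * Real.log (A.card * K / P)) := by
        rw [Real.exp_add]
        congr 1
        rw [← Real.exp_log (show (0 : ℝ) < A.card * K / P by positivity), ← Real.exp_nat_mul,
          Real.log_exp, Nat.cast_sub hw3]
        push_cast
        rfl
    _ ≤ _ := by
        -- The logarithm is nonpositive and, by the choice of `w`, at least `ε * (A.card * K)`
        -- factors remain.
        refine Real.exp_le_exp.2 ?_
        nlinarith

/-- With `η = exp (-(1/ε + 2))`, sets of at most `η P / K` nodes rarely hold few keys. -/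
theorem choose_mul_exp_le {m k : ℕ} {ε σ : ℝ} (hε : 0 < ε) (hσ : 0 < σ) (hk : 0 < k) (hkm : k ≤ m)
    (hK0 : 0 < K) (hP : 0 < P) (hm : σ * m ≤ P)
    (hkη : (k : ℝ) * K ≤ Real.exp (-(1 / ε + 2)) * P) (hεK : 1 ≤ ε * K)
    (hK : 3 + 1 / ε - Real.log σ + Real.log K ≤ ε * K) :
    (m.choose k : ℝ) * Real.exp (k * K * (1 + ε * Real.log (k * K / P))) ≤
      Real.exp (-(ε * K)) ^ k := by
  have hP' : (0 : ℝ) < P := by exact_mod_cast hP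
  have hk' : (0 : ℝ) < k := by exact_mod_cast hk
  have hK' : (0 : ℝ) < K := by exact_mod_cast hK0
  have hm' : (0 : ℝ) < m := by exact_mod_cast hk.trans_le hkm
  have e1 : Real.exp (k * K * (1 + ε * Real.log (k * K / P))) =
      Real.exp (K * (1 + ε * Real.log (k * K / P))) ^ k := by
    rw [← Real.exp_nat_mul]; congr 1; ring
  rw [e1]
  refine (mul_le_mul_of_nonneg_right (choose_le_exp_mul_div_pow m hk) (by positivity)).trans ?_
  rw [← mul_pow]
  refine pow_le_pow_left₀ (by positivity) ?_ k
  have hy : 0 < (k : ℝ) * K / P := by positivity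
  have hlogy : Real.log (k * K / P) ≤ -(1 / ε + 2) := by
    rw [Real.log_le_iff_le_exp hy, div_le_iff₀ hP']
    exact hkη
  -- This is where `σ m ≤ P` enters: it bounds the entropy per node, `log (e m / k)`, in terms of
  -- `log K` and the logarithm of `k K / P`.
  have hmk : (m : ℝ) / k ≤ K / (σ * (k * K / P)) := by
    rw [div_le_div_iff₀ hk' (by positivity)]
    have : (m : ℝ) * (σ * (k * K / P)) = (σ * m) / P * (k * K) := by field_simp
    rw [this]
    have h1 : σ * m / P ≤ 1 := (div_le_one hP').2 hm
    nlinarith [mul_pos hk' hK']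
  have hmk2 : Real.exp 1 * m / k ≤
      Real.exp (1 + Real.log K - Real.log σ - Real.log (k * K / P)) := by
    have : Real.exp (1 + Real.log K - Real.log σ - Real.log (k * K / P)) =
        Real.exp 1 * (K / (σ * (k * K / P))) := by
      rw [Real.exp_sub, Real.exp_sub, Real.exp_add, Real.exp_log hK', Real.exp_log hσ,
        Real.exp_log hy]
      field_simp
    rw [this, mul_div_assoc]
    gcongr
  refine (mul_le_mul_of_nonneg_right hmk2 (Real.exp_pos _).le).trans ?_
  rw [← Real.exp_add]
  refine Real.exp_le_exp.2 ?_
  -- In `-(1/ε + 2)`, the summand `1/ε` cancels the `K` in the exponent and the `2` produces `-2 ε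
  -- K`. By `hK`, half of the latter absorbs `log K` and the constants, which leaves `-ε K` per
  -- node.
  have h5 : (ε * K - 1) * Real.log (k * K / P) ≤ (ε * K - 1) * (-(1 / ε + 2)) :=
    mul_le_mul_of_nonneg_left hlogy (by linarith)
  have h6 : (ε * K - 1) * (-(1 / ε + 2)) = -K - 2 * (ε * K) + 1 / ε + 2 := by
    field_simp; ring
  nlinarith

/-- Some set of at most half of the nodes of `M` shares no key with the rest of `M`. -/
def KeySplit (S : ι → KeyRing P K) (M : Finset ι) : Prop :=
  ∃ A ⊆ M, A.Nonempty ∧ 2 * A.card ≤ M.card ∧ KeyIsolated S M A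

theorem sum_Icc_pow_le {q : ℝ} (hq : 0 ≤ q) (hq2 : q ≤ 1 / 2) (N : ℕ) :
    ∑ k ∈ Finset.Icc 1 N, q ^ k ≤ 2 * q := by
  -- The subtracted tail makes the induction close, because `q ≤ 1/2`.
  have h : ∀ N : ℕ, ∑ k ∈ Finset.Icc 1 N, q ^ k ≤ 2 * q - 2 * (q ^ N * q) := by
    intro N
    induction N with
    | zero => simp
    | succ n ih =>
      rw [Finset.sum_Icc_succ_top (by omega)]
      have : 0 ≤ q ^ n * q := by positivity
      rw [pow_succ]
      nlinarith
  have := h N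
  have : 0 ≤ q ^ N * q := by positivity
  linarith [h N]

/-- One summand for each kind of isolated set `A`: at most `k₀` nodes with many keys; at most `k₀`
nodes with few keys; more than `k₀` nodes, some `k₀` of which hold few keys; more than `k₀` nodes
that hold at least the keys typical of `k₀` nodes. -/
theorem keysLaw_real_keySplit_le (hKP : K ≤ P) (hK0 : 0 < K) (M : Finset ι) {ε σ : ℝ}
    (hε : 0 < ε) (hε1 : ε < 1) (hσ : 0 < σ) (hm : σ * M.card ≤ P) (hεK : 1 ≤ ε * K)
    (hK : 3 + 1 / ε - Real.log σ + Real.log K ≤ ε * K) {k₀ : ℕ} (hk₀ : 0 < k₀)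
    (hk₀m : (k₀ : ℝ) ≤ ε * M.card) (hk₀P : (k₀ : ℝ) * K ≤ Real.exp (-(1 / ε + 2)) * P) {h : ℝ}
    (hh : h = M.card * (K : ℝ) ^ 2 / P)
    (hsmall : M.card * Real.exp (-((1 - ε) ^ 2 * h)) ≤ 1 / 2) :
    (keysLaw ι P K).real {S | KeySplit S M} ≤
      2 * (M.card * Real.exp (-((1 - ε) ^ 2 * h))) + Real.exp (-((1 - ε) * h)) +
        Real.exp (-(ε * K * k₀)) + 2 ^ M.card * Real.exp (-((1 - ε) / 2 * h * k₀)) := by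
  classical
  have hP : 0 < P := by omega
  have hP' : (0 : ℝ) < P := by exact_mod_cast hP
  have hK' : (0 : ℝ) < K := by exact_mod_cast hK0
  have hprob := keyLaw_isProbabilityMeasure hKP
  set m := M.card with hmdef
  have hm0 : (0 : ℝ) ≤ m := Nat.cast_nonneg m
  have hh0 : 0 ≤ h := by rw [hh]; positivity
  have hk₀' : (0 : ℝ) < k₀ := by exact_mod_cast hk₀
  have hη1 : Real.exp (-(1 / ε + 2)) ≤ 1 := by
    rw [Real.exp_le_one_iff]
    have : 0 < 1 / ε := by positivity
    linarith
  have hk₀m' : k₀ ≤ m := by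
    have : (k₀ : ℝ) ≤ m := by nlinarith
    exact_mod_cast this
  set μ := keysLaw ι P K with hμ
  let E1 : ℕ → Finset ι → Set (ι → KeyRing P K) := fun k A =>
    {S | (1 - ε) * (k * K) ≤ ((keysOf S A).card : ℝ) ∧ KeyIsolated S M A}
  let E2 : ℕ → Finset ι → Set (ι → KeyRing P K) := fun k A =>
    {S | (((keysOf S A).card : ℝ) < (1 - ε) * (k * K) ∧ (K : ℝ) ≤ (keysOf S A).card) ∧
      KeyIsolated S M A}
  let E3 : Finset ι → Set (ι → KeyRing P K) := fun A =>
    {S | ((keysOf S A).card : ℝ) < (1 - ε) * (k₀ * K)}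
  have hcover : {S : ι → KeyRing P K | KeySplit S M} ⊆
      (((⋃ k ∈ Finset.Icc 1 k₀, ⋃ A ∈ Finset.powersetCard k M, E1 k A) ∪
        (⋃ k ∈ Finset.Icc 1 k₀, ⋃ A ∈ Finset.powersetCard k M, E2 k A)) ∪
        (⋃ A ∈ Finset.powersetCard k₀ M, E3 A)) ∪
        (⋃ A ∈ M.powerset.filter (fun A => 2 * A.card ≤ m), E1 k₀ A) := by
    rintro S ⟨A, hAM, hAne, hA2, hiso⟩
    have hApos := hAne.card_pos
    rcases le_or_gt A.card k₀ with hle | hlt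
    · rcases le_or_gt ((1 - ε) * (A.card * K)) ((keysOf S A).card : ℝ) with hu | hu
      · left; left; left
        simp only [Set.mem_iUnion]
        exact ⟨A.card, Finset.mem_Icc.2 ⟨hApos, hle⟩, A,
          Finset.mem_powersetCard.2 ⟨hAM, rfl⟩, hu, hiso⟩
      · left; left; right
        simp only [Set.mem_iUnion]
        exact ⟨A.card, Finset.mem_Icc.2 ⟨hApos, hle⟩, A,
          Finset.mem_powersetCard.2 ⟨hAM, rfl⟩,
          ⟨hu, by exact_mod_cast le_card_keysOf S hAne⟩, hiso⟩
    -- For a large `A`, any `k₀` of its nodes serve: either they hold few keys, which is rare by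
    -- itself, or their keys already make the isolation of `A` unlikely.
    · obtain ⟨A', hA'A, hA'c⟩ := Finset.exists_subset_card_eq hlt.le
      rcases le_or_gt ((1 - ε) * (k₀ * K)) ((keysOf S A').card : ℝ) with hu | hu
      · right
        simp only [Set.mem_iUnion]
        refine ⟨A, Finset.mem_filter.2 ⟨Finset.mem_powerset.2 hAM, hA2⟩, hu.trans ?_, hiso⟩
        exact_mod_cast Finset.card_le_card (keysOf_mono S hA'A)
      · left; right
        simp only [Set.mem_iUnion]
        exact ⟨A', Finset.mem_powersetCard.2 ⟨hA'A.trans hAM, hA'c⟩, hu⟩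
  have hcardP : ∀ k : ℕ, k ≤ k₀ → k * K ≤ P := by
    intro k hk
    have : (k : ℝ) * K ≤ P := by
      have h1 : (k : ℝ) * K ≤ k₀ * K := by gcongr
      nlinarith
    exact_mod_cast this
  have hfew : ∀ k : ℕ, 0 < k → k ≤ k₀ → ∀ A ∈ Finset.powersetCard k M,
      μ.real {S | ((keysOf S A).card : ℝ) < (1 - ε) * (k * K)} ≤
        Real.exp (k * K * (1 + ε * Real.log (k * K / P))) := by
    intro k hk hkk A hA
    obtain ⟨hAM, rfl⟩ := Finset.mem_powersetCard.1 hA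
    exact keysLaw_real_card_keysOf_le_exp hKP hP hK0 A (Finset.card_pos.1 hk) (hcardP _ hkk) hε hε1
  have hsum : ∀ k : ℕ, 0 < k → k ≤ k₀ →
      (m.choose k : ℝ) * Real.exp (k * K * (1 + ε * Real.log (k * K / P))) ≤
        Real.exp (-(ε * K)) ^ k := by
    intro k hk hkk
    refine choose_mul_exp_le hε hσ hk (hkk.trans hk₀m') hK0 hP hm ?_ hεK hK
    have h1 : (k : ℝ) * K ≤ k₀ * K := by gcongr
    linarith
  -- sets that hold many keys
  have hb1 : μ.real (⋃ k ∈ Finset.Icc 1 k₀, ⋃ A ∈ Finset.powersetCard k M, E1 k A) ≤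
      2 * (m * Real.exp (-((1 - ε) ^ 2 * h))) := by
    refine (measureReal_biUnion_finset_le _ _).trans
      (le_trans ?_ (sum_Icc_pow_le (by positivity) hsmall k₀))
    refine Finset.sum_le_sum fun k hk => ?_
    obtain ⟨hk1, hkk⟩ := Finset.mem_Icc.1 hk
    have hkk' : (k : ℝ) ≤ k₀ := by exact_mod_cast hkk
    refine (measureReal_biUnion_finset_le _ _).trans ?_
    have hone : ∀ A ∈ Finset.powersetCard k M, μ.real (E1 k A) ≤
        Real.exp (-((1 - ε) ^ 2 * h)) ^ k := by
      intro A hA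
      obtain ⟨hAM, hAk⟩ := Finset.mem_powersetCard.1 hA
      have h1 := keysLaw_real_isolated_le hKP hP M A hAM
        (fun V => (1 - ε) * (k * K) ≤ (V.card : ℝ)) (fun V hV => hV)
      refine h1.trans ((mul_le_of_le_one_right (Real.exp_pos _).le measureReal_le_one).trans ?_)
      rw [← Real.exp_nat_mul, hAk]
      refine Real.exp_le_exp.2 ?_
      have h2 : (1 - ε) * m ≤ (m : ℝ) - k := by nlinarith
      have h3 : (K : ℝ) * ((1 - ε) * (k * K)) / P * (m - k) ≥
          (K : ℝ) * ((1 - ε) * (k * K)) / P * ((1 - ε) * m) := by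
        refine mul_le_mul_of_nonneg_left h2 ?_
        have : 0 ≤ 1 - ε := by linarith
        positivity
      have h4 : (K : ℝ) * ((1 - ε) * (k * K)) / P * ((1 - ε) * m) = k * ((1 - ε) ^ 2 * h) := by
        rw [hh]; ring
      linarith
    refine (Finset.sum_le_sum hone).trans ?_
    rw [Finset.sum_const, Finset.card_powersetCard, nsmul_eq_mul, mul_pow]
    gcongr
    exact_mod_cast Nat.choose_le_pow m k
  -- small sets that hold few keys
  have hb2 : μ.real (⋃ k ∈ Finset.Icc 1 k₀, ⋃ A ∈ Finset.powersetCard k M, E2 k A) ≤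
      Real.exp (-((1 - ε) * h)) := by
    have hq2 : Real.exp (-(ε * K)) ≤ 1 / 2 := by
      have h2 : (2 : ℝ) ≤ Real.exp (ε * K) := by
        linarith [Real.add_one_le_exp (ε * K)]
      rw [Real.exp_neg, one_div]
      exact inv_anti₀ (by norm_num) h2
    have hgeo := sum_Icc_pow_le (Real.exp_pos _).le hq2 k₀
    refine (measureReal_biUnion_finset_le _ _).trans ?_
    have hk : ∀ k ∈ Finset.Icc 1 k₀, μ.real (⋃ A ∈ Finset.powersetCard k M, E2 k A) ≤
        Real.exp (-(ε * K)) ^ k * Real.exp (-((1 - ε) * h)) := by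
      intro k hk
      obtain ⟨hk1, hkk⟩ := Finset.mem_Icc.1 hk
      have hkk' : (k : ℝ) ≤ k₀ := by exact_mod_cast hkk
      refine (measureReal_biUnion_finset_le _ _).trans ?_
      have hone : ∀ A ∈ Finset.powersetCard k M, μ.real (E2 k A) ≤
          Real.exp (k * K * (1 + ε * Real.log (k * K / P))) * Real.exp (-((1 - ε) * h)) := by
        intro A hA
        obtain ⟨hAM, hAk⟩ := Finset.mem_powersetCard.1 hA
        have h1 := keysLaw_real_isolated_le hKP hP M A hAM
          (fun V => (V.card : ℝ) < (1 - ε) * (k * K) ∧ (K : ℝ) ≤ V.card) (fun V hV => hV.2)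
        refine h1.trans ?_
        rw [mul_comm]
        refine mul_le_mul ?_ ?_ (Real.exp_pos _).le (Real.exp_pos _).le
        -- The rarity of holding few keys pays for the choice of `A`; isolation, estimated with the
        -- keys of one ring only, provides the factor `exp (-((1 - ε) * h))` for all sizes together.
        · exact (measureReal_mono fun S hS => hS.1).trans (hfew k hk1 hkk A hA)
        · rw [hAk]
          refine Real.exp_le_exp.2 ?_
          have h2 : (1 - ε) * m ≤ (m : ℝ) - k := by nlinarith
          have h3 : (K : ℝ) * K / P * (m - k) ≥ (K : ℝ) * K / P * ((1 - ε) * m) :=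
            mul_le_mul_of_nonneg_left h2 (by positivity)
          have h4 : (K : ℝ) * K / P * ((1 - ε) * m) = (1 - ε) * h := by
            rw [hh]; ring
          linarith
      refine (Finset.sum_le_sum hone).trans ?_
      rw [Finset.sum_const, Finset.card_powersetCard, nsmul_eq_mul, ← mul_assoc]
      exact mul_le_mul_of_nonneg_right (hsum k hk1 hkk) (Real.exp_pos _).le
    refine (Finset.sum_le_sum hk).trans ?_
    rw [← Finset.sum_mul]
    refine mul_le_of_le_one_left (Real.exp_pos _).le ?_
    linarith
  have hb3 : μ.real (⋃ A ∈ Finset.powersetCard k₀ M, E3 A) ≤ Real.exp (-(ε * K * k₀)) := by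
    refine (measureReal_biUnion_finset_le _ _).trans
      ((Finset.sum_le_sum (hfew k₀ hk₀ le_rfl)).trans ?_)
    rw [Finset.sum_const, Finset.card_powersetCard, nsmul_eq_mul]
    refine (hsum k₀ hk₀ le_rfl).trans (le_of_eq ?_)
    rw [← Real.exp_nat_mul]
    congr 1
    ring
  have hb4 : μ.real (⋃ A ∈ M.powerset.filter (fun A => 2 * A.card ≤ m), E1 k₀ A) ≤
      2 ^ m * Real.exp (-((1 - ε) / 2 * h * k₀)) := by
    refine (measureReal_biUnion_finset_le _ _).trans ?_
    have hone : ∀ A ∈ M.powerset.filter (fun A => 2 * A.card ≤ m), μ.real (E1 k₀ A) ≤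
        Real.exp (-((1 - ε) / 2 * h * k₀)) := by
      intro A hA
      obtain ⟨hAM, hA2⟩ := Finset.mem_filter.1 hA
      have h1 := keysLaw_real_isolated_le hKP hP M A (Finset.mem_powerset.1 hAM)
        (fun V => (1 - ε) * (k₀ * K) ≤ (V.card : ℝ)) (fun V hV => hV)
      refine h1.trans ((mul_le_of_le_one_right (Real.exp_pos _).le measureReal_le_one).trans ?_)
      refine Real.exp_le_exp.2 ?_
      have hA2' : 2 * (A.card : ℝ) ≤ m := by exact_mod_cast hA2
      -- Only here is it used that the isolated set has at most half of the nodes; for sets of at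
      -- most `k₀` nodes, `k₀ ≤ ε m` does better.
      have h2 : (m : ℝ) / 2 ≤ (m : ℝ) - A.card := by linarith
      have h3 : (K : ℝ) * ((1 - ε) * (k₀ * K)) / P * (m - A.card) ≥
          (K : ℝ) * ((1 - ε) * (k₀ * K)) / P * (m / 2) := by
        refine mul_le_mul_of_nonneg_left h2 ?_
        have : 0 ≤ 1 - ε := by linarith
        positivity
      have h4 : (K : ℝ) * ((1 - ε) * (k₀ * K)) / P * (m / 2) = (1 - ε) / 2 * h * k₀ := by
        rw [hh]; ring
      linarith
    refine (Finset.sum_le_sum hone).trans ?_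
    rw [Finset.sum_const, nsmul_eq_mul]
    gcongr
    have h5 := Finset.card_filter_le M.powerset (fun A => 2 * A.card ≤ m)
    rw [Finset.card_powerset] at h5
    exact_mod_cast h5
  refine (measureReal_mono hcover (measure_ne_top _ _)).trans ?_
  refine (measureReal_union_le _ _).trans ?_
  refine add_le_add ((measureReal_union_le _ _).trans ?_) hb4
  refine add_le_add ((measureReal_union_le _ _).trans ?_) hb3
  exact add_le_add hb1 hb2

end RandomKeyGraph

/-! ### Uniform locations in the unit square -/

section Plane

/-- The Euclidean plane. -/
abbrev Plane : Type := EuclideanSpace ℝ (Fin 2)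

theorem measurableSet_rect {I J : Set ℝ} (hI : MeasurableSet I) (hJ : MeasurableSet J) :
    MeasurableSet {x : Plane | x 0 ∈ I ∧ x 1 ∈ J} := by
  have h0 : Measurable fun x : Plane => x 0 := by fun_prop
  have h1 : Measurable fun x : Plane => x 1 := by fun_prop
  exact (h0 hI).inter (h1 hJ)

theorem volume_rect {I J : Set ℝ} (hI : MeasurableSet I) (hJ : MeasurableSet J) :
    volume {x : Plane | x 0 ∈ I ∧ x 1 ∈ J} = volume I * volume J := by
  have h := (PiLp.volume_preserving_ofLp (Fin 2)).measure_preimage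
    (s := Set.pi Set.univ ![I, J]) (MeasurableSet.univ_pi (by
      intro i; fin_cases i <;> assumption)).nullMeasurableSet
  rw [volume_pi_pi] at h
  simp only [Fin.prod_univ_two, Matrix.cons_val_zero, Matrix.cons_val_one] at h
  rw [← h]
  congr 1
  ext x
  simp [Fin.forall_fin_two]

theorem unitSquare_eq_rect :
    unitSquare = {x : Plane | x 0 ∈ Set.Icc (0 : ℝ) 1 ∧ x 1 ∈ Set.Icc (0 : ℝ) 1} := by
  ext x
  simp only [unitSquare, Set.mem_ofPred_eq, Fin.forall_fin_two]

/-- The uniform law on the unit square. -/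
abbrev locLaw : Measure Plane := (volume : Measure Plane).restrict unitSquare

instance locLaw_isProbabilityMeasure : IsProbabilityMeasure locLaw := by
  constructor
  rw [Measure.restrict_apply_univ, unitSquare_eq_rect,
    volume_rect measurableSet_Icc measurableSet_Icc]
  simp

theorem locLaw_real_of_subset {s : Set Plane} (hs : s ⊆ unitSquare) :
    locLaw.real s = (volume : Measure Plane).real s := by
  rw [measureReal_def, measureReal_def, Measure.restrict_eq_self _ hs]

theorem locLaw_real_rect {a b c d : ℝ} (ha : 0 ≤ a) (hab : a ≤ b) (hb : b ≤ 1) (hc : 0 ≤ c)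
    (hcd : c ≤ d) (hd : d ≤ 1) :
    locLaw.real {x : Plane | x 0 ∈ Set.Ico a b ∧ x 1 ∈ Set.Ico c d} = (b - a) * (d - c) := by
  rw [locLaw_real_of_subset, measureReal_def, volume_rect measurableSet_Ico measurableSet_Ico,
    Real.volume_Ico, Real.volume_Ico, ENNReal.toReal_mul, ENNReal.toReal_ofReal (by linarith),
    ENNReal.toReal_ofReal (by linarith)]
  rw [unitSquare_eq_rect]
  rintro x ⟨⟨h1, h2⟩, h3, h4⟩
  exact ⟨⟨ha.trans h1, h2.le.trans hb⟩, hc.trans h3, h4.le.trans hd⟩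

theorem measureReal_closedBall {r : ℝ} (hr : 0 ≤ r) (x : Plane) :
    (volume : Measure Plane).real (Metric.closedBall x r) = Real.pi * r ^ 2 := by
  rw [measureReal_def, EuclideanSpace.volume_closedBall_fin_two]
  simp [ENNReal.toReal_ofReal hr, mul_comm, Real.pi_pos.le]

theorem measureReal_ball {r : ℝ} (hr : 0 ≤ r) (x : Plane) :
    (volume : Measure Plane).real (Metric.ball x r) = Real.pi * r ^ 2 := by
  rw [measureReal_def, EuclideanSpace.volume_ball_fin_two]
  simp [ENNReal.toReal_ofReal hr, mul_comm, Real.pi_pos.le]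

theorem locLaw_real_closedBall_le {r : ℝ} (hr : 0 ≤ r) (x : Plane) :
    locLaw.real (Metric.closedBall x r) ≤ Real.pi * r ^ 2 := by
  rw [← measureReal_closedBall hr x]
  refine ENNReal.toReal_mono measure_closedBall_lt_top.ne ?_
  exact Measure.restrict_apply_le _ _

end Plane

/-! ### The network law and measurability -/

section Network

variable {n P K : ℕ}

theorem nodeLaw_isProbabilityMeasure (h : K ≤ P) : IsProbabilityMeasure (nodeLaw P K) := by
  have := keyLaw_isProbabilityMeasure h
  unfold nodeLaw
  infer_instance

theorem networkLaw_isProbabilityMeasure (h : K ≤ P) :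
    IsProbabilityMeasure (networkLaw n P K) := by
  have := nodeLaw_isProbabilityMeasure h
  unfold networkLaw
  infer_instance

/-- Two nodes are close to each other and share a key. -/
def Linked (r : ℝ) (y z : Node P K) : Prop :=
  dist y.1 z.1 ≤ r ∧ (y.2.val ∩ z.2.val).Nonempty

theorem measurableSet_keys {Ω : Type*} [MeasurableSpace Ω] {f g : Ω → KeyRing P K}
    (hf : Measurable f) (hg : Measurable g) (Q : KeyRing P K → KeyRing P K → Prop) :
    MeasurableSet {ω | Q (f ω) (g ω)} :=
  (hf.prodMk hg) (MeasurableSet.of_discrete (s := {z : KeyRing P K × KeyRing P K | Q z.1 z.2}))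

theorem measurableSet_linked {Ω : Type*} [MeasurableSpace Ω] {f g : Ω → Node P K}
    (hf : Measurable f) (hg : Measurable g) (r : ℝ) :
    MeasurableSet {ω | Linked r (f ω) (g ω)} := by
  refine MeasurableSet.inter ?_ ?_
  · exact measurableSet_le (hf.fst.dist hg.fst) measurable_const
  · exact measurableSet_keys hf.snd hg.snd fun S T => (S.val ∩ T.val).Nonempty

/-- There are finitely many graphs on `Fin n`, and prescribing the whole graph is a finite
intersection of conditions on links. No structure of `Q` is needed. -/
theorem measurableSet_keyGeometricGraph (r : ℝ) (Q : SimpleGraph (Fin n) → Prop) :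
    MeasurableSet {ω : Fin n → Node P K | Q (keyGeometricGraph r ω)} := by
  classical
  have hset : {ω : Fin n → Node P K | Q (keyGeometricGraph r ω)} =
      ⋃ H ∈ {H : SimpleGraph (Fin n) | Q H}, ⋂ i : Fin n, ⋂ j : Fin n,
        {ω | (i ≠ j ∧ Linked r (ω i) (ω j)) ↔ H.Adj i j} := by
    ext ω
    simp only [Set.mem_ofPred_eq, Set.mem_iUnion, Set.mem_iInter, exists_prop]
    constructor
    · intro h
      exact ⟨_, h, fun i j => Iff.rfl⟩
    · rintro ⟨H, hH, h⟩
      have : keyGeometricGraph r ω = H := by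
        ext i j
        exact h i j
      rwa [this]
  rw [hset]
  refine MeasurableSet.biUnion (Set.to_countable _) fun H _ =>
    MeasurableSet.iInter fun i => MeasurableSet.iInter fun j => ?_
  have hm := measurableSet_linked (P := P) (K := K) (measurable_pi_apply (X := fun _ => Node P K) i)
    (measurable_pi_apply j) r
  by_cases hij : i = j
  · simp [hij]
  · by_cases hH : H.Adj i j
    · simpa [hij, hH] using hm
    · have : {ω : Fin n → Node P K | (i ≠ j ∧ Linked r (ω i) (ω j)) ↔ H.Adj i j} =
          {ω | Linked r (ω i) (ω j)}ᶜ := by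
        ext ω
        simp [hij, hH]
      rw [this]
      exact hm.compl

end Network

/-! ### Boxes, blocks, and connectivity from local connectivity -/

section Cells

variable {n P K L : ℕ}

/-- The index of the box of side `1 / L` that contains a point of the unit square. -/
def boxIndex (L : ℕ) (x : Plane) : ℕ × ℕ := (⌊(L : ℝ) * x 0⌋₊, ⌊(L : ℝ) * x 1⌋₊)

theorem measurable_boxIndex (L : ℕ) : Measurable (boxIndex L) := by
  have h0 : Measurable fun x : Plane => x 0 := by fun_prop
  have h1 : Measurable fun x : Plane => x 1 := by fun_prop
  exact (Nat.measurable_floor.comp (h0.const_mul _)).prodMk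
    (Nat.measurable_floor.comp (h1.const_mul _))

/-- The half-open unit square. -/
def halfOpenSquare : Set Plane := {x | x 0 ∈ Set.Ico (0 : ℝ) 1 ∧ x 1 ∈ Set.Ico (0 : ℝ) 1}

theorem locLaw_real_halfOpenSquare : locLaw.real halfOpenSquare = 1 := by
  rw [halfOpenSquare, locLaw_real_rect] <;> norm_num

theorem floor_mul_eq_iff (hL : 0 < L) {y : ℝ} (hy : 0 ≤ y) (a : ℕ) :
    ⌊(L : ℝ) * y⌋₊ = a ↔ y ∈ Set.Ico ((a : ℝ) / L) ((a + 1 : ℝ) / L) := by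
  have hL' : (0 : ℝ) < L := by exact_mod_cast hL
  rw [Nat.floor_eq_iff (by positivity), Set.mem_Ico, div_le_iff₀ hL', lt_div_iff₀ hL', mul_comm y]

/-- The box with a given index, inside the half-open unit square. -/
def box (L : ℕ) (a b : ℕ) : Set Plane := {x | x ∈ halfOpenSquare ∧ boxIndex L x = (a, b)}

theorem measurableSet_halfOpenSquare : MeasurableSet halfOpenSquare :=
  measurableSet_rect measurableSet_Ico measurableSet_Ico

theorem measurableSet_box (L a b : ℕ) : MeasurableSet (box L a b) :=
  measurableSet_halfOpenSquare.inter (measurable_boxIndex L (measurableSet_singleton _))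

theorem locLaw_real_box (hL : 0 < L) {a b : ℕ} (ha : a < L) (hb : b < L) :
    locLaw.real (box L a b) = 1 / (L : ℝ) ^ 2 := by
  have hL' : (0 : ℝ) < L := by exact_mod_cast hL
  have ha' : (a + 1 : ℝ) ≤ L := by exact_mod_cast ha
  have hb' : (b + 1 : ℝ) ≤ L := by exact_mod_cast hb
  have hset : box L a b = {x : Plane | x 0 ∈ Set.Ico ((a : ℝ) / L) ((a + 1 : ℝ) / L) ∧
      x 1 ∈ Set.Ico ((b : ℝ) / L) ((b + 1 : ℝ) / L)} := by
    ext x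
    simp only [box, boxIndex, Set.mem_ofPred_eq, Prod.mk.injEq]
    constructor
    · rintro ⟨⟨h0, h1⟩, h2, h3⟩
      exact ⟨(floor_mul_eq_iff hL h0.1 a).1 h2, (floor_mul_eq_iff hL h1.1 b).1 h3⟩
    · rintro ⟨h0, h1⟩
      have e0 : 0 ≤ x 0 := le_trans (by positivity) h0.1
      have e1 : 0 ≤ x 1 := le_trans (by positivity) h1.1
      refine ⟨⟨⟨e0, h0.2.trans_le ?_⟩, e1, h1.2.trans_le ?_⟩, (floor_mul_eq_iff hL e0 a).2 h0,
        (floor_mul_eq_iff hL e1 b).2 h1⟩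
      · rwa [div_le_one hL']
      · rwa [div_le_one hL']
  rw [hset, locLaw_real_rect (by positivity) (by gcongr; linarith) ((div_le_one hL').2 ha')
    (by positivity) (by gcongr; linarith) ((div_le_one hL').2 hb')]
  field_simp
  ring

/-- The points lying in a block of two by two boxes. -/
def cell (L : ℕ) (x : Fin n → Plane) (a b : ℕ) : Finset (Fin n) :=
  Finset.univ.filter fun i => boxIndex L (x i) ∈ Finset.Icc a (a + 1) ×ˢ Finset.Icc b (b + 1)

/-- The number of points lying in a box. -/
def boxCount (L : ℕ) (x : Fin n → Plane) (a b : ℕ) : ℕ :=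
  (Finset.univ.filter fun i => boxIndex L (x i) = (a, b)).card

theorem card_cell (L : ℕ) (x : Fin n → Plane) (a b : ℕ) :
    (cell L x a b).card =
      ∑ c ∈ Finset.Icc a (a + 1) ×ˢ Finset.Icc b (b + 1), boxCount L x c.1 c.2 := by
  rw [Finset.card_eq_sum_card_fiberwise (f := fun i => boxIndex L (x i))
    (t := Finset.Icc a (a + 1) ×ˢ Finset.Icc b (b + 1))
    (s := cell L x a b) (fun i hi => (Finset.mem_filter.1 hi).2)]
  refine Finset.sum_congr rfl fun c hc => ?_
  unfold boxCount cell
  congr 1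
  ext i
  simp only [Finset.mem_filter, Finset.mem_univ, true_and]
  constructor
  · rintro ⟨_, h⟩; exact h
  · intro h; exact ⟨by rw [h]; exact hc, h⟩

theorem card_block (a b : ℕ) : (Finset.Icc a (a + 1) ×ˢ Finset.Icc b (b + 1)).card = 4 := by
  have h : ∀ c : ℕ, (Finset.Icc c (c + 1)).card = 2 := fun c => by rw [Nat.card_Icc]; omega
  rw [Finset.card_product, h, h]

theorem sum_indicator_box {x : Fin n → Plane} (hx : ∀ i, x i ∈ halfOpenSquare) (a b : ℕ) :
    ∑ i, (box L a b).indicator (1 : Plane → ℝ) (x i) = boxCount L x a b := by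
  classical
  unfold boxCount
  rw [Finset.card_filter]
  push_cast
  refine Finset.sum_congr rfl fun i _ => ?_
  simp [Set.indicator_apply, box, hx i]

/-- A block has side `2 / L`, hence squared diagonal `8 / L²`; this is the origin of the `8`. -/
theorem dist_le_of_mem_cell (hL : 0 < L) {r : ℝ} (hr : 0 ≤ r) (hLr : 8 ≤ (r * L) ^ 2)
    {x : Fin n → Plane} (hx : ∀ i, x i ∈ halfOpenSquare) {a b : ℕ} {i j : Fin n}
    (hi : i ∈ cell L x a b) (hj : j ∈ cell L x a b) : dist (x i) (x j) ≤ r := by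
  have hL' : (0 : ℝ) < L := by exact_mod_cast hL
  have hcoord : ∀ (y : ℝ) (c : ℕ), 0 ≤ y → c ≤ ⌊(L : ℝ) * y⌋₊ → ⌊(L : ℝ) * y⌋₊ ≤ c + 1 →
      (c : ℝ) ≤ L * y ∧ L * y ≤ c + 2 := by
    intro y c hy h1 h2
    have h3 := Nat.floor_le (show 0 ≤ (L : ℝ) * y by positivity)
    have h4 := Nat.lt_floor_add_one ((L : ℝ) * y)
    have h1' : (c : ℝ) ≤ ⌊(L : ℝ) * y⌋₊ := by exact_mod_cast h1
    have h2' : (⌊(L : ℝ) * y⌋₊ : ℝ) ≤ c + 1 := by exact_mod_cast h2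
    constructor <;> linarith
  simp only [cell, Finset.mem_filter, Finset.mem_univ, true_and, Finset.mem_product,
    Finset.mem_Icc, boxIndex] at hi hj
  obtain ⟨i1, i2⟩ := hcoord _ a (hx i).1.1 hi.1.1 hi.1.2
  obtain ⟨i3, i4⟩ := hcoord _ b (hx i).2.1 hi.2.1 hi.2.2
  obtain ⟨j1, j2⟩ := hcoord _ a (hx j).1.1 hj.1.1 hj.1.2
  obtain ⟨j3, j4⟩ := hcoord _ b (hx j).2.1 hj.2.1 hj.2.2
  rw [EuclideanSpace.dist_eq, Real.sqrt_le_left hr, Fin.sum_univ_two, Real.dist_eq, Real.dist_eq,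
    sq_abs, sq_abs]
  have h1 : ((L : ℝ) * (x i 0 - x j 0)) ^ 2 ≤ 2 ^ 2 := by
    refine sq_le_sq' ?_ ?_ <;> nlinarith
  have h2 : ((L : ℝ) * (x i 1 - x j 1)) ^ 2 ≤ 2 ^ 2 := by
    refine sq_le_sq' ?_ ?_ <;> nlinarith
  have h3 : (L : ℝ) ^ 2 * ((x i 0 - x j 0) ^ 2 + (x i 1 - x j 1) ^ 2) ≤ (L : ℝ) ^ 2 * r ^ 2 := by
    nlinarith
  exact le_of_mul_le_mul_left h3 (by positivity)

/-- The nodes of the block reachable from `i`, by paths that may leave the block, share no key with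
the other nodes of the block, since within a block a shared key is an edge. If `j` were not among
them, one of the two sets would be a key-isolated set of at most half of the block. -/
theorem reachable_of_mem_cell (hL : 0 < L) {r : ℝ} (hr : 0 ≤ r) (hLr : 8 ≤ (r * L) ^ 2)
    {ω : Fin n → Node P K} (hx : ∀ i, (ω i).1 ∈ halfOpenSquare) {a b : ℕ}
    (hns : ¬ KeySplit (fun i => (ω i).2) (cell L (fun i => (ω i).1) a b)) {i j : Fin n}
    (hi : i ∈ cell L (fun i => (ω i).1) a b) (hj : j ∈ cell L (fun i => (ω i).1) a b) :
    (keyGeometricGraph r ω).Reachable i j := by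
  classical
  set M := cell L (fun i => (ω i).1) a b with hM
  by_contra hcon
  set A := M.filter fun k => (keyGeometricGraph r ω).Reachable i k with hA
  have hiA : i ∈ A := Finset.mem_filter.2 ⟨hi, SimpleGraph.Reachable.refl i⟩
  have hjA : j ∈ M \ A := by
    refine Finset.mem_sdiff.2 ⟨hj, fun h => hcon (Finset.mem_filter.1 h).2⟩
  have hAM : A ⊆ M := Finset.filter_subset _ _
  have hno : ∀ k ∈ A, ∀ l ∈ M \ A, ¬ ((ω k).2.val ∩ (ω l).2.val).Nonempty := by
    intro k hk l hl hne
    obtain ⟨hkM, hkR⟩ := Finset.mem_filter.1 hk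
    obtain ⟨hlM, hlA⟩ := Finset.mem_sdiff.1 hl
    refine hlA (Finset.mem_filter.2 ⟨hlM, hkR.trans (SimpleGraph.Adj.reachable ?_)⟩)
    exact ⟨fun h => hlA (h ▸ hk), dist_le_of_mem_cell hL hr hLr (x := fun i => (ω i).1) hx hkM hlM,
      hne⟩
  have hcard := Finset.card_sdiff_add_card_eq_card hAM
  rcases le_total (2 * A.card) M.card with h | h
  · exact hns ⟨A, hAM, ⟨i, hiA⟩, h, hno⟩
  · refine hns ⟨M \ A, Finset.sdiff_subset, ⟨j, hjA⟩, by omega, ?_⟩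
    intro k hk l hl
    rw [Finset.sdiff_sdiff_eq_self hAM] at hl
    rw [Finset.inter_comm]
    exact hno l hl k hk

/-- Two boxes with a common side lie in a common block. Starting from box `(0, 0)`, one reaches
every box `(0, b)` and then varies the first index; nonempty boxes supply the intermediate nodes. -/
theorem connected_of_cells (hL : 2 ≤ L) {r : ℝ} (hr : 0 ≤ r) (hLr : 8 ≤ (r * L) ^ 2)
    {ω : Fin n → Node P K} (hx : ∀ i, (ω i).1 ∈ halfOpenSquare)
    (hne : ∀ a < L, ∀ b < L, 0 < boxCount L (fun i => (ω i).1) a b)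
    (hns : ∀ a, a + 1 < L → ∀ b, b + 1 < L → ¬ KeySplit (fun i => (ω i).2) (cell L (fun i => (ω i).1) a b)) :
    (keyGeometricGraph r ω).Connected := by
  classical
  have hL0 : 0 < L := by omega
  have hL' : (0 : ℝ) < L := by exact_mod_cast hL0
  have hcell : ∀ i j : Fin n, ∀ c d c' d' : ℕ, boxIndex L (ω i).1 = (c, d) →
      boxIndex L (ω j).1 = (c', d') → ∀ a, a + 1 < L → ∀ b, b + 1 < L → a ≤ c → c ≤ a + 1 → b ≤ d → d ≤ b + 1 →
      a ≤ c' → c' ≤ a + 1 → b ≤ d' → d' ≤ b + 1 → (keyGeometricGraph r ω).Reachable i j := by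
    intro i j c d c' d' hi hj a ha b hb h1 h2 h3 h4 h5 h6 h7 h8
    refine reachable_of_mem_cell hL0 hr hLr hx (hns a ha b hb) ?_ ?_
    · simp only [cell, Finset.mem_filter, Finset.mem_univ, true_and, Finset.mem_product,
        Finset.mem_Icc, hi]
      exact ⟨⟨h1, h2⟩, h3, h4⟩
    · simp only [cell, Finset.mem_filter, Finset.mem_univ, true_and, Finset.mem_product,
        Finset.mem_Icc, hj]
      exact ⟨⟨h5, h6⟩, h7, h8⟩
  have hrep : ∀ a < L, ∀ b < L, ∃ i : Fin n, boxIndex L (ω i).1 = (a, b) := by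
    intro a ha b hb
    obtain ⟨i, hi⟩ := Finset.card_pos.1 (hne a ha b hb)
    exact ⟨i, (Finset.mem_filter.1 hi).2⟩
  obtain ⟨o, ho⟩ := hrep 0 hL0 0 hL0
  have hrow : ∀ b < L, ∀ i, boxIndex L (ω i).1 = (0, b) →
      (keyGeometricGraph r ω).Reachable o i := by
    intro b
    induction b with
    | zero =>
      intro _ i hi
      exact hcell o i 0 0 0 0 ho hi 0 (by omega) 0 (by omega) (by omega) (by omega) (by omega) (by omega)
        (by omega) (by omega) (by omega) (by omega)
    | succ b ih =>
      intro hb i hi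
      obtain ⟨j, hj⟩ := hrep 0 hL0 b (by omega)
      exact (ih (by omega) j hj).trans (hcell j i 0 b 0 (b + 1) hj hi 0 (by omega) b (by omega) (by omega)
        (by omega) (by omega) (by omega) (by omega) (by omega) (by omega) (by omega))
  have hall : ∀ a < L, ∀ b < L, ∀ i, boxIndex L (ω i).1 = (a, b) →
      (keyGeometricGraph r ω).Reachable o i := by
    intro a
    induction a with
    | zero => intro _ b hb i hi; exact hrow b hb i hi
    | succ a ih =>
      intro ha b hb i hi
      obtain ⟨j, hj⟩ := hrep a (by omega) b hb
      -- The corner `min b (L - 2)` keeps the block inside the grid when `b = L - 1`.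
      exact (ih (by omega) b hb j hj).trans (hcell j i a b (a + 1) b hj hi a (by omega) (min b (L - 2))
        (by omega)
        (by omega) (by omega) (by omega) (by omega) (by omega) (by omega) (by omega) (by omega))
  -- Half-openness matters here: a coordinate equal to `1` would have index `L`.
  have hidx : ∀ i, (boxIndex L (ω i).1).1 < L ∧ (boxIndex L (ω i).1).2 < L := by
    intro i
    obtain ⟨h0, h1⟩ := hx i
    constructor
    · exact (Nat.floor_lt (mul_nonneg hL'.le h0.1)).2 (by nlinarith [h0.2])
    · exact (Nat.floor_lt (mul_nonneg hL'.le h1.1)).2 (by nlinarith [h1.2])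
  have hreach : ∀ i, (keyGeometricGraph r ω).Reachable o i := fun i =>
    hall _ (hidx i).1 _ (hidx i).2 i rfl
  exact (SimpleGraph.connected_iff _).2 ⟨fun i j => (hreach i).symm.trans (hreach j), ⟨o⟩⟩

end Cells

/-! ### Probability of disconnection for given parameters -/

section Connectivity

/-- Makes the choice of `k₀` in `keysLaw_real_keySplit_le`. The parameter `l` will be `log n`, so
the terms `exp (-(3 * l))` are `n⁻³`. -/
theorem keysLaw_real_keySplit_le_of_large {ι : Type*} [Fintype ι] [DecidableEq ι] {P K : ℕ}
    (hKP : K ≤ P) (hK0 : 0 < K) (M : Finset ι) {ε σ η h l γ : ℝ}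
    (hε : 0 < ε) (hε1 : ε < 1) (hσ : 0 < σ) (hη : η = Real.exp (-(1 / ε + 2)))
    (hh : h = M.card * (K : ℝ) ^ 2 / P) (hm : σ * M.card ≤ P) (hεK : 1 ≤ ε * K)
    (hK : 3 + 1 / ε - Real.log σ + Real.log K ≤ ε * K)
    (hKη : 8 ≤ η * (1 - ε) * K) (hh8 : 8 ≤ ε * (1 - ε) * h) (hm1 : 1 ≤ ε * M.card)
    (hml : 6 * l ≤ ε ^ 2 * M.card) (hml' : 3 * l ≤ M.card) (hPK : (K : ℝ) ≤ η * P)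
    (hPl : 6 * l ≤ ε * η * P) (hhl : (1 + γ) * l ≤ (1 - ε) ^ 2 * h)
    (hsmall : M.card * Real.exp (-((1 + γ) * l)) ≤ 1 / 2) :
    (keysLaw ι P K).real {S | KeySplit S M} ≤
      3 * (M.card * Real.exp (-((1 + γ) * l))) + 2 * Real.exp (-(3 * l)) := by
  have hP : 0 < P := by omega
  have hP' : (0 : ℝ) < P := by exact_mod_cast hP
  have hK' : (0 : ℝ) < K := by exact_mod_cast hK0
  have hη0 : 0 < η := by rw [hη]; exact Real.exp_pos _
  obtain ⟨m, hmdef⟩ : ∃ m : ℝ, m = M.card := ⟨_, rfl⟩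
  rw [← hmdef] at hh hm hm1 hml hml' hsmall ⊢
  have hmpos : 0 < m := pos_of_mul_pos_right (zero_lt_one.trans_le hm1) hε.le
  have hm1' : 1 ≤ m := by
    rw [hmdef] at hmpos ⊢
    exact_mod_cast hmpos
  have hh0 : 0 ≤ h := by rw [hh]; positivity
  -- The largest size allowed by both constraints on `k₀`: `k₀ ≤ ε m` and `k₀ K ≤ η P`. Since `y ≥
  -- 1`, rounding down loses at most a factor two.
  set y : ℝ := min (ε * m) (η * P / K) with hy
  have hy1 : 1 ≤ y := le_min hm1 ((one_le_div hK').2 hPK)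
  set k₀ : ℕ := ⌊y⌋₊ with hk₀
  have hk₀y : (k₀ : ℝ) ≤ y := Nat.floor_le (by linarith)
  have hk₀1 : 1 ≤ k₀ := (Nat.one_le_floor_iff y).2 hy1
  have hk₀1' : (1 : ℝ) ≤ k₀ := by exact_mod_cast hk₀1
  have hk₀2 : y / 2 ≤ k₀ := by
    have := Nat.lt_floor_add_one y
    linarith
  have hexp : Real.exp (-((1 - ε) ^ 2 * h)) ≤ Real.exp (-((1 + γ) * l)) :=
    Real.exp_le_exp.2 (neg_le_neg hhl)
  have key := keysLaw_real_keySplit_le hKP hK0 M hε hε1 hσ (hmdef ▸ hm) hεK hK hk₀1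
    (hmdef ▸ hk₀y.trans (min_le_left _ _)) (by
      have : (k₀ : ℝ) ≤ η * P / K := hk₀y.trans (min_le_right _ _)
      rw [le_div_iff₀ hK'] at this
      rwa [← hη]) (hmdef ▸ hh) (hmdef ▸ (mul_le_mul_of_nonneg_left hexp hmpos.le).trans hsmall)
  rw [← hmdef] at key
  have b1 : m * Real.exp (-((1 - ε) ^ 2 * h)) ≤ m * Real.exp (-((1 + γ) * l)) :=
    mul_le_mul_of_nonneg_left hexp hmpos.le
  have b2 : Real.exp (-((1 - ε) * h)) ≤ m * Real.exp (-((1 + γ) * l)) := by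
    have h1 : (1 - ε) ^ 2 * h ≤ (1 - ε) * h := by
      refine mul_le_mul_of_nonneg_right ?_ hh0
      nlinarith
    have h2 : Real.exp (-((1 - ε) * h)) ≤ Real.exp (-((1 + γ) * l)) :=
      Real.exp_le_exp.2 (by linarith)
    nlinarith [Real.exp_pos (-((1 + γ) * l))]
  have hy3 : 6 * l ≤ ε * K * y := by
    rcases min_choice (ε * m) (η * P / K) with h1 | h1
    · rw [hy, h1]
      have hK1 : (1 : ℝ) ≤ K := by exact_mod_cast hK0
      have h2 : ε ^ 2 * m * 1 ≤ ε ^ 2 * m * K :=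
        mul_le_mul_of_nonneg_left hK1 (mul_nonneg (sq_nonneg ε) hmpos.le)
      calc 6 * l ≤ ε ^ 2 * m * 1 := by rw [mul_one]; exact hml
        _ ≤ ε ^ 2 * m * K := h2
        _ = ε * K * (ε * m) := by ring
    · rw [hy, h1]
      have : ε * K * (η * P / K) = ε * η * P := by field_simp
      linarith
  have b3 : Real.exp (-(ε * K * k₀)) ≤ Real.exp (-(3 * l)) := by
    refine Real.exp_le_exp.2 ?_
    have : ε * K * (y / 2) ≤ ε * K * k₀ := mul_le_mul_of_nonneg_left hk₀2 (by positivity)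
    linarith
  -- Then `(1 - ε) / 2 * h * k₀ ≥ 2 m`: one `m` beats `2 ^ m`, the other is at least `3 l`.
  have hy4 : 8 * m ≤ (1 - ε) * h * y := by
    rcases min_choice (ε * m) (η * P / K) with h1 | h1
    · rw [hy, h1]
      calc 8 * m ≤ ε * (1 - ε) * h * m := mul_le_mul_of_nonneg_right hh8 hmpos.le
        _ = (1 - ε) * h * (ε * m) := by ring
    · rw [hy, h1]
      have : (1 - ε) * h * (η * P / K) = η * (1 - ε) * K * m := by
        rw [hh]; field_simp
      rw [this]
      exact mul_le_mul_of_nonneg_right hKη hmpos.le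
  have b4 : 2 ^ M.card * Real.exp (-((1 - ε) / 2 * h * k₀)) ≤ Real.exp (-(3 * l)) := by
    have h1 : (2 : ℝ) ^ M.card ≤ Real.exp m := by
      have : (2 : ℝ) ≤ Real.exp 1 := by linarith [Real.add_one_le_exp (1 : ℝ)]
      calc (2 : ℝ) ^ M.card ≤ Real.exp 1 ^ M.card := by gcongr
        _ = Real.exp m := by rw [hmdef]; exact Real.exp_one_pow M.card
    have h2 : (1 - ε) / 2 * h * (y / 2) ≤ (1 - ε) / 2 * h * k₀ :=
      mul_le_mul_of_nonneg_left hk₀2 (mul_nonneg (by linarith) hh0)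
    calc 2 ^ M.card * Real.exp (-((1 - ε) / 2 * h * k₀))
        ≤ Real.exp m * Real.exp (-((1 - ε) / 2 * h * k₀)) := by gcongr
      _ = Real.exp (m - (1 - ε) / 2 * h * k₀) := by rw [← Real.exp_add]; congr 1
      _ ≤ _ := Real.exp_le_exp.2 (by linarith)
  linarith

theorem pi_real_exists_not_mem_halfOpenSquare (n : ℕ) :
    (Measure.pi fun _ : Fin n => locLaw).real {x | ∃ i, x i ∉ halfOpenSquare} = 0 := by
  have h := pi_real_forall_mem_eq (ι := Fin n) locLaw Finset.univ Set.univ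
    (fun _ => halfOpenSquare) (fun _ _ => by simp) (fun _ _ => rfl) (by
      simp only [Set.mem_univ, true_and, Finset.mem_univ, forall_true_left]
      exact MeasurableSet.univ_pi' fun _ => measurableSet_halfOpenSquare)
    MeasurableSet.univ (fun _ _ => locLaw_real_halfOpenSquare)
  simp only [Set.mem_univ, true_and, Finset.mem_univ, forall_true_left, one_pow, one_mul,
    probReal_univ] at h
  have hm : MeasurableSet {x : Fin n → Plane | ∀ i, x i ∈ halfOpenSquare} :=
    MeasurableSet.univ_pi' fun _ => measurableSet_halfOpenSquare
  have hc := probReal_compl_eq_one_sub (μ := Measure.pi fun _ : Fin n => locLaw) hm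
  rw [h, sub_self] at hc
  rw [← hc]
  congr 1
  ext x
  simp

/-- Fix the locations. Unless some box count leaves the range between `(1 - ε) N` and `2 N`, where
`N = n / L²`, disconnection forces a key split in some block, and only the rings remain random. The
first term is the Chernoff cost over the boxes, the second a union bound over the blocks. -/
theorem networkLaw_real_not_connected_le {n P K L : ℕ} (hKP : K ≤ P) (hL : 2 ≤ L)
    (hn : 0 < n) {r ε b : ℝ} (hr : 0 ≤ r) (hLr : 8 ≤ (r * L) ^ 2) (hε : 0 < ε) (hε1 : ε < 1)
    (hb : 0 ≤ b)
    (hsplit : ∀ M : Finset (Fin n), 4 * ((1 - ε) * (n / (L : ℝ) ^ 2)) ≤ M.card →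
      (M.card : ℝ) ≤ 4 * (2 * (n / (L : ℝ) ^ 2)) →
      (keysLaw (Fin n) P K).real {S | KeySplit S M} ≤ b) :
    (networkLaw n P K).real {ω | ¬ (keyGeometricGraph r ω).Connected} ≤
      (L : ℝ) ^ 2 * (Real.exp (-(ε ^ 2 / 2 * (n / (L : ℝ) ^ 2))) +
        Real.exp (-(1 / 4 * (n / (L : ℝ) ^ 2)))) + (L : ℝ) ^ 2 * b := by
  classical
  have hkey := keyLaw_isProbabilityMeasure hKP
  have hL0 : 0 < L := by omega
  have hL' : (0 : ℝ) < L := by exact_mod_cast hL0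
  have hn' : (0 : ℝ) < n := by exact_mod_cast hn
  set N : ℝ := n / (L : ℝ) ^ 2 with hN
  have hNpos : 0 < N := by positivity
  let grid : Finset (ℕ × ℕ) := Finset.range L ×ˢ Finset.range L
  have hgrid : (grid.card : ℝ) = (L : ℝ) ^ 2 := by
    simp [grid, Finset.card_product, sq]
  let lo : ℕ × ℕ → Set (Fin n → Plane) := fun c =>
    {x | ∑ i, (box L c.1 c.2).indicator (1 : Plane → ℝ) (x i) ≤ (1 - ε) * N}
  let hi : ℕ × ℕ → Set (Fin n → Plane) := fun c =>
    {x | 2 * N ≤ ∑ i, (box L c.1 c.2).indicator (1 : Plane → ℝ) (x i)}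
  have hcount : ∀ c : ℕ × ℕ, Measurable fun x : Fin n → Plane =>
      ∑ i, (box L c.1 c.2).indicator (1 : Plane → ℝ) (x i) := fun c =>
    Finset.measurable_sum _ fun i _ =>
      (measurable_one.indicator (measurableSet_box L c.1 c.2)).comp (measurable_pi_apply i)
  let bad : Set (Fin n → Plane) := {x | ∃ i, x i ∉ halfOpenSquare} ∪ ⋃ c ∈ grid, (lo c ∪ hi c)
  have hbadm : MeasurableSet bad := by
    refine MeasurableSet.union ?_ (Finset.measurableSet_biUnion _ fun c _ => ?_)
    · have : {x : Fin n → Plane | ∃ i, x i ∉ halfOpenSquare} =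
          {x | ∀ i, x i ∈ halfOpenSquare}ᶜ := by
        ext x; simp
      rw [this]
      exact (MeasurableSet.univ_pi' fun _ => measurableSet_halfOpenSquare).compl
    · exact (measurableSet_le (hcount c) measurable_const).union
        (measurableSet_le measurable_const (hcount c))
  have hbad : (Measure.pi fun _ : Fin n => locLaw).real bad ≤
      (L : ℝ) ^ 2 * (Real.exp (-(ε ^ 2 / 2 * N)) + Real.exp (-(1 / 4 * N))) := by
    refine (measureReal_union_le _ _).trans ?_
    rw [pi_real_exists_not_mem_halfOpenSquare, zero_add]
    refine (measureReal_biUnion_finset_le _ _).trans ?_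
    rw [← hgrid, ← nsmul_eq_mul]
    refine Finset.sum_le_card_nsmul _ _ _ fun c hc => ?_
    obtain ⟨hc1, hc2⟩ := Finset.mem_product.1 hc
    have hbox := locLaw_real_box hL0 (Finset.mem_range.1 hc1) (Finset.mem_range.1 hc2)
    have hNb : (Fintype.card (Fin n) : ℝ) * locLaw.real (box L c.1 c.2) = N := by
      rw [hbox, Fintype.card_fin, hN]; ring
    have t1 := pi_real_count_lower_tail (ι := Fin n) locLaw (measurableSet_box L c.1 c.2) hε
    have t2 := pi_real_count_upper_tail (ι := Fin n) locLaw (measurableSet_box L c.1 c.2)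
    rw [hNb] at t1 t2
    exact (measureReal_union_le _ _).trans (add_le_add t1 t2)
  have hmain := pi_prod_real_le (ι := Fin n) locLaw (keyLaw P K)
    (E := {ω : Fin n → Node P K | ¬ (keyGeometricGraph r ω).Connected})
    (measurableSet_keyGeometricGraph r fun G => ¬ G.Connected) hbadm
    (b := (L : ℝ) ^ 2 * b) (by positivity) (fun x hx => by
      have hx1 : ∀ i, x i ∈ halfOpenSquare := by
        intro i
        by_contra h
        exact hx (Or.inl ⟨i, h⟩)
      have hx2 : ∀ c ∈ grid, (1 - ε) * N < boxCount L x c.1 c.2 ∧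
          (boxCount L x c.1 c.2 : ℝ) < 2 * N := by
        intro c hc
        rw [← sum_indicator_box hx1]
        constructor
        · by_contra h
          exact hx (Or.inr (Set.mem_biUnion hc (Or.inl (not_lt.1 h))))
        · by_contra h
          exact hx (Or.inr (Set.mem_biUnion hc (Or.inr (not_lt.1 h))))
      have hcell : ∀ c ∈ Finset.range (L - 1) ×ˢ Finset.range (L - 1),
          (keysLaw (Fin n) P K).real {S | KeySplit S (cell L x c.1 c.2)} ≤ b := by
        intro c hc
        obtain ⟨hc1, hc2⟩ := Finset.mem_product.1 hc
        rw [Finset.mem_range] at hc1 hc2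
        have hsub : ∀ d ∈ Finset.Icc c.1 (c.1 + 1) ×ˢ Finset.Icc c.2 (c.2 + 1), d ∈ grid := by
          intro d hd
          obtain ⟨hd1, hd2⟩ := Finset.mem_product.1 hd
          rw [Finset.mem_Icc] at hd1 hd2
          exact Finset.mem_product.2 ⟨Finset.mem_range.2 (by omega), Finset.mem_range.2 (by omega)⟩
        have hcard := card_block c.1 c.2
        have h4 : ((cell L x c.1 c.2).card : ℝ) = ∑ d ∈ Finset.Icc c.1 (c.1 + 1) ×ˢ
            Finset.Icc c.2 (c.2 + 1), (boxCount L x d.1 d.2 : ℝ) := by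
          rw [card_cell]; push_cast; rfl
        refine hsplit _ ?_ ?_
        · rw [h4]
          have := Finset.card_nsmul_le_sum _ (fun d : ℕ × ℕ => (boxCount L x d.1 d.2 : ℝ))
            ((1 - ε) * N) (fun d hd => (hx2 d (hsub d hd)).1.le)
          rw [hcard] at this
          simpa [nsmul_eq_mul] using this
        · rw [h4]
          have := Finset.sum_le_card_nsmul _ (fun d : ℕ × ℕ => (boxCount L x d.1 d.2 : ℝ))
            (2 * N) (fun d hd => (hx2 d (hsub d hd)).2.le)
          rw [hcard] at this
          simpa [nsmul_eq_mul] using this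
      have hcover : {S : Fin n → KeyRing P K | (fun i => (x i, S i)) ∈
          {ω : Fin n → Node P K | ¬ (keyGeometricGraph r ω).Connected}} ⊆
          ⋃ c ∈ Finset.range (L - 1) ×ˢ Finset.range (L - 1),
            {S : Fin n → KeyRing P K | KeySplit S (cell L x c.1 c.2)} := by
        intro S hS
        by_contra hcon
        simp only [Set.mem_iUnion, not_exists] at hcon
        refine hS (connected_of_cells hL hr hLr (ω := fun i => (x i, S i)) hx1 ?_ ?_)
        · intro a ha b hb
          have := (hx2 (a, b) (Finset.mem_product.2 ⟨Finset.mem_range.2 ha,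
            Finset.mem_range.2 hb⟩)).1
          have h0 : (0 : ℝ) < boxCount L x a b :=
            lt_trans (mul_pos (by linarith) hNpos) this
          exact_mod_cast h0
        · intro a ha b hb
          exact hcon (a, b) (Finset.mem_product.2 ⟨Finset.mem_range.2 (by omega),
            Finset.mem_range.2 (by omega)⟩)
      refine (measureReal_mono hcover (measure_ne_top _ _)).trans ?_
      refine (measureReal_biUnion_finset_le _ _).trans ?_
      refine (Finset.sum_le_card_nsmul _ _ _ hcell).trans ?_
      rw [nsmul_eq_mul]
      refine mul_le_mul_of_nonneg_right ?_ hb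
      rw [Finset.card_product, Finset.card_range, sq]
      push_cast
      have : ((L - 1 : ℕ) : ℝ) ≤ L := by exact_mod_cast Nat.sub_le L 1
      gcongr)
  refine le_trans hmain ?_
  linarith

end Connectivity

/-! ### Part (ii): the choice of constants and the limit -/

section ConnectivityAsymptotics

/-- The budget for `ε = δ / 8`. The argument loses `(1 - ε)` by rounding the grid, `(1 - ε)` in the
box counts and `(1 - ε)²` in the key graph; a degree `log n / (1 - δ)` still leaves the exponent `1
+ δ / 2`. -/
theorem one_add_half_mul_one_sub_le {δ : ℝ} (hδ : 0 < δ) (hδ1 : δ < 1) :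
    (1 + δ / 2) * (1 - δ) ≤ (1 - δ / 8) ^ 2 * (1 - δ / 8) ^ 2 := by
  have h2 : 1 - δ / 4 ≤ (1 - δ / 8) ^ 2 := by nlinarith
  have h3 : (1 - δ / 4) * (1 - δ / 4) ≤ (1 - δ / 8) ^ 2 * (1 - δ / 8) ^ 2 :=
    mul_le_mul h2 h2 (by linarith) (sq_nonneg _)
  nlinarith

set_option maxHeartbeats 1000000 in
theorem probConnected_ge_of_large {n P K : ℕ} {r σ δ ε η : ℝ} (hδ : 0 < δ) (hδ1 : δ < 1)
    (hεδ : ε = δ / 8) (hη : η = Real.exp (-(1 / ε + 2))) (hσ : 0 < σ) (hn : 1 ≤ Real.log n)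
    (hr : 0 < r) (hr1 : r ≤ 1) (hrε : (1 - ε) * (Real.sqrt 8 + r) ^ 2 ≤ 8) (hK0 : 0 < K)
    (hKP : K ≤ P) (hPσ : σ * n * r ^ 2 ≤ P) (hεK : 1 ≤ ε * K)
    (hK : 3 + 1 / ε - Real.log σ + Real.log K ≤ ε * K) (hKη : 8 ≤ η * (1 - ε) * K)
    (hx : (K : ℝ) ^ 2 / P ≤ η) (hlog : 8 ≤ ε * (1 - ε) * Real.log n)
    (hγ : Real.exp (-(δ / 2 * Real.log n)) ≤ 1 / 2)
    (hnr : 64 * Real.log n ≤ ε ^ 2 * (n * r ^ 2)) (hnr' : 6 * Real.log n ≤ ε * η * σ * (n * r ^ 2))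
    (hdeg : 2 / (1 - δ) * Real.log n ≤ n * r ^ 2 * ((K : ℝ) ^ 2 / P)) :
    1 - 28 / (n : ℝ) ^ (δ / 2) ≤ probConnected n P K r := by
  have hε : 0 < ε := by rw [hεδ]; linarith
  have hε8 : ε ≤ 1 / 8 := by rw [hεδ]; linarith
  have hη0 : 0 < η := by rw [hη]; exact Real.exp_pos _
  have hP : 0 < P := by omega
  have hP' : (0 : ℝ) < P := by exact_mod_cast hP
  have hn0 : 0 < n := by
    rcases Nat.eq_zero_or_pos n with h | h
    · simp [h] at hn; linarith
    · exact h
  have hn' : (0 : ℝ) < n := by exact_mod_cast hn0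
  obtain ⟨l, hl⟩ : ∃ l, l = Real.log n := ⟨_, rfl⟩
  rw [← hl] at hn hlog hγ hnr hnr' hdeg
  have hln : Real.exp l = n := by rw [hl, Real.exp_log hn']
  obtain ⟨d, hd⟩ : ∃ d : ℝ, d = n * r ^ 2 := ⟨_, rfl⟩
  rw [← hd] at hnr hnr' hdeg
  have hPd : σ * d ≤ P := by rw [hd]; linarith
  have hd0 : 0 < d := by rw [hd]; positivity
  have hdn : d ≤ n := by
    rw [hd]
    exact mul_le_of_le_one_right hn'.le (pow_le_one₀ hr.le hr1)
  -- the grid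
  set L : ℕ := ⌈Real.sqrt 8 / r⌉₊ with hL
  have h8 : Real.sqrt 8 ^ 2 = 8 := Real.sq_sqrt (by norm_num)
  have h80 : 0 ≤ Real.sqrt 8 := Real.sqrt_nonneg 8
  have h82 : 2 ≤ Real.sqrt 8 := Real.le_sqrt_of_sq_le (by norm_num)
  have hL1 : Real.sqrt 8 ≤ r * L := by
    have := Nat.le_ceil (Real.sqrt 8 / r)
    rw [div_le_iff₀ hr] at this
    linarith
  have hL2 : r * L ≤ Real.sqrt 8 + r := by
    have := (Nat.ceil_lt_add_one (show 0 ≤ Real.sqrt 8 / r by positivity)).le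
    have h2 : (Real.sqrt 8 / r + 1) * r = Real.sqrt 8 + r := by field_simp
    rw [← h2, mul_comm]
    exact mul_le_mul_of_nonneg_right this hr.le
  have hL3 : (2 : ℝ) ≤ L := by
    have : r * L ≤ L := mul_le_of_le_one_left (Nat.cast_nonneg L) hr1
    linarith
  have hL4 : 2 ≤ L := by exact_mod_cast hL3
  have hLr : 8 ≤ (r * L) ^ 2 := by
    rw [← h8]
    exact pow_le_pow_left₀ h80 hL1 2
  have hLr' : (1 - ε) * (r * L) ^ 2 ≤ 8 := by
    refine le_trans (mul_le_mul_of_nonneg_left ?_ (by linarith)) hrε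
    exact pow_le_pow_left₀ (by linarith) hL2 2
  have hLpos : (0 : ℝ) < L := by linarith
  obtain ⟨N, hN⟩ : ∃ N : ℝ, N = n / (L : ℝ) ^ 2 := ⟨_, rfl⟩
  have hNL : N * (L : ℝ) ^ 2 = n := by rw [hN]; field_simp
  have hNd : N * (r * L) ^ 2 = d := by rw [hd, ← hNL]; ring
  have hN0 : 0 < N := by rw [hN]; positivity
  have hN1 : 8 * N ≤ d := by
    rw [← hNd, mul_comm]
    exact mul_le_mul_of_nonneg_left hLr hN0.le
  have hN2 : (1 - ε) * d ≤ 8 * N := by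
    rw [← hNd]
    calc (1 - ε) * (N * (r * L) ^ 2) = N * ((1 - ε) * (r * L) ^ 2) := by ring
      _ ≤ N * 8 := mul_le_mul_of_nonneg_left hLr' hN0.le
      _ = 8 * N := by ring
  have hN3 : d ≤ 16 * N := by
    have := mul_le_mul_of_nonneg_right hε8 hd0.le
    linarith
  have hε2 : ε ^ 2 ≤ 1 / 2 := by
    have := pow_le_pow_left₀ hε.le hε8 2
    linarith
  -- Each box then deviates with probability at most a constant times `n⁻²`, while there are at most
  -- `n` boxes.
  have hNl : 2 * l ≤ ε ^ 2 / 2 * N := by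
    have : ε ^ 2 * d ≤ ε ^ 2 * (16 * N) := mul_le_mul_of_nonneg_left hN3 (sq_nonneg ε)
    linarith
  have hN4 : 1 ≤ N := by
    have := mul_le_mul_of_nonneg_right hε2 hN0.le
    linarith
  have hLn : (L : ℝ) ^ 2 ≤ n := by
    rw [← hNL]
    exact le_mul_of_one_le_left (by positivity) hN4
  obtain ⟨e, he⟩ : ∃ e : ℝ, e = Real.exp (-((1 + δ / 2) * l)) := ⟨_, rfl⟩
  have he0 : 0 < e := by rw [he]; exact Real.exp_pos _
  have hne : n * e = Real.exp (-(δ / 2 * l)) := by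
    rw [he, ← hln, ← Real.exp_add]; congr 1; ring
  have hsplit : ∀ M : Finset (Fin n), 4 * ((1 - ε) * (n / (L : ℝ) ^ 2)) ≤ M.card →
      (M.card : ℝ) ≤ 4 * (2 * (n / (L : ℝ) ^ 2)) →
      (keysLaw (Fin n) P K).real {S | KeySplit S M} ≤
        3 * (8 * N * e) + 2 * Real.exp (-(3 * l)) := by
    intro M hM1 hM2
    rw [← hN] at hM1 hM2
    have hmd : (M.card : ℝ) ≤ d := by linarith
    have hdm : (1 - ε) ^ 2 / 2 * d ≤ M.card := by
      have : (1 - ε) * ((1 - ε) * d) ≤ (1 - ε) * (8 * N) :=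
        mul_le_mul_of_nonneg_left hN2 (by linarith)
      linarith
    have hdm' : d / 4 ≤ M.card := by
      have h1 : 1 / 2 ≤ (1 - ε) ^ 2 := by
        have := pow_le_pow_left₀ (by norm_num) (show 7 / 8 ≤ 1 - ε by linarith) 2
        linarith
      have := mul_le_mul_of_nonneg_right h1 hd0.le
      linarith
    have hε2m : 16 * l ≤ ε ^ 2 * M.card := by
      have := mul_le_mul_of_nonneg_left hdm' (sq_nonneg ε)
      linarith
    have hm0 : (0 : ℝ) ≤ M.card := Nat.cast_nonneg _
    have hm1 : ε ^ 2 * M.card ≤ 1 * M.card := mul_le_mul_of_nonneg_right (by linarith) hm0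
    have hm2 : ε ^ 2 * M.card ≤ ε * M.card := by
      refine mul_le_mul_of_nonneg_right ?_ hm0
      rw [sq]
      exact mul_le_of_le_one_left hε.le (by linarith)
    have hx0 : 0 ≤ (K : ℝ) ^ 2 / P := by positivity
    obtain ⟨h, hh⟩ : ∃ h : ℝ, h = M.card * (K : ℝ) ^ 2 / P := ⟨_, rfl⟩
    -- A block is only guaranteed nearly half of `d = n r²` nodes, which uses up the factor `2` in
    -- `hdeg`.
    have hh1 : (1 - ε) ^ 2 / (1 - δ) * l ≤ h := by
      have h1 : (1 - ε) ^ 2 / 2 * d * ((K : ℝ) ^ 2 / P) ≤ M.card * ((K : ℝ) ^ 2 / P) :=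
        mul_le_mul_of_nonneg_right hdm hx0
      have h2 := mul_le_mul_of_nonneg_left hdeg (show 0 ≤ (1 - ε) ^ 2 / 2 by positivity)
      calc (1 - ε) ^ 2 / (1 - δ) * l = (1 - ε) ^ 2 / 2 * (2 / (1 - δ) * l) := by ring
        _ ≤ (1 - ε) ^ 2 / 2 * (d * ((K : ℝ) ^ 2 / P)) := h2
        _ = (1 - ε) ^ 2 / 2 * d * ((K : ℝ) ^ 2 / P) := by ring
        _ ≤ M.card * ((K : ℝ) ^ 2 / P) := h1
        _ = h := by rw [hh]; ring
    have hδ0 : 0 < 1 - δ := by linarith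
    have hhl : (1 + δ / 2) * l ≤ (1 - ε) ^ 2 * h := by
      have h1 := mul_le_mul_of_nonneg_left hh1 (sq_nonneg (1 - ε))
      refine le_trans ?_ h1
      rw [← mul_assoc]
      refine mul_le_mul_of_nonneg_right ?_ (by linarith)
      rw [← mul_div_assoc, le_div_iff₀ hδ0]
      rw [hεδ]
      exact one_add_half_mul_one_sub_le hδ hδ1
    have hlh : l ≤ h := by
      have h0 : 0 ≤ h := by rw [hh]; positivity
      have h1 : (1 - ε) ^ 2 * h ≤ 1 * h :=
        mul_le_mul_of_nonneg_right (pow_le_one₀ (by linarith) (by linarith)) h0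
      have h2 : 0 ≤ δ / 2 * l := by positivity
      linarith
    have hkey := keysLaw_real_keySplit_le_of_large hKP hK0 M (γ := δ / 2) (l := l) hε
      (by linarith) hσ hη hh
      (by
        have := mul_le_mul_of_nonneg_left hmd hσ.le
        linarith) hεK hK hKη
      (by
        have : ε * (1 - ε) * l ≤ ε * (1 - ε) * h :=
          mul_le_mul_of_nonneg_left hlh (mul_nonneg hε.le (by linarith))
        linarith)
      (by linarith) (by linarith) (by linarith)
      (by
        rw [div_le_iff₀ hP'] at hx
        have hK1 : (1 : ℝ) ≤ K := by exact_mod_cast hK0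
        exact (le_self_pow₀ hK1 two_ne_zero).trans hx)
      (by
        have := mul_le_mul_of_nonneg_left hPd (mul_nonneg hε.le hη0.le)
        linarith) hhl
      (by
        rw [← he]
        have := mul_le_mul_of_nonneg_right (hmd.trans hdn) he0.le
        linarith)
    rw [← he] at hkey
    have : M.card * e ≤ 8 * N * e := mul_le_mul_of_nonneg_right (by linarith) he0.le
    linarith
  have hb0 : 0 ≤ 3 * (8 * N * e) + 2 * Real.exp (-(3 * l)) := by positivity
  have hmain := networkLaw_real_not_connected_le hKP hL4 hn0 hr.le hLr hε (by linarith) hb0 hsplit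
  rw [← hN] at hmain
  have hsq : 0 ≤ (L : ℝ) ^ 2 := by positivity
  have hexpδ : ∀ s : ℝ, l ≤ s → Real.exp (-s) ≤ Real.exp (-(δ / 2 * l)) := fun s hs =>
    Real.exp_le_exp.2 (neg_le_neg ((mul_le_of_le_one_left (by linarith) (by linarith)).trans hs))
  have t1 : (L : ℝ) ^ 2 * (Real.exp (-(ε ^ 2 / 2 * N)) + Real.exp (-(1 / 4 * N))) ≤
      2 * Real.exp (-(δ / 2 * l)) := by
    have h1 : Real.exp (-(ε ^ 2 / 2 * N)) ≤ Real.exp (-(2 * l)) :=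
      Real.exp_le_exp.2 (neg_le_neg hNl)
    have h2 : Real.exp (-(1 / 4 * N)) ≤ Real.exp (-(2 * l)) := by
      refine Real.exp_le_exp.2 (neg_le_neg (hNl.trans ?_))
      exact mul_le_mul_of_nonneg_right (by linarith) hN0.le
    have h3 : n * Real.exp (-(2 * l)) = Real.exp (-l) := by
      rw [← hln, ← Real.exp_add]; congr 1; ring
    calc (L : ℝ) ^ 2 * (Real.exp (-(ε ^ 2 / 2 * N)) + Real.exp (-(1 / 4 * N)))
        ≤ n * (Real.exp (-(2 * l)) + Real.exp (-(2 * l))) :=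
          mul_le_mul hLn (add_le_add h1 h2) (by positivity) hn'.le
      _ = 2 * Real.exp (-l) := by rw [← h3]; ring
      _ ≤ _ := by linarith [hexpδ l le_rfl]
  -- As `L² N = n`, the sum over blocks of a bound proportional to the block size is proportional to
  -- `n * e = n^{-δ/2}`. The constant is `24 + 2`, and with the `2` of `t1` it gives `28`.
  have t2 : (L : ℝ) ^ 2 * (3 * (8 * N * e) + 2 * Real.exp (-(3 * l))) ≤
      26 * Real.exp (-(δ / 2 * l)) := by
    have h1 : (L : ℝ) ^ 2 * (3 * (8 * N * e)) = 24 * Real.exp (-(δ / 2 * l)) := by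
      rw [← hne, ← hNL]; ring
    have h2 : n * Real.exp (-(3 * l)) = Real.exp (-(2 * l)) := by
      rw [← hln, ← Real.exp_add]; congr 1; ring
    have h3 : (L : ℝ) ^ 2 * Real.exp (-(3 * l)) ≤ n * Real.exp (-(3 * l)) :=
      mul_le_mul_of_nonneg_right hLn (Real.exp_pos _).le
    have h4 := hexpδ (2 * l) (by linarith)
    linarith
  have hprob := networkLaw_isProbabilityMeasure (n := n) hKP
  have hpow : 28 / (n : ℝ) ^ (δ / 2) = 28 * Real.exp (-(δ / 2 * l)) := by
    rw [Real.rpow_def_of_pos hn', ← hl, Real.exp_neg, div_eq_mul_inv, mul_comm l]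
  have hcompl := probReal_compl_eq_one_sub (μ := networkLaw n P K)
    (measurableSet_keyGeometricGraph (P := P) (K := K) (n := n) r fun G => G.Connected)
  have hset : {ω : Fin n → Node P K | (keyGeometricGraph r ω).Connected}ᶜ =
      {ω | ¬ (keyGeometricGraph r ω).Connected} := rfl
  rw [hset] at hcompl
  rw [hpow]
  unfold probConnected
  linarith

theorem eventually_probConnected_ge (K P : ℕ → ℕ) (r : ℕ → ℝ) (σ : ℝ) (hσ : 0 < σ)
    (hr_pos : ∀ᶠ n in atTop, 0 < r n) (hr_lim : Tendsto r atTop (𝓝 0))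
    (hK_lim : Tendsto K atTop atTop)
    (hKP_lim : Tendsto (fun n => (K n : ℝ) ^ 2 / (P n : ℝ)) atTop (𝓝 0))
    (hPK : ∀ᶠ n in atTop, 2 * K n ≤ P n)
    (hPσ : ∀ᶠ n : ℕ in atTop, σ * (n : ℝ) * r n ^ 2 ≤ (P n : ℝ))
    (δ : ℝ) (hδ : 0 < δ) (hδ1 : δ < 1)
    (hdeg : ∀ᶠ n : ℕ in atTop, 2 * Real.pi / (1 - δ) * (Real.log n / (n : ℝ)) <
      Real.pi * r n ^ 2 * ((K n : ℝ) ^ 2 / (P n : ℝ))) :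
    ∀ᶠ n : ℕ in atTop, 1 - 28 / (n : ℝ) ^ (δ / 2) ≤ probConnected n (P n) (K n) (r n) := by
  obtain ⟨ε, hε⟩ : ∃ ε, ε = δ / 8 := ⟨_, rfl⟩
  obtain ⟨η, hη⟩ : ∃ η, η = Real.exp (-(1 / ε + 2)) := ⟨_, rfl⟩
  have hε0 : 0 < ε := by rw [hε]; linarith
  have hε1 : ε < 1 := by rw [hε]; linarith
  have hη0 : 0 < η := by rw [hη]; exact Real.exp_pos _
  have hlog : Tendsto (fun n : ℕ => Real.log n) atTop atTop :=
    Real.tendsto_log_atTop.comp tendsto_natCast_atTop_atTop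
  have hKr : Tendsto (fun n => (K n : ℝ)) atTop atTop :=
    tendsto_natCast_atTop_atTop.comp hK_lim
  have hrε : ∀ᶠ n in atTop, (1 - ε) * (Real.sqrt 8 + r n) ^ 2 ≤ 8 := by
    have h1 : Tendsto (fun n => (1 - ε) * (Real.sqrt 8 + r n) ^ 2) atTop
        (𝓝 ((1 - ε) * (Real.sqrt 8 + 0) ^ 2)) :=
      ((hr_lim.const_add _).pow 2).const_mul _
    rw [add_zero, Real.sq_sqrt (by norm_num)] at h1
    exact h1.eventually_le_const (by linarith)
  have hKlog : ∀ᶠ n in atTop, 3 + 1 / ε - Real.log σ + Real.log (K n) ≤ ε * K n := by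
    have h1 : ∀ᶠ y : ℝ in atTop, Real.log y ≤ ε / 2 * y := by
      have := Real.isLittleO_log_id_atTop.def (half_pos hε0)
      filter_upwards [this, eventually_ge_atTop 0] with y hy hy0
      simp only [id, Real.norm_eq_abs, abs_of_nonneg hy0] at hy
      exact (le_abs_self _).trans hy
    have h2 : ∀ᶠ y : ℝ in atTop, 3 + 1 / ε - Real.log σ ≤ ε / 2 * y :=
      (tendsto_id.const_mul_atTop (half_pos hε0)).eventually_ge_atTop _
    filter_upwards [hKr.eventually h1, hKr.eventually h2] with n h3 h4
    linarith
  have hdeg' : ∀ᶠ n : ℕ in atTop,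
      2 / (1 - δ) * Real.log n ≤ n * r n ^ 2 * ((K n : ℝ) ^ 2 / P n) := by
    filter_upwards [hdeg, eventually_gt_atTop 0] with n h hn
    have hn' : (0 : ℝ) < n := by exact_mod_cast hn
    have h2 := (mul_le_mul_of_nonneg_left h.le (div_nonneg hn'.le Real.pi_pos.le))
    have e1 : (n : ℝ) / Real.pi * (2 * Real.pi / (1 - δ) * (Real.log n / n)) =
        2 / (1 - δ) * Real.log n := by
      field_simp
    have e2 : (n : ℝ) / Real.pi * (Real.pi * r n ^ 2 * ((K n : ℝ) ^ 2 / P n)) =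
        n * r n ^ 2 * ((K n : ℝ) ^ 2 / P n) := by
      field_simp
    rwa [e1, e2] at h2
  -- Because `K² / P → 0`, the degree condition forces `n r²` to dominate `log n`, which the
  -- Chernoff bounds need.
  have hnr : ∀ C : ℝ, 0 < C → ∀ᶠ n : ℕ in atTop, Real.log n ≤ C * (n * r n ^ 2) := by
    intro C hC
    filter_upwards [hdeg', hKP_lim.eventually_le_const hC, hlog.eventually_ge_atTop 0]
      with n h1 h2 h3
    have h4 : Real.log n ≤ 2 / (1 - δ) * Real.log n := by
      refine le_mul_of_one_le_left h3 ?_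
      rw [le_div_iff₀ (by linarith)]
      linarith
    have h5 := mul_le_mul_of_nonneg_left h2 (show 0 ≤ n * r n ^ 2 by positivity)
    linarith
  filter_upwards [hr_pos, hr_lim.eventually_le_const zero_lt_one, hrε, hPK, hPσ,
    hK_lim.eventually_ge_atTop 1, hKlog, hlog.eventually_ge_atTop 1, hdeg',
    (hKr.const_mul_atTop hε0).eventually_ge_atTop 1,
    (hKr.const_mul_atTop (show 0 < η * (1 - ε) from mul_pos hη0 (by linarith))).eventually_ge_atTop 8,
    hKP_lim.eventually_le_const hη0,
    (hlog.const_mul_atTop (show 0 < ε * (1 - ε) from mul_pos hε0 (by linarith))).eventually_ge_atTop 8,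
    (Real.tendsto_exp_neg_atTop_nhds_zero.comp
      (hlog.const_mul_atTop (half_pos hδ))).eventually_le_const (show (0 : ℝ) < 1 / 2 by norm_num),
    hnr (ε ^ 2 / 64) (by positivity), hnr (ε * η * σ / 6) (by positivity)]
    with n h1 h2 h3 h4 h5 h6 h7 h8 h9 h10 h11 h12 h13 h14 h15 h16
  exact probConnected_ge_of_large hδ hδ1 hε hη hσ h8 h1 h2 h3 h6 (by omega) h5 h10 h7 h11 h12 h13
    h14 (by linarith) (by linarith) h9

theorem tendsto_one_of_eventually_ge (K P : ℕ → ℕ) (r : ℕ → ℝ)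
    (hPK : ∀ᶠ n in atTop, 2 * K n ≤ P n) {c₂ c₃ : ℝ} (hc₃ : 0 < c₃)
    (h : ∀ᶠ n : ℕ in atTop, 1 - c₂ / (n : ℝ) ^ c₃ ≤ probConnected n (P n) (K n) (r n)) :
    Tendsto (fun n => probConnected n (P n) (K n) (r n)) atTop (𝓝 1) := by
  have h1 : Tendsto (fun n : ℕ => 1 - c₂ / (n : ℝ) ^ c₃) atTop (𝓝 (1 - 0)) :=
    (((tendsto_rpow_atTop hc₃).comp tendsto_natCast_atTop_atTop).const_div_atTop c₂).const_sub 1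
  rw [sub_zero] at h1
  refine tendsto_of_tendsto_of_tendsto_of_le_of_le' h1 tendsto_const_nhds h ?_
  filter_upwards [hPK] with n hn
  have := networkLaw_isProbabilityMeasure (n := n) (show K n ≤ P n by omega)
  exact measureReal_le_one

end ConnectivityAsymptotics

/-! ### Part (i): isolated nodes away from the boundary -/

section IsolatedNodes

variable {n P K : ℕ} {r : ℝ}

/-- The points of the unit square at distance at least `r` from its boundary. -/
def innerSquare (r : ℝ) : Set Plane :=
  {x | x 0 ∈ Set.Ico r (1 - r) ∧ x 1 ∈ Set.Ico r (1 - r)}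

theorem measurableSet_innerSquare (r : ℝ) : MeasurableSet (innerSquare r) :=
  measurableSet_rect measurableSet_Ico measurableSet_Ico

theorem locLaw_real_innerSquare (hr : 0 ≤ r) (hr2 : r ≤ 1 / 2) :
    locLaw.real (innerSquare r) = (1 - 2 * r) ^ 2 := by
  rw [innerSquare, locLaw_real_rect hr (by linarith) (by linarith) hr (by linarith) (by linarith)]
  ring

theorem closedBall_subset_unitSquare {x : Plane} (hx : x ∈ innerSquare r) :
    Metric.closedBall x r ⊆ unitSquare := by
  intro y hy
  have hcoord : ∀ i, |y i - x i| ≤ r := by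
    intro i
    have := PiLp.norm_apply_le (y - x) i
    rw [PiLp.sub_apply, Real.norm_eq_abs, ← dist_eq_norm] at this
    exact this.trans hy
  rw [unitSquare_eq_rect]
  have h0 := abs_le.1 (hcoord 0)
  have h1 := abs_le.1 (hcoord 1)
  obtain ⟨⟨a1, a2⟩, b1, b2⟩ := hx
  exact ⟨⟨by linarith, by linarith⟩, by linarith, by linarith⟩

theorem setOf_linked (r : ℝ) (z : Node P K) :
    {w | Linked r z w} = Metric.closedBall z.1 r ×ˢ {T | (z.2.val ∩ T.val).Nonempty} := by
  ext w
  simp [Linked, dist_comm]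

theorem nodeLaw_real_prod (s : Set Plane) (t : Set (KeyRing P K)) (h : K ≤ P) :
    (nodeLaw P K).real (s ×ˢ t) = locLaw.real s * (keyLaw P K).real t := by
  have := keyLaw_isProbabilityMeasure h
  exact measureReal_prod_prod s t

/-- An equality, because the whole disc around an inner point lies in the square; boundary effects
are avoided rather than estimated. -/
theorem nodeLaw_real_linked (hr : 0 ≤ r) (h : K ≤ P) {z : Node P K} (hz : z.1 ∈ innerSquare r) :
    (nodeLaw P K).real {w | Linked r z w} = Real.pi * r ^ 2 * linkProb P K := by
  rw [setOf_linked, nodeLaw_real_prod _ _ h, keyLaw_real_link h,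
    locLaw_real_of_subset (closedBall_subset_unitSquare hz), measureReal_closedBall hr]

theorem nodeLaw_real_linked_le (hr : 0 ≤ r) (h : K ≤ P) (hP : 0 < P) (z : Node P K) :
    (nodeLaw P K).real {w | Linked r z w} ≤ Real.pi * r ^ 2 * linkProb P K := by
  rw [setOf_linked, nodeLaw_real_prod _ _ h, keyLaw_real_link h]
  exact mul_le_mul_of_nonneg_right (locLaw_real_closedBall_le hr z.1) (linkProb_nonneg h hP)

theorem nodeLaw_real_dist_le (hr : 0 ≤ r) (h : K ≤ P) (z : Node P K) :
    (nodeLaw P K).real {w | dist z.1 w.1 ≤ r} ≤ Real.pi * r ^ 2 := by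
  have := keyLaw_isProbabilityMeasure h
  have hset : {w : Node P K | dist z.1 w.1 ≤ r} = Metric.closedBall z.1 r ×ˢ Set.univ := by
    ext w
    simp [dist_comm]
  rw [hset, nodeLaw_real_prod _ _ h, probReal_univ, mul_one]
  exact locLaw_real_closedBall_le hr z.1

theorem measurableSet_linked_left (r : ℝ) (z : Node P K) : MeasurableSet {w | Linked r z w} :=
  measurableSet_linked measurable_const measurable_id r

theorem nodeLaw_real_not_linked (hr : 0 ≤ r) (h : K ≤ P) {z : Node P K}
    (hz : z.1 ∈ innerSquare r) :
    (nodeLaw P K).real {w | ¬ Linked r z w} = 1 - Real.pi * r ^ 2 * linkProb P K := by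
  have := nodeLaw_isProbabilityMeasure h
  rw [← nodeLaw_real_linked hr h hz,
    ← probReal_compl_eq_one_sub (measurableSet_linked_left r z)]
  rfl

theorem nodeLaw_real_not_linked_pair (h : K ≤ P) (r : ℝ) (z₁ z₂ : Node P K) :
    (nodeLaw P K).real {w | ¬ Linked r z₁ w ∧ ¬ Linked r z₂ w} =
      1 - (nodeLaw P K).real ({w | Linked r z₁ w} ∪ {w | Linked r z₂ w}) := by
  have := nodeLaw_isProbabilityMeasure h
  rw [← probReal_compl_eq_one_sub
    ((measurableSet_linked_left r z₁).union (measurableSet_linked_left r z₂))]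
  congr 1
  ext w
  simp

theorem nodeLaw_real_not_linked_of_far (hr : 0 ≤ r) (h : K ≤ P) {z₁ z₂ : Node P K}
    (hz₁ : z₁.1 ∈ innerSquare r) (hz₂ : z₂.1 ∈ innerSquare r) (hfar : 2 * r < dist z₁.1 z₂.1) :
    (nodeLaw P K).real {w | ¬ Linked r z₁ w ∧ ¬ Linked r z₂ w} ≤
      1 - 2 * (Real.pi * r ^ 2 * linkProb P K) := by
  have := nodeLaw_isProbabilityMeasure h
  have hdis : Disjoint {w | Linked r z₁ w} {w | Linked r z₂ w} := by
    rw [Set.disjoint_left]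
    rintro w ⟨h1, -⟩ ⟨h2, -⟩
    have := dist_triangle_right z₁.1 z₂.1 w.1
    linarith
  rw [nodeLaw_real_not_linked_pair h, measureReal_union hdis (measurableSet_linked_left r z₂),
    nodeLaw_real_linked hr h hz₁, nodeLaw_real_linked hr h hz₂]
  linarith

/-- Inclusion-exclusion: even if the discs coincide, disjoint rings are both met with probability at
most `p²`, so the overlap is at most `p` times the link probability. -/
theorem nodeLaw_real_not_linked_of_disjoint (hr : 0 ≤ r) (h : 2 * K ≤ P) {z₁ z₂ : Node P K}
    (hz₁ : z₁.1 ∈ innerSquare r) (hz₂ : z₂.1 ∈ innerSquare r)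
    (hdis : ¬ (z₁.2.val ∩ z₂.2.val).Nonempty) :
    (nodeLaw P K).real {w | ¬ Linked r z₁ w ∧ ¬ Linked r z₂ w} ≤
      1 - (2 - linkProb P K) * (Real.pi * r ^ 2 * linkProb P K) := by
  have hKP : K ≤ P := by omega
  have := nodeLaw_isProbabilityMeasure hKP
  have hie := measureReal_union_add_inter (μ := nodeLaw P K) (s := {w | Linked r z₁ w})
    (t := {w | Linked r z₂ w}) (measurableSet_linked_left r z₂)
  rw [nodeLaw_real_linked hr hKP hz₁, nodeLaw_real_linked hr hKP hz₂] at hie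
  have hint : (nodeLaw P K).real ({w | Linked r z₁ w} ∩ {w | Linked r z₂ w}) ≤
      Real.pi * r ^ 2 * linkProb P K ^ 2 := by
    have hsub : {w | Linked r z₁ w} ∩ {w | Linked r z₂ w} ⊆ Metric.closedBall z₁.1 r ×ˢ
        {T | (z₁.2.val ∩ T.val).Nonempty ∧ (z₂.2.val ∩ T.val).Nonempty} := by
      rintro w ⟨h1, h2⟩
      exact ⟨by simpa [dist_comm] using h1.1, h1.2, h2.2⟩
    refine (measureReal_mono hsub (measure_ne_top _ _)).trans ?_
    rw [nodeLaw_real_prod _ _ hKP]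
    exact mul_le_mul (locLaw_real_closedBall_le hr _) (keyLaw_real_link_link_le h _ _ hdis)
      measureReal_nonneg (by positivity)
  rw [nodeLaw_real_not_linked_pair hKP]
  nlinarith

/-- The disc around the second point contains a disc of radius `r / 2` that misses the first one;
its area is the extra quarter. Nothing is assumed about the two rings. -/
theorem nodeLaw_real_not_linked_of_apart (hr : 0 < r) (h : K ≤ P) {z₁ z₂ : Node P K}
    (hz₁ : z₁.1 ∈ innerSquare r) (hz₂ : z₂.1 ∈ innerSquare r) (hd : r < dist z₁.1 z₂.1) :
    (nodeLaw P K).real {w | ¬ Linked r z₁ w ∧ ¬ Linked r z₂ w} ≤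
      1 - 5 / 4 * (Real.pi * r ^ 2 * linkProb P K) := by
  have := nodeLaw_isProbabilityMeasure h
  set x := z₁.1
  set y := z₂.1
  have hd' : r < ‖y - x‖ := by rwa [← dist_eq_norm, dist_comm]
  have hpos : 0 < ‖y - x‖ := hr.trans hd'
  -- The point at distance `r / 2` beyond `y` on the ray from `x`; its distance from `x` exceeds `3
  -- r / 2`.
  set c : Plane := y + (r / 2 / ‖y - x‖) • (y - x) with hc
  have hcy : dist c y = r / 2 := by
    rw [dist_eq_norm, hc, add_sub_cancel_left, norm_smul, Real.norm_eq_abs,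
      abs_of_nonneg (by positivity), div_mul_cancel₀ _ hpos.ne']
  have hcx : dist c x = ‖y - x‖ + r / 2 := by
    have : c - x = (1 + r / 2 / ‖y - x‖) • (y - x) := by
      rw [hc, add_smul, one_smul]; abel
    rw [dist_eq_norm, this, norm_smul, Real.norm_eq_abs, abs_of_nonneg (by positivity), add_mul,
      one_mul, div_mul_cancel₀ _ hpos.ne']
  have hby : Metric.ball c (r / 2) ⊆ Metric.closedBall y r := by
    intro w hw
    have h1 := dist_triangle w c y
    rw [Metric.mem_ball] at hw
    rw [Metric.mem_closedBall]
    linarith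
  have hdis : Disjoint {w | Linked r z₁ w}
      (Metric.ball c (r / 2) ×ˢ {T | (z₂.2.val ∩ T.val).Nonempty}) := by
    rw [Set.disjoint_left]
    rintro w ⟨h1, -⟩ ⟨h2, -⟩
    have h3 := dist_triangle c w.1 x
    rw [Metric.mem_ball, dist_comm] at h2
    rw [dist_comm] at h1
    linarith
  have hm : MeasurableSet (Metric.ball c (r / 2) ×ˢ
      {T : KeyRing P K | (z₂.2.val ∩ T.val).Nonempty}) :=
    measurableSet_ball.prod MeasurableSet.of_discrete
  have hu := measureReal_union (μ := nodeLaw P K) hdis hm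
  rw [nodeLaw_real_linked hr.le h hz₁, nodeLaw_real_prod _ _ h, keyLaw_real_link h,
    locLaw_real_of_subset (hby.trans (closedBall_subset_unitSquare hz₂)),
    measureReal_ball (by linarith)] at hu
  have hsub : {w | Linked r z₁ w} ∪
      (Metric.ball c (r / 2) ×ˢ {T | (z₂.2.val ∩ T.val).Nonempty}) ⊆
      {w | Linked r z₁ w} ∪ {w | Linked r z₂ w} := by
    refine Set.union_subset_union_right _ ?_
    rw [setOf_linked]
    exact Set.prod_mono hby le_rfl
  have hle := measureReal_mono (μ := nodeLaw P K) hsub (measure_ne_top _ _)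
  rw [nodeLaw_real_not_linked_pair h]
  rw [hu] at hle
  linarith

/-- Node `i` lies in the inner square and has no neighbours. -/
def isolatedInner (n P K : ℕ) (r : ℝ) (i : Fin n) : Set (Fin n → Node P K) :=
  {ω | ω ∈ {ω : Fin n → Node P K | (ω i).1 ∈ innerSquare r} ∧
    ∀ k ∈ Finset.univ.erase i, ω k ∈ {w | ¬ Linked r (ω i) w}}

theorem measurableSet_inner (r : ℝ) (i : Fin n) :
    MeasurableSet {ω : Fin n → Node P K | (ω i).1 ∈ innerSquare r} :=
  (measurable_pi_apply i).fst (measurableSet_innerSquare r)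

theorem measurableSet_isolatedInner (r : ℝ) (i : Fin n) :
    MeasurableSet (isolatedInner n P K r i) := by
  refine (measurableSet_inner r i).inter ?_
  have : {ω : Fin n → Node P K | ∀ k ∈ Finset.univ.erase i, ω k ∈ {w | ¬ Linked r (ω i) w}} =
      ⋂ k ∈ Finset.univ.erase i, {ω | Linked r (ω i) (ω k)}ᶜ := by
    ext ω
    simp
  change MeasurableSet
    {ω : Fin n → Node P K | ∀ k ∈ Finset.univ.erase i, ω k ∈ {w | ¬ Linked r (ω i) w}}
  rw [this]
  exact Finset.measurableSet_biInter _ fun k _ =>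
    (measurableSet_linked (measurable_pi_apply i) (measurable_pi_apply k) r).compl

theorem networkLaw_real_forall_inner (h : K ≤ P) (hr : 0 ≤ r) (hr2 : r ≤ 1 / 2)
    (t : Finset (Fin n)) :
    (networkLaw n P K).real {ω | ∀ i ∈ t, (ω i).1 ∈ innerSquare r} =
      ((1 - 2 * r) ^ 2) ^ t.card := by
  have := nodeLaw_isProbabilityMeasure h
  have hk := keyLaw_isProbabilityMeasure h
  have hc : (nodeLaw P K).real {w | w.1 ∈ innerSquare r} = (1 - 2 * r) ^ 2 := by
    have hset : {w : Node P K | w.1 ∈ innerSquare r} = innerSquare r ×ˢ Set.univ := by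
      ext w
      simp
    rw [hset, nodeLaw_real_prod _ _ h, probReal_univ, mul_one, locLaw_real_innerSquare hr hr2]
  have hm : MeasurableSet {ω : Fin n → Node P K | ω ∈ Set.univ ∧
      ∀ i ∈ t, ω i ∈ {w : Node P K | w.1 ∈ innerSquare r}} := by
    have : {ω : Fin n → Node P K | ω ∈ Set.univ ∧
        ∀ i ∈ t, ω i ∈ {w : Node P K | w.1 ∈ innerSquare r}} =
        ⋂ i ∈ t, {ω | (ω i).1 ∈ innerSquare r} := by
      ext ω
      simp
    rw [this]
    exact Finset.measurableSet_biInter _ fun i _ => measurableSet_inner r i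
  have hG := pi_real_forall_mem_eq (ι := Fin n) (nodeLaw P K) t Set.univ
    (fun _ => {w : Node P K | w.1 ∈ innerSquare r}) (fun _ _ => by simp) (fun _ _ => rfl) hm
    MeasurableSet.univ (fun _ _ => hc)
  simpa [networkLaw] using hG

theorem networkLaw_real_isolatedInner (h : K ≤ P) (hr : 0 ≤ r) (hr2 : r ≤ 1 / 2) (i : Fin n) :
    (networkLaw n P K).real (isolatedInner n P K r i) =
      (1 - Real.pi * r ^ 2 * linkProb P K) ^ (n - 1) * (1 - 2 * r) ^ 2 := by
  have := nodeLaw_isProbabilityMeasure h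
  have hi : ∀ (ω : Fin n → Node P K) (y : (k : (Finset.univ.erase i : Finset (Fin n))) → Node P K),
      Function.updateFinset ω (Finset.univ.erase i) y i = ω i := by
    intro ω y
    simp [Function.updateFinset]
  have hG := pi_real_forall_mem_eq (ι := Fin n) (nodeLaw P K) (Finset.univ.erase i)
    {ω | (ω i).1 ∈ innerSquare r} (fun ω => {w | ¬ Linked r (ω i) w})
    (fun ω y => by simp only [Set.mem_ofPred_eq, hi]) (fun ω y => by simp only [hi])
    (measurableSet_isolatedInner r i) (measurableSet_inner r i)
    (fun ω hω => nodeLaw_real_not_linked hr h hω)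
  rw [Finset.card_erase_of_mem (Finset.mem_univ i), Finset.card_univ, Fintype.card_fin] at hG
  have h1 := networkLaw_real_forall_inner h hr hr2 {i}
  simp only [Finset.mem_singleton, forall_eq, Finset.card_singleton, pow_one] at h1
  rw [← h1]
  exact hG

theorem networkLaw_real_pair_le (h : K ≤ P) {i j : Fin n} (hij : i ≠ j)
    (Q : Node P K → Node P K → Prop) (hQ : MeasurableSet {ω : Fin n → Node P K | Q (ω i) (ω j)})
    {c : ℝ} (hc : ∀ z₁ z₂, Q z₁ z₂ →
      (nodeLaw P K).real {w | ¬ Linked r z₁ w ∧ ¬ Linked r z₂ w} ≤ c) :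
    (networkLaw n P K).real {ω | Q (ω i) (ω j) ∧
      ∀ k ∈ (Finset.univ.erase i).erase j, ¬ Linked r (ω i) (ω k) ∧ ¬ Linked r (ω j) (ω k)} ≤
      c ^ (n - 2) * (networkLaw n P K).real {ω | Q (ω i) (ω j)} := by
  have := nodeLaw_isProbabilityMeasure h
  set t : Finset (Fin n) := (Finset.univ.erase i).erase j with ht
  have hit : i ∉ t := by simp [ht]
  have hjt : j ∉ t := by simp [ht]
  have hcard : t.card = n - 2 := by
    rw [ht, Finset.card_erase_of_mem (by simp [hij.symm]),
      Finset.card_erase_of_mem (Finset.mem_univ i), Finset.card_univ, Fintype.card_fin]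
    omega
  have hi : ∀ (ω : Fin n → Node P K) (y : (k : t) → Node P K),
      Function.updateFinset ω t y i = ω i := by
    intro ω y
    simp [Function.updateFinset, hit]
  have hj : ∀ (ω : Fin n → Node P K) (y : (k : t) → Node P K),
      Function.updateFinset ω t y j = ω j := by
    intro ω y
    simp [Function.updateFinset, hjt]
  have hm : MeasurableSet {ω : Fin n → Node P K | ω ∈ {ω : Fin n → Node P K | Q (ω i) (ω j)} ∧
      ∀ k ∈ t, ω k ∈ {w | ¬ Linked r (ω i) w ∧ ¬ Linked r (ω j) w}} := by
    refine hQ.inter ?_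
    have : {ω : Fin n → Node P K | ∀ k ∈ t, ω k ∈ {w | ¬ Linked r (ω i) w ∧ ¬ Linked r (ω j) w}} =
        ⋂ k ∈ t, ({ω | Linked r (ω i) (ω k)}ᶜ ∩ {ω | Linked r (ω j) (ω k)}ᶜ) := by
      ext ω
      simp
    change MeasurableSet
      {ω : Fin n → Node P K | ∀ k ∈ t, ω k ∈ {w | ¬ Linked r (ω i) w ∧ ¬ Linked r (ω j) w}}
    rw [this]
    exact Finset.measurableSet_biInter _ fun k _ =>
      (measurableSet_linked (measurable_pi_apply i) (measurable_pi_apply k) r).compl.inter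
        (measurableSet_linked (measurable_pi_apply j) (measurable_pi_apply k) r).compl
  have hG := pi_real_forall_mem_le (ι := Fin n) (nodeLaw P K) t
    {ω | Q (ω i) (ω j)} (fun ω => {w | ¬ Linked r (ω i) w ∧ ¬ Linked r (ω j) w})
    (fun ω y => by simp only [Set.mem_ofPred_eq, hi, hj]) (fun ω y => by simp only [hi, hj])
    hm hQ (fun ω hω => hc _ _ hω)
  rw [hcard] at hG
  exact hG

theorem networkLaw_real_neighbour_le (h : K ≤ P) {i j : Fin n} (hij : i ≠ j)
    (Q : Node P K → Node P K → Prop) (hQ : MeasurableSet {ω : Fin n → Node P K | Q (ω i) (ω j)})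
    {c : ℝ} (hc : ∀ z, (nodeLaw P K).real {w | Q z w} ≤ c) :
    (networkLaw n P K).real {ω | Q (ω i) (ω j)} ≤ c := by
  have := nodeLaw_isProbabilityMeasure h
  have hi : ∀ (ω : Fin n → Node P K) (y : (k : ({j} : Finset (Fin n))) → Node P K),
      Function.updateFinset ω {j} y i = ω i := by
    intro ω y
    simp [Function.updateFinset, hij]
  have hG := pi_real_forall_mem_le (ι := Fin n) (nodeLaw P K) {j} Set.univ
    (fun ω => {w | Q (ω i) w}) (fun _ _ => by simp) (fun ω y => by simp only [hi])
    (by simpa using hQ) MeasurableSet.univ (fun ω _ => hc (ω i))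
  simpa [networkLaw] using hG

theorem measurableSet_dist_le (s : ℝ) (i j : Fin n) :
    MeasurableSet {ω : Fin n → Node P K | dist (ω i).1 (ω j).1 ≤ s} :=
  measurableSet_le ((measurable_pi_apply i).fst.dist (measurable_pi_apply j).fst) measurable_const

/-- One summand per case: distance above `2r`; distance at most `2r` with disjoint rings; distance
at most `2r` with a common key. In the last case nonadjacency forces distance above `r`, and the
factor `4 a` contains the probability of a common key, unlike `4 π r²` in the second. -/
theorem networkLaw_real_isolatedInner_inter_le (h : 2 * K ≤ P) (hP : 0 < P) (hr : 0 < r)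
    (hr2 : r ≤ 1 / 2) {p a : ℝ} (hp : p = linkProb P K) (ha : a = Real.pi * r ^ 2 * p)
    (ha2 : a ≤ 1 / 2) {i j : Fin n} (hij : i ≠ j) :
    (networkLaw n P K).real (isolatedInner n P K r i ∩ isolatedInner n P K r j) ≤
      (1 - 2 * a) ^ (n - 2) * ((1 - 2 * r) ^ 2) ^ 2 +
      (1 - (2 - p) * a) ^ (n - 2) * (4 * (Real.pi * r ^ 2)) +
      (1 - 5 / 4 * a) ^ (n - 2) * (4 * a) := by
  have hKP : K ≤ P := by omega
  have hprob := networkLaw_isProbabilityMeasure (n := n) hKP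
  have hp0 : 0 ≤ p := hp ▸ linkProb_nonneg hKP hP
  have ha0 : 0 ≤ a := by rw [ha]; positivity
  let Q₁ : Node P K → Node P K → Prop := fun z₁ z₂ =>
    (z₁.1 ∈ innerSquare r ∧ z₂.1 ∈ innerSquare r) ∧ ¬ dist z₁.1 z₂.1 ≤ 2 * r
  let Q₂ : Node P K → Node P K → Prop := fun z₁ z₂ =>
    (z₁.1 ∈ innerSquare r ∧ z₂.1 ∈ innerSquare r) ∧ dist z₁.1 z₂.1 ≤ 2 * r ∧
      ¬ (z₁.2.val ∩ z₂.2.val).Nonempty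
  let Q₃ : Node P K → Node P K → Prop := fun z₁ z₂ =>
    (z₁.1 ∈ innerSquare r ∧ z₂.1 ∈ innerSquare r) ∧ Linked (2 * r) z₁ z₂ ∧ ¬ dist z₁.1 z₂.1 ≤ r
  have hin : MeasurableSet {ω : Fin n → Node P K |
      (ω i).1 ∈ innerSquare r ∧ (ω j).1 ∈ innerSquare r} :=
    (measurableSet_inner r i).inter (measurableSet_inner r j)
  have hQ₁ : MeasurableSet {ω : Fin n → Node P K | Q₁ (ω i) (ω j)} :=
    hin.inter (measurableSet_dist_le (2 * r) i j).compl
  have hQ₂ : MeasurableSet {ω : Fin n → Node P K | Q₂ (ω i) (ω j)} :=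
    hin.inter ((measurableSet_dist_le (2 * r) i j).inter (measurableSet_keys
      (measurable_pi_apply i).snd (measurable_pi_apply j).snd
      fun S T => ¬ (S.val ∩ T.val).Nonempty))
  have hQ₃ : MeasurableSet {ω : Fin n → Node P K | Q₃ (ω i) (ω j)} :=
    hin.inter ((measurableSet_linked (measurable_pi_apply i) (measurable_pi_apply j) (2 * r)).inter
      (measurableSet_dist_le r i j).compl)
  have b₁ := networkLaw_real_pair_le (r := r) hKP hij Q₁ hQ₁ (c := 1 - 2 * a) (by
    rintro z₁ z₂ ⟨⟨h1, h2⟩, h3⟩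
    rw [ha, hp]
    exact nodeLaw_real_not_linked_of_far hr.le hKP h1 h2 (not_le.1 h3))
  have b₂ := networkLaw_real_pair_le (r := r) hKP hij Q₂ hQ₂ (c := 1 - (2 - p) * a) (by
    rintro z₁ z₂ ⟨⟨h1, h2⟩, -, h3⟩
    rw [ha, hp]
    exact nodeLaw_real_not_linked_of_disjoint hr.le h h1 h2 h3)
  have b₃ := networkLaw_real_pair_le (r := r) hKP hij Q₃ hQ₃ (c := 1 - 5 / 4 * a) (by
    rintro z₁ z₂ ⟨⟨h1, h2⟩, -, h3⟩
    rw [ha, hp]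
    exact nodeLaw_real_not_linked_of_apart hr hKP h1 h2 (not_le.1 h3))
  have d₁ : (networkLaw n P K).real {ω | Q₁ (ω i) (ω j)} ≤ ((1 - 2 * r) ^ 2) ^ 2 := by
    have h1 := networkLaw_real_forall_inner (n := n) hKP hr.le hr2 {i, j}
    rw [Finset.card_pair hij] at h1
    rw [← h1]
    refine measureReal_mono ?_ (measure_ne_top _ _)
    rintro ω ⟨⟨h1, h2⟩, -⟩ k hk
    rcases Finset.mem_insert.1 hk with rfl | hk
    · exact h1
    · rw [Finset.mem_singleton.1 hk]; exact h2
  have d₂ : (networkLaw n P K).real {ω | Q₂ (ω i) (ω j)} ≤ 4 * (Real.pi * r ^ 2) := by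
    have h1 := networkLaw_real_neighbour_le hKP hij (fun z w : Node P K => dist z.1 w.1 ≤ 2 * r)
      (measurableSet_dist_le (2 * r) i j)
      (fun z => nodeLaw_real_dist_le (by linarith) hKP z)
    have h2 : (networkLaw n P K).real {ω | Q₂ (ω i) (ω j)} ≤
        (networkLaw n P K).real {ω | dist (ω i).1 (ω j).1 ≤ 2 * r} :=
      measureReal_mono (fun ω hω => hω.2.1) (measure_ne_top _ _)
    linarith
  have d₃ : (networkLaw n P K).real {ω | Q₃ (ω i) (ω j)} ≤ 4 * a := by
    have h1 := networkLaw_real_neighbour_le hKP hij (fun z w : Node P K => Linked (2 * r) z w)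
      (measurableSet_linked (measurable_pi_apply i) (measurable_pi_apply j) (2 * r))
      (fun z => nodeLaw_real_linked_le (by linarith) hKP hP z)
    have h2 : (networkLaw n P K).real {ω | Q₃ (ω i) (ω j)} ≤
        (networkLaw n P K).real {ω | Linked (2 * r) (ω i) (ω j)} :=
      measureReal_mono (fun ω hω => hω.2.1) (measure_ne_top _ _)
    rw [ha, hp]
    linarith
  let F : (Node P K → Node P K → Prop) → Set (Fin n → Node P K) := fun Q => {ω | Q (ω i) (ω j) ∧
      ∀ k ∈ (Finset.univ.erase i).erase j, ¬ Linked r (ω i) (ω k) ∧ ¬ Linked r (ω j) (ω k)}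
  have hcover : isolatedInner n P K r i ∩ isolatedInner n P K r j ⊆ (F Q₁ ∪ F Q₂) ∪ F Q₃ := by
    rintro ω ⟨⟨hi1, hi2⟩, hj1, hj2⟩
    have hrest : ∀ k ∈ (Finset.univ.erase i).erase j,
        ¬ Linked r (ω i) (ω k) ∧ ¬ Linked r (ω j) (ω k) := by
      intro k hk
      obtain ⟨hkj, hki⟩ := Finset.mem_erase.1 hk
      exact ⟨hi2 k hki, hj2 k (Finset.mem_erase.2 ⟨hkj, Finset.mem_univ k⟩)⟩
    have hnl : ¬ Linked r (ω i) (ω j) :=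
      hi2 j (Finset.mem_erase.2 ⟨hij.symm, Finset.mem_univ j⟩)
    by_cases hd : dist (ω i).1 (ω j).1 ≤ 2 * r
    · by_cases hk : ((ω i).2.val ∩ (ω j).2.val).Nonempty
      · exact Or.inr ⟨⟨⟨hi1, hj1⟩, ⟨hd, hk⟩, fun hle => hnl ⟨hle, hk⟩⟩, hrest⟩
      · exact Or.inl (Or.inr ⟨⟨⟨hi1, hj1⟩, hd, hk⟩, hrest⟩)
    · exact Or.inl (Or.inl ⟨⟨⟨hi1, hj1⟩, hd⟩, hrest⟩)
  refine (measureReal_mono hcover (measure_ne_top _ _)).trans ?_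
  refine (measureReal_union_le _ _).trans (add_le_add ((measureReal_union_le _ _).trans
    (add_le_add (b₁.trans ?_) (b₂.trans ?_))) (b₃.trans ?_))
  · exact mul_le_mul_of_nonneg_left d₁ (pow_nonneg (by linarith) _)
  · exact mul_le_mul_of_nonneg_left d₂ (pow_nonneg (by nlinarith) _)
  · exact mul_le_mul_of_nonneg_left d₃ (pow_nonneg (by linarith) _)

theorem iUnion_isolatedInner_subset (hn : 2 ≤ n) (r : ℝ) :
    ⋃ i, isolatedInner n P K r i ⊆
      {ω : Fin n → Node P K | ¬ (keyGeometricGraph r ω).Connected} := by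
  intro ω hω hconn
  obtain ⟨i, -, hi⟩ := Set.mem_iUnion.1 hω
  have : Nontrivial (Fin n) := Fin.nontrivial_iff_two_le.2 hn
  obtain ⟨j, hj⟩ := hconn.preconnected.exists_adj_of_nontrivial i
  exact hi j (Finset.mem_erase.2 ⟨hj.1.symm, Finset.mem_univ j⟩) hj.2

end IsolatedNodes

/-! ### Part (i): second moment asymptotics -/

section DisconnectednessAsymptotics

theorem exp_neg_le_one_sub_pow {b : ℝ} (hb2 : b ≤ 1 / 2) (k : ℕ) :
    Real.exp (-(k * (b + 2 * b ^ 2))) ≤ (1 - b) ^ k := by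
  -- Indeed `(1 - b)(1 + b + 2 b²) = 1 + b² (1 - 2 b)`.
  have h1 : 1 ≤ (1 - b) * Real.exp (b + 2 * b ^ 2) := by
    have h2 : 1 + (b + 2 * b ^ 2) ≤ Real.exp (b + 2 * b ^ 2) := by
      linarith [Real.add_one_le_exp (b + 2 * b ^ 2)]
    have h3 := mul_le_mul_of_nonneg_left h2 (show 0 ≤ 1 - b by linarith)
    nlinarith [mul_nonneg (sq_nonneg b) (show 0 ≤ 1 - 2 * b by linarith)]
  have h2 : Real.exp (-(b + 2 * b ^ 2)) ≤ 1 - b := by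
    rw [Real.exp_neg, inv_le_iff_one_le_mul₀ (Real.exp_pos _)]
    exact h1
  rw [show -(k * (b + 2 * b ^ 2)) = k * -(b + 2 * b ^ 2) by ring, Real.exp_nat_mul]
  exact pow_le_pow_left₀ (Real.exp_pos _).le h2 k

theorem one_sub_pow_le_exp {y : ℝ} (hy : y ≤ 1) (k : ℕ) : (1 - y) ^ k ≤ Real.exp (-(k * y)) := by
  rw [show -(k * y) = k * -y by ring, Real.exp_nat_mul]
  exact pow_le_pow_left₀ (by linarith) (by linarith [Real.add_one_le_exp (-y)]) k

/-- For near pairs with disjoint rings the factor `r²` must absorb `exp (3 x l)`, which need not be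
bounded since `x` may tend to zero slowly. But if `3 x l > 1`, then `π r² x = b` forces `r² ≤ l b`,
of order `l² e^{-l}`, while `x ≤ 1/20` keeps the exponential below `e^{l/2}`. -/
theorem sq_mul_exp_le {r x l c b w : ℝ} (hc : 0 < c) (hl : 1 ≤ l) (hx0 : 0 < x) (hx : x ≤ 1 / 20)
    (hb : b = (l + c) * Real.exp (-l)) (heq : Real.pi * r ^ 2 * x = b)
    (hw : w = (l + c) ^ 2 * Real.exp (-(l / 8))) :
    r ^ 2 * Real.exp (3 * x * l) ≤ Real.exp 1 * r ^ 2 + w := by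
  have hw0 : 0 ≤ w := by rw [hw]; positivity
  have hb0 : 0 ≤ b := by
    rw [hb]; exact mul_nonneg (by linarith) (Real.exp_pos _).le
  rcases le_or_gt (3 * x * l) 1 with h | h
  · have := mul_le_mul_of_nonneg_left (Real.exp_le_exp.2 h) (sq_nonneg r)
    linarith
  · have h1 : r ^ 2 ≤ l * b := by
      have h2 : r ^ 2 * 1 ≤ r ^ 2 * (3 * x * l) := mul_le_mul_of_nonneg_left h.le (sq_nonneg r)
      have h3 : r ^ 2 * (3 * x * l) ≤ Real.pi * r ^ 2 * x * l := by
        have : 3 * (r ^ 2 * x * l) ≤ Real.pi * (r ^ 2 * x * l) :=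
          mul_le_mul_of_nonneg_right Real.pi_gt_three.le (by positivity)
        linarith
      rw [heq] at h3
      linarith
    have h4 : Real.exp (3 * x * l) ≤ Real.exp (l / 2) := by
      refine Real.exp_le_exp.2 ?_
      nlinarith
    have h5 : r ^ 2 * Real.exp (3 * x * l) ≤ l * b * Real.exp (l / 2) :=
      mul_le_mul h1 h4 (Real.exp_pos _).le (by positivity)
    have h6 : l * b * Real.exp (l / 2) = l * (l + c) * Real.exp (-(l / 2)) := by
      rw [hb, show -(l / 2) = -l + l / 2 by ring, Real.exp_add]; ring
    have h7 : l * (l + c) * Real.exp (-(l / 2)) ≤ w := by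
      rw [hw]
      refine mul_le_mul (by nlinarith) (Real.exp_le_exp.2 (by linarith)) (Real.exp_pos _).le
        (by positivity)
    have : 0 ≤ Real.exp 1 * r ^ 2 := by positivity
    linarith

/-- The multiplier `t / s` is optimal and gives `t² / s`. Bounding `e` by `10 t / 9`, and by `1`
beside `t²`, yields `e s ≤ (10/9 + 3/2 + 10/81) t²`, which is below `4 t²`. -/
theorem second_moment_bound {e t s ρ : ℝ} (he : 0 < e) (he1 : e ≤ 1) (ht : 9 / 10 * e ≤ t)
    (hρ : ρ ≤ e / 10) (hs : s ≤ t + 3 / 2 * t ^ 2 + ρ) (hs0 : 0 < s) :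
    e / 4 ≤ 2 * (t / s) * t - (t / s) ^ 2 * s := by
  have h1 : 2 * (t / s) * t - (t / s) ^ 2 * s = t ^ 2 / s := by
    field_simp; ring
  rw [h1, le_div_iff₀ hs0]
  have ht0 : 0 < t := by linarith
  have h2 : e * s ≤ e * (t + 3 / 2 * t ^ 2 + e / 10) :=
    mul_le_mul_of_nonneg_left (by linarith) he.le
  have h3 : e * t ≤ 10 / 9 * t * t := mul_le_mul_of_nonneg_right (by linarith) ht0.le
  have h4 : e * t ^ 2 ≤ 1 * t ^ 2 := mul_le_mul_of_nonneg_right he1 (sq_nonneg t)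
  have h5 : e * e ≤ 10 / 9 * t * (10 / 9 * t) :=
    mul_le_mul (by linarith) (by linarith) he.le (by linarith)
  nlinarith

theorem probDisconnected_ge_second_moment {n P K : ℕ} {r p a : ℝ} (hn : 2 ≤ n) (h : 2 * K ≤ P)
    (hP : 0 < P) (hr : 0 < r) (hr2 : r ≤ 1 / 2) (hp : p = linkProb P K)
    (ha : a = Real.pi * r ^ 2 * p) (ha2 : a ≤ 1 / 2) {t s : ℝ}
    (ht : t = n * ((1 - a) ^ (n - 1) * (1 - 2 * r) ^ 2))
    (hs : s = t + (n : ℝ) ^ 2 * ((1 - 2 * a) ^ (n - 2) * ((1 - 2 * r) ^ 2) ^ 2 +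
      (1 - (2 - p) * a) ^ (n - 2) * (4 * (Real.pi * r ^ 2)) +
      (1 - 5 / 4 * a) ^ (n - 2) * (4 * a))) (q : ℝ) :
    2 * q * t - q ^ 2 * s ≤ probDisconnected n P K r := by
  have hKP : K ≤ P := by omega
  have hprob := networkLaw_isProbabilityMeasure (n := n) hKP
  have hp0 : 0 ≤ p := hp ▸ linkProb_nonneg hKP hP
  have hp1 : p ≤ 1 := hp ▸ linkProb_le_one P K
  have ha0 : 0 ≤ a := by rw [ha]; positivity
  have hsm := measureReal_iUnion_ge (networkLaw n P K) (isolatedInner n P K r)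
    (measurableSet_isolatedInner r) q
  have hone : ∀ i : Fin n, (networkLaw n P K).real (isolatedInner n P K r i) =
      (1 - a) ^ (n - 1) * (1 - 2 * r) ^ 2 := by
    intro i
    rw [networkLaw_real_isolatedInner hKP hr.le hr2, ha, hp]
  have hsum : ∑ i : Fin n, (networkLaw n P K).real (isolatedInner n P K r i) = t := by
    simp_rw [hone]
    rw [Finset.sum_const, Finset.card_univ, Fintype.card_fin, nsmul_eq_mul, ht]
  set B : ℝ := (1 - 2 * a) ^ (n - 2) * ((1 - 2 * r) ^ 2) ^ 2 +
      (1 - (2 - p) * a) ^ (n - 2) * (4 * (Real.pi * r ^ 2)) +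
      (1 - 5 / 4 * a) ^ (n - 2) * (4 * a) with hB
  have hB0 : 0 ≤ B := by
    have h1 : 0 ≤ 1 - 2 * a := by linarith
    have h2 : 0 ≤ 1 - (2 - p) * a := by nlinarith
    have h3 : 0 ≤ 1 - 5 / 4 * a := by linarith
    positivity
  -- Allowing `B` on the diagonal as well makes the double sum simply `t + n² B`.
  have hpair : ∀ i j : Fin n, (networkLaw n P K).real
      (isolatedInner n P K r i ∩ isolatedInner n P K r j) ≤
      (if i = j then (1 - a) ^ (n - 1) * (1 - 2 * r) ^ 2 else 0) + B := by
    intro i j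
    by_cases hij : i = j
    · subst hij
      rw [Set.inter_self, hone, if_pos rfl]
      linarith
    · rw [if_neg hij, zero_add]
      exact networkLaw_real_isolatedInner_inter_le h hP hr hr2 hp ha ha2 hij
  have hsum2 : ∑ i : Fin n, ∑ j : Fin n, (networkLaw n P K).real
      (isolatedInner n P K r i ∩ isolatedInner n P K r j) ≤ s := by
    refine (Finset.sum_le_sum fun i _ => Finset.sum_le_sum fun j _ => hpair i j).trans ?_
    simp only [Finset.sum_add_distrib, Finset.sum_ite_eq, Finset.mem_univ, if_true,
      Finset.sum_const, Finset.card_univ, Fintype.card_fin, nsmul_eq_mul]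
    rw [hs, ht]
    linarith
  rw [hsum] at hsm
  have h2 := mul_le_mul_of_nonneg_left hsum2 (sq_nonneg q)
  have h3 : (networkLaw n P K).real (⋃ i, isolatedInner n P K r i) ≤ probDisconnected n P K r :=
    measureReal_mono (iUnion_isolatedInner_subset hn r) (measure_ne_top _ _)
  linarith

set_option maxHeartbeats 1000000 in
-- The single quantity `w` controls every error that vanishes with `log n`; its rate `e^{-l/8}`
-- comes from the near pairs with a common key, and the square of `l + c` from `sq_mul_exp_le`.
theorem probDisconnected_ge_of_large {n P K : ℕ} {r c l x b w : ℝ} (hc : 0 < c)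
    (hl : l = Real.log n) (hl1 : 1 ≤ l) (h : 2 * K ≤ P) (hK : 0 < K) (hr : 0 < r)
    (hr2 : r ≤ 1 / 2) (hx : x = (K : ℝ) ^ 2 / P) (hx20 : x ≤ 1 / 20)
    (hb : b = (l + c) / n) (heq : Real.pi * r ^ 2 * x = b)
    (hw : w = (l + c) ^ 2 * Real.exp (-(l / 8))) (hw10 : w ≤ 1 / 10)
    (hmain : 9 / 10 ≤ (1 - 2 * r) ^ 2 * Real.exp (-(2 * w)))
    (hrest : 4 * Real.pi * Real.exp 4 * (Real.exp 1 * r ^ 2 + w) + 4 * Real.exp 3 * w ≤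
      Real.exp (-c) / 10) :
    Real.exp (-c) / 4 ≤ probDisconnected n P K r := by
  have hKP : K ≤ P := by omega
  have hP : 0 < P := by omega
  have hP' : (0 : ℝ) < P := by exact_mod_cast hP
  have hn0 : 0 < n := by
    rcases Nat.eq_zero_or_pos n with h0 | h0
    · rw [h0] at hl; simp at hl; linarith
    · exact h0
  have hn' : (0 : ℝ) < n := by exact_mod_cast hn0
  have hln : (n : ℝ) = Real.exp l := by rw [hl, Real.exp_log hn']
  have hn2 : 2 ≤ n := by
    have : (2 : ℝ) ≤ n := by
      rw [hln]; linarith [Real.add_one_le_exp l]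
    exact_mod_cast this
  have hx0 : 0 < x := by rw [hx]; positivity
  have hnb : n * b = l + c := by rw [hb]; field_simp
  have hb' : b = (l + c) * Real.exp (-l) := by
    rw [hb, hln, Real.exp_neg, div_eq_mul_inv]
  have hlc : 1 ≤ l + c := by linarith
  have hlc2 : l + c ≤ (l + c) ^ 2 := by nlinarith
  have hb0 : 0 < b := by rw [hb']; positivity
  have hlb : (l + c) * b ≤ w := by
    rw [hb', hw, ← mul_assoc, ← sq]
    exact mul_le_mul_of_nonneg_left (Real.exp_le_exp.2 (by linarith)) (sq_nonneg _)
  have hbw : b ≤ w := (le_mul_of_one_le_left hb0.le hlc).trans hlb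
  have hb10 : b ≤ 1 / 10 := hbw.trans hw10
  obtain ⟨p, hp⟩ : ∃ p, p = linkProb P K := ⟨_, rfl⟩
  obtain ⟨a, ha⟩ : ∃ a, a = Real.pi * r ^ 2 * p := ⟨_, rfl⟩
  have hpx : p ≤ x := by rw [hp, hx]; exact linkProb_le hKP hP
  have hxp : x / (1 + x) ≤ p := by rw [hp, hx]; exact linkProb_ge hKP hP
  have hp0 : 0 ≤ p := le_trans (by positivity) hxp
  have hπr : 0 < Real.pi * r ^ 2 := by positivity
  have hab : a ≤ b := by
    rw [ha, ← heq]
    exact mul_le_mul_of_nonneg_left hpx hπr.le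
  have hba : b ≤ (1 + x) * a := by
    have h1 : x ≤ (1 + x) * p := by
      rw [div_le_iff₀ (by linarith)] at hxp
      linarith
    rw [ha, ← heq]
    have := mul_le_mul_of_nonneg_left h1 hπr.le
    linarith
  have ha0 : 0 ≤ a := by rw [ha]; positivity
  have ha10 : a ≤ 1 / 10 := hab.trans hb10
  obtain ⟨t, ht⟩ : ∃ t : ℝ, t = n * ((1 - a) ^ (n - 1) * (1 - 2 * r) ^ 2) := ⟨_, rfl⟩
  have ht1 : 9 / 10 * Real.exp (-c) ≤ t := by
    have h1 : Real.exp (-(l + c + 2 * w)) ≤ (1 - a) ^ (n - 1) := by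
      calc Real.exp (-(l + c + 2 * w)) ≤ Real.exp (-(n * (b + 2 * b ^ 2))) := by
            refine Real.exp_le_exp.2 ?_
            have : n * (b + 2 * b ^ 2) = l + c + 2 * ((l + c) * b) := by
              rw [← hnb]; ring
            linarith
        _ ≤ (1 - b) ^ n := exp_neg_le_one_sub_pow (by linarith) n
        _ ≤ (1 - b) ^ (n - 1) :=
            pow_le_pow_of_le_one (by linarith) (by linarith) (Nat.sub_le n 1)
        _ ≤ (1 - a) ^ (n - 1) := pow_le_pow_left₀ (by linarith) (by linarith) _
    have h2 : n * Real.exp (-(l + c + 2 * w)) = Real.exp (-c) * Real.exp (-(2 * w)) := by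
      rw [hln, ← Real.exp_add, ← Real.exp_add]; congr 1; ring
    calc 9 / 10 * Real.exp (-c) ≤ (1 - 2 * r) ^ 2 * Real.exp (-(2 * w)) * Real.exp (-c) :=
          mul_le_mul_of_nonneg_right hmain (Real.exp_pos _).le
      _ = n * (Real.exp (-(l + c + 2 * w)) * (1 - 2 * r) ^ 2) := by
          rw [← mul_assoc, h2]; ring
      _ ≤ t := by
          rw [ht]
          gcongr
  have hcast : ((n - 2 : ℕ) : ℝ) = n - 2 := by
    rw [Nat.cast_sub hn2]; norm_num
  have hn2l : (n : ℝ) ^ 2 = Real.exp (2 * l) := by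
    rw [hln, ← Real.exp_nat_mul]; norm_num
  -- As `1 - 2 a ≤ (1 - a)²`, the excess over `t²` is only `(1 - a)⁻²`, at most `100/81`.
  have T1 : (n : ℝ) ^ 2 * ((1 - 2 * a) ^ (n - 2) * ((1 - 2 * r) ^ 2) ^ 2) ≤ 3 / 2 * t ^ 2 := by
    have h1 : (1 - 2 * a) ^ (n - 2) ≤ ((1 - a) ^ 2) ^ (n - 2) := by
      refine pow_le_pow_left₀ (by linarith) ?_ _
      linarith [sq_nonneg a]
    have h2 : ((1 - a) ^ (n - 1)) ^ 2 = ((1 - a) ^ 2) ^ (n - 2) * (1 - a) ^ 2 := by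
      rw [← pow_mul, ← pow_mul, ← pow_add]
      congr 1
      omega
    have h3 : 81 / 100 ≤ (1 - a) ^ 2 := by
      have := pow_le_pow_left₀ (by norm_num) (show 9 / 10 ≤ 1 - a by linarith) 2
      linarith
    have h4 : 0 ≤ ((1 - a) ^ 2) ^ (n - 2) := by positivity
    have h5 : (1 - 2 * a) ^ (n - 2) ≤ 3 / 2 * ((1 - a) ^ (n - 1)) ^ 2 := by
      rw [h2]
      have := mul_le_mul_of_nonneg_left h3 h4
      linarith
    have h6 : 3 / 2 * t ^ 2 = (n : ℝ) ^ 2 * (3 / 2 * ((1 - a) ^ (n - 1)) ^ 2 *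
        ((1 - 2 * r) ^ 2) ^ 2) := by
      rw [ht]; ring
    rw [h6]
    gcongr
  have T2 : (n : ℝ) ^ 2 * ((1 - (2 - p) * a) ^ (n - 2) * (4 * (Real.pi * r ^ 2))) ≤
      4 * Real.pi * Real.exp 4 * (Real.exp 1 * r ^ 2 + w) := by
    -- Passing from `a` to `b` costs `1 + x`, and `(2 - 3x)(1 + x) = 2 - x - 3x² ≤ 2 - p`.
    have hy : (2 - 3 * x) * b ≤ (2 - p) * a := by
      have h1 : (2 - 3 * x) * b ≤ (2 - 3 * x) * ((1 + x) * a) :=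
        mul_le_mul_of_nonneg_left hba (by linarith)
      have h2 : (2 - 3 * x) * (1 + x) ≤ 2 - p := by linarith [sq_nonneg x]
      have h3 := mul_le_mul_of_nonneg_right h2 ha0
      linarith
    have hy1 : (2 - p) * a ≤ 1 := by
      have := mul_nonneg hp0 ha0
      linarith
    have hpow : (1 - (2 - p) * a) ^ (n - 2) ≤
        Real.exp (-((2 - 3 * x) * (l + c)) + 4) := by
      refine (one_sub_pow_le_exp hy1 _).trans (Real.exp_le_exp.2 ?_)
      rw [hcast]
      have h1 := mul_le_mul_of_nonneg_left hy (show (0 : ℝ) ≤ n - 2 by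
        rw [← hcast]; positivity)
      have h2 : (n - 2) * ((2 - 3 * x) * b) = (2 - 3 * x) * (l + c) - 2 * ((2 - 3 * x) * b) := by
        rw [← hnb]; ring
      have h3 : (2 - 3 * x) * b ≤ 2 * b := mul_le_mul_of_nonneg_right (by linarith) hb0.le
      linarith
    have hexp : (n : ℝ) ^ 2 * Real.exp (-((2 - 3 * x) * (l + c)) + 4) ≤
        Real.exp 4 * Real.exp (3 * x * l) := by
      rw [hn2l, ← Real.exp_add, ← Real.exp_add]
      refine Real.exp_le_exp.2 ?_
      have : 0 ≤ (2 - 3 * x) * c := mul_nonneg (by linarith) hc.le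
      linarith
    have hsq := sq_mul_exp_le hc hl1 hx0 hx20 hb' heq hw
    calc (n : ℝ) ^ 2 * ((1 - (2 - p) * a) ^ (n - 2) * (4 * (Real.pi * r ^ 2)))
        ≤ (n : ℝ) ^ 2 * (Real.exp (-((2 - 3 * x) * (l + c)) + 4) * (4 * (Real.pi * r ^ 2))) := by
          gcongr
      _ = (n : ℝ) ^ 2 * Real.exp (-((2 - 3 * x) * (l + c)) + 4) * (4 * (Real.pi * r ^ 2)) := by
          ring
      _ ≤ Real.exp 4 * Real.exp (3 * x * l) * (4 * (Real.pi * r ^ 2)) := by gcongr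
      _ = 4 * Real.pi * Real.exp 4 * (r ^ 2 * Real.exp (3 * x * l)) := by ring
      _ ≤ _ := by gcongr
  have T3 : (n : ℝ) ^ 2 * ((1 - 5 / 4 * a) ^ (n - 2) * (4 * a)) ≤ 4 * Real.exp 3 * w := by
    -- Any exponent above `1` would do; `9/8` absorbs the factor `1 + x ≤ 21/20` and leaves `n²
    -- n^{-9/8} b`, which is `(l + c) e^{-l/8}`.
    have hy : 9 / 8 * b ≤ 5 / 4 * a := by
      have := mul_le_mul_of_nonneg_right hx20 ha0
      linarith
    have hpow : (1 - 5 / 4 * a) ^ (n - 2) ≤ Real.exp (-(9 / 8 * l) + 3) := by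
      refine (one_sub_pow_le_exp (by linarith) _).trans (Real.exp_le_exp.2 ?_)
      rw [hcast]
      have h1 := mul_le_mul_of_nonneg_left hy (show (0 : ℝ) ≤ n - 2 by
        rw [← hcast]; positivity)
      have h2 : (n - 2) * (9 / 8 * b) = 9 / 8 * (l + c) - 9 / 4 * b := by
        rw [← hnb]; ring
      linarith
    calc (n : ℝ) ^ 2 * ((1 - 5 / 4 * a) ^ (n - 2) * (4 * a))
        ≤ (n : ℝ) ^ 2 * (Real.exp (-(9 / 8 * l) + 3) * (4 * b)) := by gcongr
      _ = 4 * ((n * Real.exp (-(9 / 8 * l) + 3)) * (n * b)) := by ring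
      _ = 4 * Real.exp 3 * ((l + c) * Real.exp (-(l / 8))) := by
          rw [hnb, hln, ← Real.exp_add,
            show l + (-(9 / 8 * l) + 3) = 3 + -(l / 8) by ring, Real.exp_add]
          ring
      _ ≤ 4 * Real.exp 3 * ((l + c) ^ 2 * Real.exp (-(l / 8))) := by gcongr
      _ = _ := by rw [hw]
  obtain ⟨s, hs⟩ : ∃ s : ℝ, s = t + (n : ℝ) ^ 2 * ((1 - 2 * a) ^ (n - 2) *
      ((1 - 2 * r) ^ 2) ^ 2 + (1 - (2 - p) * a) ^ (n - 2) * (4 * (Real.pi * r ^ 2)) +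
      (1 - 5 / 4 * a) ^ (n - 2) * (4 * a)) := ⟨_, rfl⟩
  have hfin := probDisconnected_ge_second_moment hn2 h hP hr hr2 hp ha (by linarith) ht hs (t / s)
  refine le_trans (second_moment_bound (Real.exp_pos _) (Real.exp_le_one_iff.2 (by linarith)) ht1
    hrest ?_ ?_) hfin
  · rw [hs]
    linarith
  · have h1 : 0 ≤ 1 - 2 * a := by linarith
    have h2 : 0 ≤ 1 - (2 - p) * a := by
      have := mul_nonneg hp0 ha0
      linarith
    have h3 : 0 ≤ 1 - 5 / 4 * a := by linarith
    have h4 : 0 < t := lt_of_lt_of_le (by positivity) ht1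
    rw [hs]
    positivity

theorem eventually_probDisconnected_ge (K P : ℕ → ℕ) (r : ℕ → ℝ)
    (hr_pos : ∀ᶠ n in atTop, 0 < r n) (hr_lim : Tendsto r atTop (𝓝 0))
    (hK_lim : Tendsto K atTop atTop)
    (hKP_lim : Tendsto (fun n => (K n : ℝ) ^ 2 / (P n : ℝ)) atTop (𝓝 0))
    (hPK : ∀ᶠ n in atTop, 2 * K n ≤ P n) (c : ℝ) (hc : 0 < c)
    (hdeg : ∀ᶠ n : ℕ in atTop,
      Real.pi * r n ^ 2 * ((K n : ℝ) ^ 2 / (P n : ℝ)) = (Real.log n + c) / (n : ℝ)) :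
    ∀ᶠ n in atTop, Real.exp (-c) / 4 ≤ probDisconnected n (P n) (K n) (r n) := by
  have hlog : Tendsto (fun n : ℕ => Real.log n) atTop atTop :=
    Real.tendsto_log_atTop.comp tendsto_natCast_atTop_atTop
  have hw : Tendsto (fun n : ℕ => (Real.log n + c) ^ 2 * Real.exp (-(Real.log n / 8))) atTop
      (𝓝 0) := by
    have h1 : Tendsto (fun y : ℝ => y ^ (2 : ℝ) * Real.exp (-(1 / 8) * y)) atTop (𝓝 0) :=
      tendsto_rpow_mul_exp_neg_mul_atTop_nhds_zero 2 (1 / 8) (by norm_num)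
    have h2 : Tendsto (fun n : ℕ => Real.log n + c) atTop atTop :=
      tendsto_atTop_add_const_right _ c hlog
    have h3 := (h1.comp h2).const_mul (Real.exp (c / 8))
    rw [mul_zero] at h3
    refine h3.congr fun n => ?_
    simp only [Function.comp_apply]
    rw [Real.rpow_two, show -(Real.log n / 8) = c / 8 + -(1 / 8) * (Real.log n + c) by ring,
      Real.exp_add]
    ring
  have hmain : Tendsto (fun n : ℕ => (1 - 2 * r n) ^ 2 *
      Real.exp (-(2 * ((Real.log n + c) ^ 2 * Real.exp (-(Real.log n / 8)))))) atTop (𝓝 1) := by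
    have h1 := ((hr_lim.const_mul 2).const_sub 1).pow 2
    have h2 := (Real.continuous_exp.tendsto _).comp ((hw.const_mul 2).neg)
    simpa using h1.mul h2
  have hrest : Tendsto (fun n : ℕ => 4 * Real.pi * Real.exp 4 * (Real.exp 1 * r n ^ 2 +
      (Real.log n + c) ^ 2 * Real.exp (-(Real.log n / 8))) +
      4 * Real.exp 3 * ((Real.log n + c) ^ 2 * Real.exp (-(Real.log n / 8)))) atTop (𝓝 0) := by
    have h1 := ((((hr_lim.pow 2).const_mul (Real.exp 1)).add hw).const_mul
      (4 * Real.pi * Real.exp 4)).add (hw.const_mul (4 * Real.exp 3))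
    simpa using h1
  filter_upwards [hr_pos, hr_lim.eventually_le_const (show (0 : ℝ) < 1 / 2 by norm_num), hPK,
    hK_lim.eventually_ge_atTop 1, hKP_lim.eventually_le_const (show (0 : ℝ) < 1 / 20 by norm_num),
    hlog.eventually_ge_atTop 1, hdeg, hw.eventually_le_const (show (0 : ℝ) < 1 / 10 by norm_num),
    hmain.eventually_const_le (show (9 / 10 : ℝ) < 1 by norm_num),
    hrest.eventually_le_const (show 0 < Real.exp (-c) / 10 by positivity)]
    with n h1 h2 h3 h4 h5 h6 h7 h8 h9 h10
  exact probDisconnected_ge_of_large hc rfl h6 h3 h4 h1 h2 rfl h5 rfl h7 rfl h8 h9 h10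

end DisconnectednessAsymptotics

end

/-! ### The theorem -/

theorem theorem3 (K P : ℕ → ℕ) (r : ℕ → ℝ) (σ : ℝ) (hσ : 0 < σ)
    (hr_pos : ∀ᶠ n in atTop, 0 < r n)
    (hr_lim : Tendsto r atTop (𝓝 0))
    (hK_two : ∀ᶠ n in atTop, 2 ≤ K n)
    (hK_lim : Tendsto K atTop atTop)
    (hP_lim : Tendsto P atTop atTop)
    (hKP_lim : Tendsto (fun n => (K n : ℝ) ^ 2 / (P n : ℝ)) atTop (𝓝 0))
    (hPK : ∀ᶠ n in atTop, 2 * K n ≤ P n)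
    (hPσ : ∀ᶠ n : ℕ in atTop, σ * (n : ℝ) * r n ^ 2 ≤ (P n : ℝ)) :
    (∀ c₁ : ℝ, 0 < c₁ →
      (∀ᶠ n : ℕ in atTop,
        Real.pi * r n ^ 2 * ((K n : ℝ) ^ 2 / (P n : ℝ)) = (Real.log n + c₁) / (n : ℝ)) →
      Real.exp (-c₁) / 4 ≤ liminf (fun n => probDisconnected n (P n) (K n) (r n)) atTop) ∧
    (∀ δ : ℝ, 0 < δ → δ < 1 →
      (∀ᶠ n : ℕ in atTop,
        2 * Real.pi / (1 - δ) * (Real.log n / (n : ℝ)) <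
          Real.pi * r n ^ 2 * ((K n : ℝ) ^ 2 / (P n : ℝ))) →
      (∃ c₂ c₃ : ℝ, 0 < c₂ ∧ 0 < c₃ ∧
        ∀ᶠ n : ℕ in atTop, 1 - c₂ / (n : ℝ) ^ c₃ ≤ probConnected n (P n) (K n) (r n)) ∧
      Tendsto (fun n => probConnected n (P n) (K n) (r n)) atTop (𝓝 1)) := by
  refine ⟨fun c hc hdeg => ?_, fun δ hδ hδ1 hdeg => ?_⟩
  · refine le_liminf_of_le ?_ (eventually_probDisconnected_ge K P r hr_pos hr_lim hK_lim hKP_lim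
      hPK c hc hdeg)
    -- The real `liminf` is meaningful only for a sequence that does not tend to infinity;
    -- probabilities are at most `1`.
    refine IsBoundedUnder.isCoboundedUnder_ge ⟨1, ?_⟩
    rw [eventually_map]
    filter_upwards [hPK] with n hn
    have := networkLaw_isProbabilityMeasure (n := n) (show K n ≤ P n by omega)
    exact measureReal_le_one
  · have h := eventually_probConnected_ge K P r σ hσ hr_pos hr_lim hK_lim hKP_lim hPK hPσ δ hδ hδ1
      hdeg
    exact ⟨⟨28, δ / 2, by norm_num, by linarith, h⟩,
      tendsto_one_of_eventually_ge K P r hPK (by linarith) h⟩
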